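/- Let $\alpha,\delta>0$ and $\lambda\in(\lambda^*,\alpha\delta)$, where $\lambda^*=\alpha\delta\big/\big(1+\frac{\delta/\alpha}{1/(4\delta)+1/\sqrt{2\alpha}}\big)$. Put $f_0=\frac1{\sqrt{2\alpha}}\Big(\sqrt{\frac{\alpha\delta+\lambda}{\alpha\delta-\lambda}}-1\Big)$, $B_0=-\frac{2f_0}{\alpha\sqrt{2\alpha}}(\alpha\delta-\lambda)e^{f_0\sqrt{2\alpha}}$, $\rho(x)=x^2+\frac{2x}{\sqrt{2\alpha}}-\frac{\lambda/\alpha}{\alpha\delta-\lambda}$, $$h_1(x)=\tfrac{\alpha\delta-\lambda}{2\alpha}e^{-x\sqrt{2\alpha}}\rho(x),\qquad h_2(x)=\tfrac{\alpha\delta-\lambda}{2\alpha}e^{x\sqrt{2\alpha}}\Big(\rho(x)-\tfrac{4x}{\sqrt{2\alpha}}\Big),$$ $$h_3(x)=\tfrac\lambda\alpha\Big(\tfrac\alpha{2\lambda}-x-\tfrac1{\sqrt{2\alpha}}\Big)e^{-x\sqrt{2\alpha}},\qquad h_4(x)=\tfrac\lambda\alpha\Big(x-\tfrac\alpha{2\lambda}-\tfrac1{\sqrt{2\alpha}}\Big)e^{x\sqrt{2\alpha}},$$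 $q(x;z)=\sqrt{2\alpha}\,(h_2(z)-h_1(z)e^{2z\sqrt{2\alpha}})+h_3(x)e^{2z\sqrt{2\alpha}}-h_4(x)$, and let $\widetilde V_0(x)=\delta x^2$ for $0\le x\le f_0$, $\widetilde V_0(x)=B_0e^{-x\sqrt{2\alpha}}+\frac\lambda\alpha x^2+\frac\lambda{\alpha^2}$ for $x>f_0$. Let $c_{\mathcal I}\ge0$, $\bar c>0$, and suppose that $\frac{\alpha}{2\lambda}\le f_0$ if $c_{\mathcal I}=0$. Let $F:[0,\infty)\to(0,\infty)$ and $G:(0,\infty)\to(0,\infty)$ be continuous on $(0,\infty)$ and of class $C^1$ on $(0,\infty)\setminus\{\bar c\}$, let $\bar F,\bar G:(0,c_{\mathcal I}]\to(0,\infty)$ be continuous and of class $C^1$ on $(0,c_{\mathcal I})$, and suppose that * $F'(c)<0$ for $c>0$, $c\ne\bar c$; $G'(c)>1$ and $q(G(c);F(c))>0$ for $0<c<\bar c$; $G'(c)\in(0,1)$ and $G(c)\ge\frac\alpha{2\lambda}$ for $c>\bar c$; $\lim_{c\to0}F(c)\le\frac1{2\delta}\le\lim_{c\to0}G(c)$;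 * $\bar F'(c)\in(0,1)$ and $\bar G'(c)<0$ for $0<c<c_{\mathcal I}$; $G(c)<\bar F(c)$ for $0<c\le c_{\mathcal I}$; and, if $c_{\mathcal I}>0$, $\lim_{c\to0}\bar F(c)=f_0$, $g_0:=\lim_{c\to0}\bar G(c)\in\big(\frac\alpha{2\lambda},\frac\alpha{2\lambda}+\frac1{\sqrt{2\alpha}}\big)$ and $\bar F(c_{\mathcal I})=\bar G(c_{\mathcal I})=\frac\alpha{2\lambda}$. Define the regions ${\rm I}=\{c>0,\,0\le x\le F(c)\}$, ${\rm II}=\{c>0,\,F(c)<x<G(c)\}$, ${\rm III}=\{0<c<c_{\mathcal I},\,\bar F(c)<x<\bar G(c)\}$, ${\rm IV}=\{c>0,\,x\ge G(c)\}\setminus{\rm III}$, and $\zeta(x,c)=\inf\{u\in(0,c]:(x-u,c-u)\notin{\rm IV}\}$. Let $\widetilde Q$ be a continuous function on $[0,\infty)^2$ with $\widetilde Q(\cdot,0)=\widetilde V_0$ such that, for some functions $A,B,\widetilde A,\widetilde B$ of $c$, * $\widetilde Q(x,c)=\delta x^2$ on ${\rm I}$; * $\widetilde Q(x,c)=A(c)e^{x\sqrt{2\alpha}}+B(c)e^{-x\sqrt{2\alpha}}+\frac\lambda\alpha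 x^2+\frac\lambda{\alpha^2}$ on ${\rm II}$, and likewise on ${\rm III}$ with $\widetilde A,\widetilde B$ in place of $A,B$; * $\widetilde Q(x,c)=\widetilde Q(x-\zeta(x,c),c-\zeta(x,c))+\zeta(x,c)$ on ${\rm IV}$. Suppose that the following smooth fit conditions hold. * SF1: $\widetilde Q(\cdot,c)$ is continuously differentiable in a neighbourhood of $F(c)$ for $c>0$, of $\bar F(c)$ for $0<c<c_{\mathcal I}$, and of $G(c)$ for $0<c\le\bar c$. * SF2: for $R=\bar G$ and $0<c<c_{\mathcal I}$, and for $R=G$ and $c>\bar c$, the partial derivatives of $\widetilde Q$ exist at $(x,c)$ for all $x\neq R(c)$ near $R(c)$, and $x\mapsto(\frac{\partial}{\partial x}+\frac{\partial}{\partial c})\widetilde Q(x,c)$ extends to a continuously differentiable function in a neighbourhood of $R(c)$. Extend $\widetilde Q$ to $\mathbb R\times[0,\infty)$ by $\widetilde Q(x,c)=\widetilde Q(|x|,c)$. Let the boundaries $b_i$ be $F$ and $G$ (on $c>0$), $\bar F$ and $\bar G$ (on $0<c\le c_{\mathcal I}$) and the lines $x=f_0+c$ ($c\ge0$), $x=G(\bar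 c)+c-\bar c$ ($c\ge\bar c$) and, if $c_{\mathcal I}>0$, $x=g_0+c$ ($c\ge0$) and $x=\frac{\alpha}{2\lambda}-c_{\mathcal I}+c$ ($c\ge c_{\mathcal I}$). Write $\mathcal R_c=\mathbb R\setminus\{\pm b_i(c)\}$, the union being over the $b_i$ that are defined at $c$, and $\mathcal L=\frac12\frac{\partial^2}{\partial x^2}$. Then $\widetilde Q$ and these boundaries satisfy all conditions of the verification theorem: * the $b_i$ are piecewise $C^1$; $\widetilde Q$ is even in $x$, continuous on $\mathbb R\times[0,\infty)$ and continuously differentiable on $\mathbb R\times(0,\infty)$; for every $c\ge0$, $\widetilde Q(\cdot,c)$ is $C^2$ on $\mathcal R_c$, and $\frac{\partial^2\widetilde Q}{\partial x^2}$ is locally bounded on $\{(x,c):c\ge0,\ x\in\mathcal R_c\}$, near every point of $\mathbb R\times[0,\infty)$; * there is a continuous increasing $K:[0,\infty)\to(0,\infty)$ such that $\frac{\partial\widetilde Q}{\partial x}$ exists and $|\frac{\partial\widetilde Q}{\partial x}(x,c)|\le K(c)(1+|x|)$ for all $x\in\mathbb R$, $c\ge0$; * $\widetilde Q(x,c)\le\delta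 x^2$ for $x\in\mathbb R$, $c\ge0$; * $|\frac{\partial\widetilde Q}{\partial x}|+\frac{\partial\widetilde Q}{\partial c}\le1$ at $(x,c)$ for $x\in\mathbb R$, $c>0$; * $(\mathcal L-\alpha)\widetilde Q(x,c)+\lambda x^2\ge0$ for $x\in\mathcal R_c$, $c\ge0$; * $[\delta x^2-\widetilde Q]\,\big[1-|\frac{\partial\widetilde Q}{\partial x}|-\frac{\partial\widetilde Q}{\partial c}\big]\,[(\mathcal L-\alpha)\widetilde Q+\lambda x^2]=0$ at $(x,c)$ for $x\in\mathcal R_c$, $c>0$. -/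

import Mathlib

open Set Filter Topology

noncomputable section

namespace FuelControl

/-! ### Constants and auxiliary functions -/

/-- The lower threshold `λ*` of the parameter regime. -/
def lamStar (α δ : ℝ) : ℝ :=
  α * δ / (1 + (δ / α) / (1 / (4 * δ) + 1 / √(2 * α)))

/-- The free boundary `f₀` of the problem without fuel. -/
def f0 (α δ lam : ℝ) : ℝ :=
  1 / √(2 * α) * (√((α * δ + lam) / (α * δ - lam)) - 1)

def B0 (α δ lam : ℝ) : ℝ :=
  -(2 * f0 α δ lam / (α * √(2 * α))) * (α * δ - lam) * Real.exp (f0 α δ lam * √(2 * α))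

/-- The value function without fuel, `Q(x,0)`, for `x ≥ 0`. -/
def V0 (α δ lam x : ℝ) : ℝ :=
  if x ≤ f0 α δ lam then δ * x ^ 2
  else B0 α δ lam * Real.exp (-x * √(2 * α)) + lam / α * x ^ 2 + lam / α ^ 2

def rho (α δ lam x : ℝ) : ℝ :=
  x ^ 2 + 2 * x / √(2 * α) - (lam / α) / (α * δ - lam)

def h1 (α δ lam x : ℝ) : ℝ :=
  (α * δ - lam) / (2 * α) * Real.exp (-x * √(2 * α)) * rho α δ lam x

def h2 (α δ lam x : ℝ) : ℝ :=
  (α * δ - lam) / (2 * α) * Real.exp (x * √(2 * α)) * (rho α δ lam x - 4 * x / √(2 * α))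

def h3 (α lam x : ℝ) : ℝ :=
  lam / α * (α / (2 * lam) - (x + 1 / √(2 * α))) * Real.exp (-x * √(2 * α))

def h4 (α lam x : ℝ) : ℝ :=
  lam / α * (x - (α / (2 * lam) + 1 / √(2 * α))) * Real.exp (x * √(2 * α))

/-- The function `q(x; z)`. -/
def q (α δ lam x z : ℝ) : ℝ :=
  √(2 * α) * (h2 α δ lam z - h1 α δ lam z * Real.exp (2 * z * √(2 * α)))
    + h3 α lam x * Real.exp (2 * z * √(2 * α)) - h4 α lam x

/-- The general solution of `½ u'' - α u + λ x² = 0` in the space variable. -/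
def waitSol (α lam a b x : ℝ) : ℝ :=
  a * Real.exp (x * √(2 * α)) + b * Real.exp (-x * √(2 * α)) + lam / α * x ^ 2 + lam / α ^ 2

/-! ### Regions (points are pairs `(x, c)`) -/

def regionI (F : ℝ → ℝ) : Set (ℝ × ℝ) :=
  {p | 0 < p.2 ∧ 0 ≤ p.1 ∧ p.1 ≤ F p.2}

def regionII (F G : ℝ → ℝ) : Set (ℝ × ℝ) :=
  {p | 0 < p.2 ∧ F p.2 < p.1 ∧ p.1 < G p.2}

def regionIII (cI : ℝ) (Fb Gb : ℝ → ℝ) : Set (ℝ × ℝ) :=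
  {p | 0 < p.2 ∧ p.2 < cI ∧ Fb p.2 < p.1 ∧ p.1 < Gb p.2}

def regionIV (cI : ℝ) (G Fb Gb : ℝ → ℝ) : Set (ℝ × ℝ) :=
  {p | 0 < p.2 ∧ G p.2 ≤ p.1} \ regionIII cI Fb Gb

/-- The amount of fuel spent from `(x, c)` in the direction `(-1, -1)` until region IV is left.
For `c > 0` the set contains `u = c`, so that the infimum is a genuine one. -/
def zeta (cI : ℝ) (G Fb Gb : ℝ → ℝ) (x c : ℝ) : ℝ :=
  sInf {u | u ∈ Ioc 0 c ∧ (x - u, c - u) ∉ regionIV cI G Fb Gb}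

/-! ### Hypotheses on the boundaries and on the candidate -/

/-- The assumptions on the boundaries `F, G` on `(0,∞)` and `F̄, Ḡ` on `(0, cI]`; the latter play
no role when `cI = 0`. The number `g0` is the limit of `Ḡ` at `0`. -/
structure AdmissibleBoundaries (α δ lam cI cbar g0 : ℝ) (F G Fb Gb : ℝ → ℝ) : Prop where
  cI_nonneg : 0 ≤ cI
  cbar_pos : 0 < cbar
  F_pos : ∀ c, 0 ≤ c → 0 < F c
  G_pos : ∀ c, 0 < c → 0 < G c
  Fb_pos : ∀ c ∈ Ioc 0 cI, 0 < Fb c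
  Gb_pos : ∀ c ∈ Ioc 0 cI, 0 < Gb c
  F_cont : ContinuousOn F (Ioi 0)
  G_cont : ContinuousOn G (Ioi 0)
  Fb_cont : ContinuousOn Fb (Ioc 0 cI)
  Gb_cont : ContinuousOn Gb (Ioc 0 cI)
  F_C1 : ContDiffOn ℝ 1 F (Ioi 0 \ {cbar})
  G_C1 : ContDiffOn ℝ 1 G (Ioi 0 \ {cbar})
  Fb_C1 : ContDiffOn ℝ 1 Fb (Ioo 0 cI)
  Gb_C1 : ContDiffOn ℝ 1 Gb (Ioo 0 cI)
  F_deriv : ∀ c, 0 < c → c ≠ cbar → deriv F c < 0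
  G_deriv_low : ∀ c ∈ Ioo 0 cbar, 1 < deriv G c
  G_deriv_high : ∀ c, cbar < c → deriv G c ∈ Ioo 0 1
  F_lim : ∃ l, Tendsto F (𝓝[>] 0) (𝓝 l) ∧ l ≤ 1 / (2 * δ)
  G_lim : ∃ l, Tendsto G (𝓝[>] 0) (𝓝 l) ∧ 1 / (2 * δ) ≤ l
  q_pos : ∀ c ∈ Ioo 0 cbar, 0 < q α δ lam (G c) (F c)
  G_ge : ∀ c, cbar < c → α / (2 * lam) ≤ G c
  Fb_deriv : ∀ c ∈ Ioo 0 cI, deriv Fb c ∈ Ioo 0 1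
  Gb_deriv : ∀ c ∈ Ioo 0 cI, deriv Gb c < 0
  G_lt_Fb : ∀ c ∈ Ioc 0 cI, G c < Fb c
  Fb_lim : 0 < cI → Tendsto Fb (𝓝[>] 0) (𝓝 (f0 α δ lam))
  Gb_lim : 0 < cI → Tendsto Gb (𝓝[>] 0) (𝓝 g0)
  g0_mem : 0 < cI → g0 ∈ Ioo (α / (2 * lam)) (α / (2 * lam) + 1 / √(2 * α))
  Fb_end : 0 < cI → Fb cI = α / (2 * lam)
  Gb_end : 0 < cI → Gb cI = α / (2 * lam)

/-- Smooth fit of `Q(·, c)` at the point `x`: it is continuously differentiable near `x`. -/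
def SmoothFit (Q : ℝ → ℝ → ℝ) (x c : ℝ) : Prop :=
  ContDiffAt ℝ 1 (fun y => Q y c) x

/-- Smooth fit of `(∂/∂x + ∂/∂c) Q(·, c)` at the point `x`: the partial derivatives exist on both
sides of `x`, and their sum is there a function that is continuously differentiable near `x`.
Nothing is assumed on the partial derivatives at `x` itself. -/
def DiagSmoothFit (Q : ℝ → ℝ → ℝ) (x c : ℝ) : Prop :=
  ∃ u : ℝ → ℝ, ContDiffAt ℝ 1 u x ∧
    ∀ᶠ y in 𝓝[≠] x, ∃ qx qc : ℝ,
      HasDerivAt (fun z => Q z c) qx y ∧ HasDerivAt (fun d => Q y d) qc c ∧ u y = qx + qc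

/-- `Q` is a continuous function on `[0,∞)²` with the prescribed form on the four regions and on
`c = 0`, and with the smooth fit conditions. -/
structure IsCandidate (α δ lam cI cbar : ℝ) (F G Fb Gb : ℝ → ℝ) (Q : ℝ → ℝ → ℝ) : Prop where
  noFuel : ∀ x, 0 ≤ x → Q x 0 = V0 α δ lam x
  onI : ∀ x c, (x, c) ∈ regionI F → Q x c = δ * x ^ 2
  onII : ∃ A B : ℝ → ℝ, ∀ x c, (x, c) ∈ regionII F G → Q x c = waitSol α lam (A c) (B c) x
  onIII : ∃ A B : ℝ → ℝ, ∀ x c, (x, c) ∈ regionIII cI Fb Gb →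
    Q x c = waitSol α lam (A c) (B c) x
  onIV : ∀ x c, (x, c) ∈ regionIV cI G Fb Gb →
    Q x c = Q (x - zeta cI G Fb Gb x c) (c - zeta cI G Fb Gb x c) + zeta cI G Fb Gb x c
  cont : ContinuousOn (fun p : ℝ × ℝ => Q p.1 p.2) (Ici 0 ×ˢ Ici 0)
  sf1_F : ∀ c, 0 < c → SmoothFit Q (F c) c
  sf1_Fb : ∀ c ∈ Ioo 0 cI, SmoothFit Q (Fb c) c
  sf1_G : ∀ c ∈ Ioc 0 cbar, SmoothFit Q (G c) c
  sf2_Gb : ∀ c ∈ Ioo 0 cI, DiagSmoothFit Q (Gb c) c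
  sf2_G : ∀ c, cbar < c → DiagSmoothFit Q (G c) c

/-- The even extension in the first variable. -/
def evenExt (Q : ℝ → ℝ → ℝ) : ℝ → ℝ → ℝ := fun x c => Q |x| c

/-! ### The conditions of the verification theorem -/

/-- A moving boundary `c ↦ b(c)`, defined on a set of fuel levels. -/
structure MovingBoundary where
  dom : Set ℝ
  val : ℝ → ℝ

/-- The domain is an interval of nonnegative fuel levels, the boundary is continuous at positive
fuel levels, and it is continuously differentiable off finitely many fuel levels. -/
def MovingBoundary.PiecewiseC1 (b : MovingBoundary) : Prop :=
  b.dom.OrdConnected ∧ b.dom ⊆ Ici 0 ∧ ContinuousOn b.val (b.dom ∩ Ioi 0) ∧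
    ∃ S : Set ℝ, S.Finite ∧ ContDiffOn ℝ 1 b.val (interior b.dom \ S)

/-- The set `ℛ_c = ℝ \ {± b_i(c)}`. -/
def offBoundaries {n : ℕ} (b : Fin n → MovingBoundary) (c : ℝ) : Set ℝ :=
  {x | ∀ i, c ∈ (b i).dom → x ≠ (b i).val c ∧ x ≠ -(b i).val c}

/-- `∂Q/∂x (x, c)`. -/
def dx (Q : ℝ → ℝ → ℝ) (x c : ℝ) : ℝ := deriv (fun y => Q y c) x

/-- `∂Q/∂c (x, c)`. -/
def dc (Q : ℝ → ℝ → ℝ) (x c : ℝ) : ℝ := deriv (fun d => Q x d) c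

/-- `∂²Q/∂x² (x, c)`. -/
def dxx (Q : ℝ → ℝ → ℝ) (x c : ℝ) : ℝ := deriv (fun y => dx Q y c) x

/-- `(𝓛 - α) Q (x, c) + λ x²` with `𝓛 = ½ ∂²/∂x²`. -/
def generatorTerm (α lam : ℝ) (Q : ℝ → ℝ → ℝ) (x c : ℝ) : ℝ :=
  1 / 2 * dxx Q x c - α * Q x c + lam * x ^ 2

/-- The conditions that the verification theorem imposes on a function `Q` on `ℝ × [0,∞)` and on a
finite family of boundaries. -/
structure VerificationConditions (α δ lam : ℝ) (Q : ℝ → ℝ → ℝ) {n : ℕ}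
    (b : Fin n → MovingBoundary) : Prop where
  piecewise : ∀ i, (b i).PiecewiseC1
  even : ∀ x c, 0 ≤ c → Q (-x) c = Q x c
  cont : ContinuousOn (fun p : ℝ × ℝ => Q p.1 p.2) (univ ×ˢ Ici 0)
  contDiff : ContDiffOn ℝ 1 (fun p : ℝ × ℝ => Q p.1 p.2) (univ ×ˢ Ioi 0)
  contDiff_two : ∀ c, 0 ≤ c → ∀ x ∈ offBoundaries b c, ContDiffAt ℝ 2 (fun y => Q y c) x
  dxx_locallyBounded : ∀ p ∈ (univ ×ˢ Ici 0 : Set (ℝ × ℝ)), ∃ M : ℝ,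
    ∀ᶠ r in 𝓝 p, 0 ≤ r.2 → r.1 ∈ offBoundaries b r.2 → |dxx Q r.1 r.2| ≤ M
  growth : ∃ K : ℝ → ℝ, ContinuousOn K (Ici 0) ∧ StrictMonoOn K (Ici 0) ∧
    (∀ c, 0 ≤ c → 0 < K c) ∧
    ∀ x c, 0 ≤ c → DifferentiableAt ℝ (fun y => Q y c) x ∧ |dx Q x c| ≤ K c * (1 + |x|)
  le_stop : ∀ x c, 0 ≤ c → Q x c ≤ δ * x ^ 2
  gradient : ∀ x c, 0 < c → |dx Q x c| + dc Q x c ≤ 1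
  generator : ∀ c, 0 ≤ c → ∀ x ∈ offBoundaries b c, 0 ≤ generatorTerm α lam Q x c
  complementarity : ∀ c, 0 < c → ∀ x ∈ offBoundaries b c,
    (δ * x ^ 2 - Q x c) * (1 - |dx Q x c| - dc Q x c) * generatorTerm α lam Q x c = 0

/-- The boundaries `F`, `G`, `F̄`, `Ḡ`, together with the lines of slope one along which the second
derivative may jump because the form of `Q` on region IV is transported along the direction
`(1, 1)`: `x = f₀ + c`, `x = G(c̄) + c - c̄`, and, if `cI > 0`, `x = g₀ + c` and
`x = α / (2λ) - cI + c`. -/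
def boundaries (α δ lam cI cbar g0 : ℝ) (F G Fb Gb : ℝ → ℝ) : Fin 8 → MovingBoundary :=
  ![⟨Ioi 0, F⟩, ⟨Ioi 0, G⟩, ⟨Ioc 0 cI, Fb⟩, ⟨Ioc 0 cI, Gb⟩,
    ⟨Ici 0, fun c => f0 α δ lam + c⟩,
    ⟨Ici cbar, fun c => G cbar + c - cbar⟩,
    ⟨{c | 0 < cI ∧ 0 ≤ c}, fun c => g0 + c⟩,
    ⟨{c | 0 < cI ∧ cI ≤ c}, fun c => α / (2 * lam) - cI + c⟩]

end FuelControl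

end

/-! Spending fuel moves (x, c) down a diagonal to (x - u, c - u), so the analysis rests on the
diagonal derivative D = Q_x + Q_c. On region IV, Q has the local form φ(x - c) + c, whence D = 1. On
II and III, smooth fit at the lower boundary fixes both free constants: Q is `sol 0 (F c)`, tangent
to the stopping payoff δx² at F, respectively `sol c (Fb c)`, tangent at F̄ to δ(x - c)² + c, the
cost of spending all the fuel and then stopping. The profile φ is the square δy², the value without
fuel, or the trace of such a fitted solution on Ḡ or on G (for c > c̄).

Gradient. On II and III, N = 1 - D satisfies N'' = 2αN + 4λx - 2α, whose source changes sign at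
α/(2λ). To the right of that level N ≥ 0 propagates leftwards from the upper boundary, where N = 0
and N' ≤ 0; to the left a minimum principle applies (`solX_add_solC_le_one`). The condition N' ≤ 0
is an equality by SF2 on Ḡ and on G above c̄, and is the hypothesis q > 0 on G below c̄ (`q_eq`,
`slope_G_pos`). The same minimum principle gives Q_x ≥ 0 for x > 0, which removes the absolute
value.

Generator. It vanishes on II and III. Where Q is a fitted square it equals `gap`, which is concave
in x, increases along diagonals beyond α/(2λ), and has its sign on G and F̄ from differentiating the
fit conditions (`gap_G_nonneg`, `gap_Fb_nonneg`); `gap_nonneg` puts these together. Elsewhere on IV,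
SF2 says that D = 1 and D_x = 0 on the foot boundary, so the second-order data of Q in x are carried
unchanged along the diagonal (`Inherits.of_boundary`), and the generator is an explicit nonnegative
quadratic in the distance travelled, since the foot lies beyond α/(2λ).

Smoothness. Across a differentiable boundary, equality of the values and of Q_x forces equality of
the whole gradient (`contDiffAt_glue`). Two points escape this: (G(c̄), c̄), where G may have a
kink, and (α/(2λ), cI), where F̄ and Ḡ meet. There the gradient has a limit along a dense set, and
the singularity is removable (`contDiffAt_of_punctured`).

Comparison with δx². For x ≤ 1/(2δ) the fitted solution increases with its fitting point. For larger
x, D ≤ 1 makes δx² - Q grow as one moves up a diagonal, starting from a point with x = 1/(2δ) or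
with no fuel left (`le_payoff`). -/

open Set Filter Topology

noncomputable section

namespace FuelControl

section

/-! ### One-dimensional calculus -/

/-- If `f` is differentiable at `z` and coincides with `g₁` on the left and with `g₂` on the right
of `z`, then `g₁` and `g₂` have the same value and the same derivative at `z`. -/
theorem fit_of_differentiableAt {f g₁ g₂ : ℝ → ℝ} {z d₁ d₂ : ℝ} (hf : DifferentiableAt ℝ f z)
    (h₁ : f =ᶠ[𝓝[<] z] g₁) (h₂ : f =ᶠ[𝓝[>] z] g₂)
    (hg₁ : HasDerivAt g₁ d₁ z) (hg₂ : HasDerivAt g₂ d₂ z) :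
    g₁ z = f z ∧ g₂ z = f z ∧ d₁ = deriv f z ∧ d₂ = deriv f z := by
  have v₁ : g₁ z = f z := by
    have a : Tendsto g₁ (𝓝[<] z) (𝓝 (g₁ z)) := hg₁.continuousAt.continuousWithinAt
    have b : Tendsto f (𝓝[<] z) (𝓝 (f z)) := hf.continuousAt.continuousWithinAt
    exact tendsto_nhds_unique a (b.congr' h₁)
  have v₂ : g₂ z = f z := by
    have a : Tendsto g₂ (𝓝[>] z) (𝓝 (g₂ z)) := hg₂.continuousAt.continuousWithinAt
    have b : Tendsto f (𝓝[>] z) (𝓝 (f z)) := hf.continuousAt.continuousWithinAt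
    exact tendsto_nhds_unique a (b.congr' h₂)
  refine ⟨v₁, v₂, ?_, ?_⟩
  · exact (uniqueDiffWithinAt_Iio z).eq_deriv _ (hg₁.hasDerivWithinAt)
      (hf.hasDerivAt.hasDerivWithinAt.congr_of_eventuallyEq h₁.symm v₁)
  · exact (uniqueDiffWithinAt_Ioi z).eq_deriv _ (hg₂.hasDerivWithinAt)
      (hf.hasDerivAt.hasDerivWithinAt.congr_of_eventuallyEq h₂.symm v₂)

/-- A function with `N'' = κ² N + r`, `r ≥ 0`, `N(g) ≥ 0` and `N'(g) ≤ 0` is nonnegative to the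
left of `g`. -/
theorem nonneg_left_of_ode {N N1 r : ℝ → ℝ} {κ m g : ℝ} (hN : ∀ x, HasDerivAt N (N1 x) x)
    (hN1 : ∀ x, HasDerivAt N1 (κ ^ 2 * N x + r x) x) (hr : ∀ x ∈ Icc m g, 0 ≤ r x)
    (hg : 0 ≤ N g) (hg1 : N1 g ≤ 0) {x : ℝ} (hx : x ∈ Icc m g) : 0 ≤ N x := by
  have hlin : ∀ y, HasDerivAt (fun y => κ * (y - g)) κ y := fun y => by
    simpa using ((hasDerivAt_id y).sub_const g).const_mul κ
  have hch : ∀ y, HasDerivAt (fun y => Real.cosh (κ * (y - g))) (Real.sinh (κ * (y - g)) * κ) y :=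
    fun y => (hlin y).cosh
  have hsh : ∀ y, HasDerivAt (fun y => Real.sinh (κ * (y - g))) (Real.cosh (κ * (y - g)) * κ) y :=
    fun y => (hlin y).sinh
  -- The Wronskian of N with cosh(κ(y - g)), a solution of the homogeneous equation: W' = r cosh ≥ 0
  -- and W(g) = N'(g) ≤ 0, while (N / cosh)' = W / cosh².
  set W : ℝ → ℝ := fun y => N1 y * Real.cosh (κ * (y - g)) - κ * N y * Real.sinh (κ * (y - g))
    with hWdef
  have hW : ∀ y, HasDerivAt W (r y * Real.cosh (κ * (y - g))) y := fun y => by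
    refine (((hN1 y).mul (hch y)).sub (((hN y).const_mul κ).mul (hsh y))).congr_deriv ?_
    ring
  have hWmono : MonotoneOn W (Icc m g) := by
    refine monotoneOn_of_deriv_nonneg (convex_Icc m g)
      (fun y _ => (hW y).continuousAt.continuousWithinAt)
      (fun y _ => (hW y).differentiableAt.differentiableWithinAt) fun y hy => ?_
    rw [(hW y).deriv]
    exact mul_nonneg (hr y (interior_subset hy)) (Real.cosh_pos _).le
  have hmg : m ≤ g := hx.1.trans hx.2
  have hWle : ∀ y ∈ Icc m g, W y ≤ 0 := fun y hy => by
    have := hWmono hy (right_mem_Icc.2 hmg) hy.2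
    refine this.trans ?_
    simp [hWdef, hg1]
  have hR : ∀ y, HasDerivAt (fun y => N y / Real.cosh (κ * (y - g)))
      (W y / Real.cosh (κ * (y - g)) ^ 2) y := fun y => by
    refine ((hN y).div (hch y) (Real.cosh_pos _).ne').congr_deriv ?_
    simp only [hWdef]; ring
  have hRanti : AntitoneOn (fun y => N y / Real.cosh (κ * (y - g))) (Icc m g) := by
    refine antitoneOn_of_deriv_nonpos (convex_Icc m g)
      (fun y _ => (hR y).continuousAt.continuousWithinAt)
      (fun y _ => (hR y).differentiableAt.differentiableWithinAt) fun y hy => ?_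
    rw [(hR y).deriv]
    exact div_nonpos_of_nonpos_of_nonneg (hWle y (interior_subset hy)) (by positivity)
  have h := hRanti hx (right_mem_Icc.2 hmg) hx.2
  have h0 : 0 ≤ N x / Real.cosh (κ * (x - g)) := by
    refine le_trans ?_ h
    simpa using hg
  have := mul_nonneg h0 (Real.cosh_pos (κ * (x - g))).le
  rwa [div_mul_cancel₀ _ (Real.cosh_pos _).ne'] at this

/-- Minimum principle: a function with `N'' = κ² N + r`, `r < 0` in the interior, that is
nonnegative at the endpoints of an interval is nonnegative on it. -/
theorem nonneg_of_ode_of_endpoints {N N1 r : ℝ → ℝ} {κ a b : ℝ} (hN : ∀ x, HasDerivAt N (N1 x) x)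
    (hN1 : ∀ x, HasDerivAt N1 (κ ^ 2 * N x + r x) x) (hr : ∀ x ∈ Ioo a b, r x < 0)
    (ha : 0 ≤ N a) (hb : 0 ≤ N b) {x : ℝ} (hx : x ∈ Icc a b) : 0 ≤ N x := by
  obtain ⟨z, hz, hmin⟩ := isCompact_Icc.exists_isMinOn ⟨x, hx⟩
    (fun y _ => (hN y).continuousAt.continuousWithinAt : ContinuousOn N (Icc a b))
  by_contra! hneg
  have hzneg : N z < 0 := (hmin hx).trans_lt hneg
  have hza : z ≠ a := fun h => by rw [h] at hzneg; exact absurd ha hzneg.not_ge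
  have hzb : z ≠ b := fun h => by rw [h] at hzneg; exact absurd hb hzneg.not_ge
  have hzI : z ∈ Ioo a b := ⟨lt_of_le_of_ne hz.1 hza.symm, lt_of_le_of_ne hz.2 hzb⟩
  have hloc : IsLocalMin N z := hmin.isLocalMin (Icc_mem_nhds hzI.1 hzI.2)
  have hd : deriv N = N1 := funext fun y => (hN y).deriv
  have hdd : deriv (deriv N) z < 0 := by
    rw [hd, (hN1 z).deriv]
    nlinarith [hr z hzI, mul_nonneg (sq_nonneg κ) (neg_nonneg.2 hzneg.le)]
  -- A local minimum with negative second derivative is also a local maximum, so N is locally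
  -- constant, which contradicts N'' < 0.
  have hmax : IsLocalMax N z :=
    isLocalMax_of_deriv_deriv_neg hdd hloc.deriv_eq_zero (hN z).continuousAt
  have hconst : N =ᶠ[𝓝 z] fun _ => N z := by
    filter_upwards [hloc, hmax] with y h1 h2 using le_antisymm h2 h1
  have : deriv (deriv N) z = 0 := by
    have h1 := hconst.deriv
    rw [h1.deriv_eq]
    simp
  exact hdd.ne this

/-- Differentiation of `φ` when `φ ∘ η` is known, `η` being a local diffeomorphism. -/
theorem hasDerivAt_of_comp {φ η ψ : ℝ → ℝ} {c η' χ : ℝ} (hη : HasStrictDerivAt η η' c)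
    (h0 : η' ≠ 0) (h : ∀ᶠ t in 𝓝 c, φ (η t) = ψ t) (hψ : HasDerivAt ψ (χ * η') c) :
    HasDerivAt φ χ (η c) := by
  have hinv := hη.to_localInverse h0
  have hleft := hη.hasStrictFDerivAt_equiv h0
  have hr : ∀ᶠ y in 𝓝 (η c), η (hη.localInverse η η' c h0 y) = y :=
    hleft.eventually_right_inverse
  have hic : hη.localInverse η η' c h0 (η c) = c := hleft.localInverse_apply_image
  have hcont : Tendsto (hη.localInverse η η' c h0) (𝓝 (η c)) (𝓝 c) := by
    have := hinv.hasDerivAt.continuousAt.tendsto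
    rwa [hic] at this
  have hψ' : HasDerivAt ψ (χ * η') (hη.localInverse η η' c h0 (η c)) := by rwa [hic]
  have hcomp := hψ'.comp (η c) hinv.hasDerivAt
  have hval : χ * η' * η'⁻¹ = χ := by field_simp
  rw [hval] at hcomp
  refine hcomp.congr_of_eventuallyEq ?_
  filter_upwards [hr, hcont.eventually h] with y h1 h2
  simp only [Function.comp]
  rw [← h2, h1]

/-- Continuity of `φ` when `φ ∘ η` is continuous, `η` being a local diffeomorphism. -/
theorem continuousAt_of_comp {φ η ψ : ℝ → ℝ} {c η' : ℝ} (hη : HasStrictDerivAt η η' c)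
    (h0 : η' ≠ 0) (h : ∀ᶠ t in 𝓝 c, φ (η t) = ψ t) (hψ : ContinuousAt ψ c) :
    ContinuousAt φ (η c) := by
  have hmap := (hη.hasStrictFDerivAt_equiv h0).map_nhds_eq_of_equiv
  rw [ContinuousAt, ← hmap, tendsto_map'_iff]
  have : φ (η c) = ψ c := h.self_of_nhds
  rw [this]
  exact hψ.tendsto.congr' (h.mono fun t ht => ht.symm)

/-- An eventual property along a local diffeomorphism. -/
theorem eventually_of_comp {P : ℝ → Prop} {η : ℝ → ℝ} {c η' : ℝ} (hη : HasStrictDerivAt η η' c)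
    (h0 : η' ≠ 0) (h : ∀ᶠ t in 𝓝 c, P (η t)) : ∀ᶠ y in 𝓝 (η c), P y := by
  rw [← (hη.hasStrictFDerivAt_equiv h0).map_nhds_eq_of_equiv]
  exact h

/-- A function of one variable with continuous derivative near a point. -/
theorem contDiffAt_one_of_deriv {f f' : ℝ → ℝ} {x : ℝ} (h : ∀ᶠ y in 𝓝 x, HasDerivAt f (f' y) y)
    (hc : ∀ᶠ y in 𝓝 x, ContinuousAt f' y) : ContDiffAt ℝ 1 f x := by
  rw [contDiffAt_one_iff]
  obtain ⟨u, hu⟩ := (h.and hc).exists_mem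
  refine ⟨fun y => ContinuousLinearMap.toSpanSingleton ℝ (f' y), u, hu.1, ?_,
    fun y hy => (hu.2 y hy).1.hasFDerivAt⟩
  intro y hy
  exact ((ContinuousLinearMap.toSpanSingletonCLE (𝕜 := ℝ) (E := ℝ)).continuous.continuousAt.comp
    (hu.2 y hy).2).continuousWithinAt

theorem continuousAt_deriv_of_contDiffAt {f : ℝ → ℝ} {x : ℝ} (h : ContDiffAt ℝ 1 f x) :
    ContinuousAt (deriv f) x := by
  have := (h.continuousAt_fderiv (by norm_num : (1 : WithTop ℕ∞) ≠ 0))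
  change ContinuousAt (fun y => deriv f y) x
  simp only [← fderiv_apply_one_eq_deriv]
  exact this.clm_apply continuousAt_const

/-- Removable singularity of the derivative at a point. -/
theorem contDiffAt_one_of_punctured {f : ℝ → ℝ} {x l : ℝ} (hf : ContinuousAt f x)
    (h : ∀ᶠ y in 𝓝[≠] x, ContDiffAt ℝ 1 f y) (hl : Tendsto (deriv f) (𝓝[≠] x) (𝓝 l)) :
    ContDiffAt ℝ 1 f x ∧ deriv f x = l := by
  classical
  have hg : ContinuousAt (Function.update (deriv f) x l) x := continuousAt_update_same.2 hl
  have hd : ∀ᶠ y in 𝓝[≠] x, HasDerivAt f (Function.update (deriv f) x l y) y := by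
    filter_upwards [h, self_mem_nhdsWithin] with y hy hne
    rw [Function.update_of_ne hne]
    exact (hy.differentiableAt (by norm_num)).hasDerivAt
  have hx : HasDerivAt f l x := by
    obtain ⟨u, hu, hu'⟩ := (eventually_nhdsWithin_iff.1 hd).exists_mem
    have hlim : Tendsto (fun y => deriv f y) (𝓝[≠] x) (𝓝 l) := hl
    have key : ∀ {s : Set ℝ}, s ⊆ {x}ᶜ → 𝓝[s] x ≤ 𝓝[≠] x := fun hs => nhdsWithin_mono _ hs
    have hdiff : ∀ y ∈ u, y ≠ x → DifferentiableAt ℝ f y := fun y hy hne =>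
      (hu' y hy hne).differentiableAt
    have r : HasDerivWithinAt f l (Ici x) x := by
      refine hasDerivWithinAt_Ici_of_tendsto_deriv (s := u ∩ Ioi x)
        (fun y hy => (hdiff y hy.1 (ne_of_gt hy.2)).differentiableWithinAt) hf.continuousWithinAt
        (inter_mem (mem_nhdsWithin_of_mem_nhds hu) self_mem_nhdsWithin)
        (hlim.mono_left (key fun y hy => ne_of_gt hy))
    have lft : HasDerivWithinAt f l (Iic x) x := by
      refine hasDerivWithinAt_Iic_of_tendsto_deriv (s := u ∩ Iio x)
        (fun y hy => (hdiff y hy.1 (ne_of_lt hy.2)).differentiableWithinAt) hf.continuousWithinAt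
        (inter_mem (mem_nhdsWithin_of_mem_nhds hu) self_mem_nhdsWithin)
        (hlim.mono_left (key fun y hy => ne_of_lt hy))
    simpa using lft.union r
  refine ⟨?_, hx.deriv⟩
  refine contDiffAt_one_of_deriv (f' := deriv f) ?_ ?_
  · rw [← nhdsNE_sup_pure]
    refine eventually_sup.2 ⟨h.mono fun y hy => (hy.differentiableAt (by norm_num)).hasDerivAt, ?_⟩
    simpa using hx.differentiableAt
  · rw [← nhdsNE_sup_pure]
    refine eventually_sup.2 ⟨h.mono fun y hy => continuousAt_deriv_of_contDiffAt hy, ?_⟩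
    have : Function.update (deriv f) x l = deriv f := by
      rw [← hx.deriv]; simp
    rw [this] at hg
    simpa using hg

/-- A limit along a decreasing curve, at the left endpoint of its parameter interval. -/
theorem tendsto_left_of_comp_anti {f η : ℝ → ℝ} {a b y : ℝ} {l : Filter ℝ} (hab : a < b)
    (hη : ContinuousOn η (Ioo a b)) (hlim : Tendsto η (𝓝[>] a) (𝓝 y))
    (hlt : ∀ c ∈ Ioo a b, η c < y)
    (h : Tendsto (fun c => f (η c)) (𝓝[>] a) l) : Tendsto f (𝓝[<] y) l := by
  intro s hs
  obtain ⟨d, hd, hds⟩ := mem_nhdsGT_iff_exists_Ioo_subset.1 (h hs)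
  set e := min d b with he
  have hae : a < e := lt_min hd hab
  obtain ⟨m, hm⟩ := exists_between hae
  have hmem : m ∈ Ioo a b := ⟨hm.1, hm.2.trans_le (min_le_right _ _)⟩
  refine mem_nhdsLT_iff_exists_Ioo_subset.2 ⟨η m, hlt m hmem, fun t ht => ?_⟩
  have hev : ∀ᶠ c in 𝓝[>] a, t < η c := hlim.eventually (lt_mem_nhds ht.2)
  obtain ⟨c1, hc1, hc1'⟩ := (hev.and (Ioo_mem_nhdsGT hm.1)).exists
  have hsub : Icc c1 m ⊆ Ioo a b := fun c hc => ⟨hc1'.1.trans_le hc.1, hc.2.trans_lt hmem.2⟩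
  -- Every value t just below y is attained by η at a parameter close to a; neither injectivity nor
  -- differentiability of η is needed.
  obtain ⟨c, hc, rfl⟩ := intermediate_value_Icc' hc1'.2.le (hη.mono hsub) ⟨ht.1.le, hc1.le⟩
  exact hds ⟨hc1'.1.trans_le hc.1, hc.2.trans_lt (hm.2.trans_le (min_le_left _ _))⟩

/-- A limit along a decreasing curve, at the right endpoint of its parameter interval. -/
theorem tendsto_right_of_comp_anti {f η : ℝ → ℝ} {a b y : ℝ} {l : Filter ℝ} (hab : a < b)
    (hη : ContinuousOn η (Ioo a b)) (hlim : Tendsto η (𝓝[<] b) (𝓝 y))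
    (hlt : ∀ c ∈ Ioo a b, y < η c)
    (h : Tendsto (fun c => f (η c)) (𝓝[<] b) l) : Tendsto f (𝓝[>] y) l := by
  intro s hs
  obtain ⟨d, hd, hds⟩ := mem_nhdsLT_iff_exists_Ioo_subset.1 (h hs)
  set e := max d a with he
  have hae : e < b := max_lt hd hab
  obtain ⟨m, hm⟩ := exists_between hae
  have hmem : m ∈ Ioo a b := ⟨(le_max_right _ _).trans_lt hm.1, hm.2⟩
  refine mem_nhdsGT_iff_exists_Ioo_subset.2 ⟨η m, hlt m hmem, fun t ht => ?_⟩
  have hev : ∀ᶠ c in 𝓝[<] b, η c < t := hlim.eventually (gt_mem_nhds ht.1)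
  obtain ⟨c1, hc1, hc1'⟩ := (hev.and (Ioo_mem_nhdsLT hm.2)).exists
  have hsub : Icc m c1 ⊆ Ioo a b := fun c hc => ⟨hmem.1.trans_le hc.1, hc.2.trans_lt hc1'.2⟩
  obtain ⟨c, hc, rfl⟩ := intermediate_value_Icc' hc1'.1.le (hη.mono hsub) ⟨hc1.le, ht.2.le⟩
  exact hds ⟨((le_max_left _ _).trans_lt hm.1).trans_le hc.1, hc.2.trans_lt hc1'.2⟩

end

section

/-! ### Two-dimensional calculus -/

theorem contDiffAt_one_of_fderiv {E : Type*} [NormedAddCommGroup E] [NormedSpace ℝ E]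
    {f : E → ℝ} {f' : E → E →L[ℝ] ℝ} {p : E} (h : ∀ᶠ z in 𝓝 p, HasFDerivAt f (f' z) z)
    (hc : ∀ᶠ z in 𝓝 p, ContinuousAt f' z) : ContDiffAt ℝ 1 f p := by
  rw [contDiffAt_one_iff]
  obtain ⟨u, hu⟩ := (h.and hc).exists_mem
  exact ⟨f', u, hu.1, fun y hy => (hu.2 y hy).2.continuousWithinAt, fun y hy => (hu.2 y hy).1⟩

theorem hasDerivAt_fst_slice {f : ℝ × ℝ → ℝ} {x c : ℝ} (h : ContDiffAt ℝ 1 f (x, c)) :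
    HasDerivAt (fun y => f (y, c)) (fderiv ℝ f (x, c) (1, 0)) x := by
  have h1 := (h.differentiableAt (by norm_num)).hasFDerivAt
  have h2 : HasDerivAt (fun y : ℝ => (y, c)) ((1 : ℝ), (0 : ℝ)) x :=
    (hasDerivAt_id x).prodMk (hasDerivAt_const x c)
  exact h1.comp_hasDerivAt x h2

theorem hasDerivAt_snd_slice {f : ℝ × ℝ → ℝ} {x c : ℝ} (h : ContDiffAt ℝ 1 f (x, c)) :
    HasDerivAt (fun d => f (x, d)) (fderiv ℝ f (x, c) (0, 1)) c := by
  have h1 := (h.differentiableAt (by norm_num)).hasFDerivAt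
  have h2 : HasDerivAt (fun d : ℝ => (x, d)) ((0 : ℝ), (1 : ℝ)) c :=
    (hasDerivAt_const c x).prodMk (hasDerivAt_id c)
  exact h1.comp_hasDerivAt c h2

theorem clm_prod_ext {L M : ℝ × ℝ →L[ℝ] ℝ} (h1 : L (1, 0) = M (1, 0)) (h2 : L (0, 1) = M (0, 1)) :
    L = M := by
  ext <;> simpa

/-- Gluing of two continuously differentiable functions along a graph `x = g(c)`. -/
theorem contDiffAt_glue {Q f₁ f₂ : ℝ × ℝ → ℝ} {g : ℝ → ℝ} {p : ℝ × ℝ}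
    (hp : p.1 = g p.2) (hg : ∀ᶠ c in 𝓝 p.2, DifferentiableAt ℝ g c)
    (h₁ : ContDiffAt ℝ 1 f₁ p) (h₂ : ContDiffAt ℝ 1 f₂ p)
    (e₁ : ∀ᶠ z in 𝓝 p, z.1 ≤ g z.2 → Q z = f₁ z) (e₂ : ∀ᶠ z in 𝓝 p, g z.2 ≤ z.1 → Q z = f₂ z)
    (hx : ∀ᶠ c in 𝓝 p.2, deriv (fun x => f₁ (x, c)) (g c) = deriv (fun x => f₂ (x, c)) (g c)) :
    ContDiffAt ℝ 1 Q p := by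
  classical
  have hcurve : Tendsto (fun c => (g c, c)) (𝓝 p.2) (𝓝 p) := by
    have h := hg.self_of_nhds.continuousAt.tendsto.prodMk_nhds (tendsto_id (x := 𝓝 p.2))
    rwa [← hp] at h
  have hd1 := h₁.eventually (by norm_num)
  have hd2 := h₂.eventually (by norm_num)
  have hval : ∀ᶠ c in 𝓝 p.2, f₁ (g c, c) = f₂ (g c, c) := by
    filter_upwards [hcurve.eventually e₁, hcurve.eventually e₂] with c a b
    rw [← a le_rfl, ← b le_rfl]
  -- The values agree along the graph, hence so do the derivatives in the tangent direction (g', 1);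
  -- together with direction (1, 0) this spans the plane.
  have hgrad : ∀ᶠ c in 𝓝 p.2, fderiv ℝ f₁ (g c, c) = fderiv ℝ f₂ (g c, c) := by
    filter_upwards [hcurve.eventually hd1, hcurve.eventually hd2,
      eventually_eventually_nhds.2 hval, hg, hx] with c k1 k2 k3 k4 k5
    have hv : HasDerivAt (fun c => (g c, c)) (deriv g c, (1 : ℝ)) c :=
      k4.hasDerivAt.prodMk (hasDerivAt_id c)
    have q1 := HasFDerivAt.comp_hasDerivAt (f := fun c => (g c, c)) c
      (k1.differentiableAt (by norm_num)).hasFDerivAt hv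
    have q2 := HasFDerivAt.comp_hasDerivAt (f := fun c => (g c, c)) c
      (k2.differentiableAt (by norm_num)).hasFDerivAt hv
    have q3 := q1.unique (q2.congr_of_eventuallyEq k3)
    rw [(hasDerivAt_fst_slice k1).deriv, (hasDerivAt_fst_slice k2).deriv] at k5
    refine clm_prod_ext k5 ?_
    have hdec : ((deriv g c, 1) : ℝ × ℝ) = deriv g c • ((1, 0) : ℝ × ℝ) + (0, 1) := by simp
    rw [hdec] at q3
    simp only [map_add, map_smul, k5] at q3
    simpa using q3
  have hgc : ∀ᶠ z in 𝓝 p, ContinuousAt g z.2 :=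
    (continuous_snd.tendsto p).eventually (hg.mono fun c h => h.continuousAt)
  have hgrad' : ∀ᶠ z in 𝓝 p, z.1 = g z.2 → fderiv ℝ f₁ z = fderiv ℝ f₂ z :=
    ((continuous_snd.tendsto p).eventually hgrad).mono fun z h hz => by
      have : z = (g z.2, z.2) := Prod.ext hz rfl
      rw [this]; exact h
  set D : ℝ × ℝ → ℝ × ℝ →L[ℝ] ℝ := fun z => if z.1 ≤ g z.2 then fderiv ℝ f₁ z else fderiv ℝ f₂ z
    with hD
  have hlt : ∀ z : ℝ × ℝ, ContinuousAt g z.2 → z.1 < g z.2 → ∀ᶠ w in 𝓝 z, w.1 < g w.2 :=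
    fun z hz h => continuous_fst.continuousAt.eventually_lt
      (ContinuousAt.comp (f := Prod.snd) (x := z) hz continuous_snd.continuousAt) h
  have hgt : ∀ z : ℝ × ℝ, ContinuousAt g z.2 → g z.2 < z.1 → ∀ᶠ w in 𝓝 z, g w.2 < w.1 :=
    fun z hz h => (ContinuousAt.comp (f := Prod.snd) (x := z) hz
      continuous_snd.continuousAt).eventually_lt continuous_fst.continuousAt h
  have hE : ∀ᶠ z in 𝓝 p, z.1 = g z.2 → fderiv ℝ f₁ z = fderiv ℝ f₂ z := hgrad'
  refine contDiffAt_one_of_fderiv (f' := D) ?_ ?_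
  · filter_upwards [hd1, hd2, eventually_eventually_nhds.2 e₁, eventually_eventually_nhds.2 e₂,
      hgc, hE] with z k1 k2 k3 k4 k5 k6
    have q1 := (k1.differentiableAt (by norm_num)).hasFDerivAt
    have q2 := (k2.differentiableAt (by norm_num)).hasFDerivAt
    rcases lt_trichotomy z.1 (g z.2) with hz | hz | hz
    · simp only [hD, if_pos hz.le]
      refine q1.congr_of_eventuallyEq ?_
      filter_upwards [k3, hlt z k5 hz] with w a b using a b.le
    · simp only [hD, if_pos hz.le]
      have w1 : HasFDerivWithinAt Q (fderiv ℝ f₁ z) {w | w.1 ≤ g w.2} z := by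
        refine q1.hasFDerivWithinAt.congr_of_eventuallyEq ?_ (k3.self_of_nhds hz.le)
        filter_upwards [mem_nhdsWithin_of_mem_nhds k3, self_mem_nhdsWithin] with w a b using a b
      have w2 : HasFDerivWithinAt Q (fderiv ℝ f₁ z) {w | g w.2 ≤ w.1} z := by
        rw [k6 hz]
        refine q2.hasFDerivWithinAt.congr_of_eventuallyEq ?_ (k4.self_of_nhds hz.ge)
        filter_upwards [mem_nhdsWithin_of_mem_nhds k4, self_mem_nhdsWithin] with w a b using a b
      have := w1.union w2
      rwa [show {w : ℝ × ℝ | w.1 ≤ g w.2} ∪ {w | g w.2 ≤ w.1} = univ from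
        eq_univ_of_forall fun w => le_total w.1 (g w.2), hasFDerivWithinAt_univ] at this
    · simp only [hD, if_neg hz.not_ge]
      refine q2.congr_of_eventuallyEq ?_
      filter_upwards [k4, hgt z k5 hz] with w a b using a b.le
  · filter_upwards [hd1, hd2, hgc, hE] with z k1 k2 k5 k6
    have q1 := k1.continuousAt_fderiv (by norm_num)
    have q2 := k2.continuousAt_fderiv (by norm_num)
    rcases lt_trichotomy z.1 (g z.2) with hz | hz | hz
    · refine q1.congr ?_
      filter_upwards [hlt z k5 hz] with w b
      simp [hD, b.le]
    · have w1 : ContinuousWithinAt D {w | w.1 ≤ g w.2} z :=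
        q1.continuousWithinAt.congr (fun w hw => by simp only [hD]; exact if_pos hw)
          (by simp [hD, hz.le])
      have w2 : ContinuousWithinAt D {w | g w.2 < w.1} z :=
        q2.continuousWithinAt.congr (fun w hw => by simp only [hD]; exact if_neg (not_le.2 hw))
          (by simp [hD, hz.le, k6 hz])
      have := w1.union w2
      rwa [show {w : ℝ × ℝ | w.1 ≤ g w.2} ∪ {w | g w.2 < w.1} = univ from
        eq_univ_of_forall fun w => le_or_gt w.1 (g w.2), continuousWithinAt_univ] at this
    · refine q2.congr ?_
      filter_upwards [hgt z k5 hz] with w b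
      simp [hD, b.not_ge]

/-- Removable singularity: if the partial derivatives have limits at `p` along a dense set of
points, then the function is continuously differentiable at `p`. -/
theorem contDiffAt_of_punctured {Q : ℝ × ℝ → ℝ} {p : ℝ × ℝ} {S : Set (ℝ × ℝ)} {a b : ℝ}
    (hc : ContinuousAt Q p) (h : ∀ᶠ z in 𝓝[≠] p, ContDiffAt ℝ 1 Q z)
    (hS : ∀ᶠ z in 𝓝[≠] p, z ∈ closure S)
    (ha : Tendsto (fun z : ℝ × ℝ => fderiv ℝ Q z (1, 0)) (𝓝[S] p) (𝓝 a))
    (hb : Tendsto (fun z : ℝ × ℝ => fderiv ℝ Q z (0, 1)) (𝓝[S] p) (𝓝 b)) :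
    ContDiffAt ℝ 1 Q p := by
  classical
  set L : ℝ × ℝ →L[ℝ] ℝ := a • ContinuousLinearMap.fst ℝ ℝ ℝ + b • ContinuousLinearMap.snd ℝ ℝ ℝ
    with hL
  have hLS : Tendsto (fderiv ℝ Q) (𝓝[S] p) (𝓝 L) := by
    have h1 := (ha.smul_const (ContinuousLinearMap.fst ℝ ℝ ℝ)).add
      (hb.smul_const (ContinuousLinearMap.snd ℝ ℝ ℝ))
    refine h1.congr fun z => clm_prod_ext ?_ ?_ <;> simp
  -- Near p the derivative is continuous off p, so a bound valid on the dense set S extends to every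
  -- nearby point of its closure.
  have hLim : Tendsto (fderiv ℝ Q) (𝓝[≠] p) (𝓝 L) := by
    rw [Metric.tendsto_nhds] at hLS ⊢
    intro ε hε
    obtain ⟨U, hUo, hpU, hU⟩ := mem_nhdsWithin.1 (hLS (ε / 2) (half_pos hε))
    filter_upwards [h, hS, mem_nhdsWithin_of_mem_nhds (hUo.mem_nhds hpU)] with z k1 k2 k3
    have hcl : z ∈ closure (U ∩ S) := by
      refine mem_closure_iff_nhds.2 fun V hV => ?_
      obtain ⟨w, hw⟩ := mem_closure_iff_nhds.1 k2 (V ∩ U) (inter_mem hV (hUo.mem_nhds k3))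
      exact ⟨w, hw.1.1, hw.1.2, hw.2⟩
    have : (𝓝[U ∩ S] z).NeBot := mem_closure_iff_nhdsWithin_neBot.1 hcl
    have hcont : Tendsto (fun w => dist (fderiv ℝ Q w) L) (𝓝[U ∩ S] z)
        (𝓝 (dist (fderiv ℝ Q z) L)) :=
      ((k1.continuousAt_fderiv (by norm_num)).continuousWithinAt.tendsto).dist tendsto_const_nhds
    have : dist (fderiv ℝ Q z) L ≤ ε / 2 := by
      refine le_of_tendsto hcont ?_
      filter_upwards [self_mem_nhdsWithin] with w hw
      exact (hU hw).le
    linarith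
  have hfd : HasFDerivAt Q L p := by
    obtain ⟨r, hr, hball⟩ := Metric.mem_nhdsWithin_iff.1 h
    have hdiff : ∀ z ∈ Metric.ball p r, z ≠ p → DifferentiableAt ℝ Q z := fun z hz hne =>
      ContDiffAt.differentiableAt (n := 1) (hball ⟨hz, hne⟩) (by norm_num)
    have hcontB : ∀ z ∈ Metric.ball p r, ContinuousAt Q z := fun z hz => by
      by_cases hne : z = p
      · rw [hne]; exact hc
      · exact (hdiff z hz hne).continuousAt
    -- The mean value argument needs a convex domain avoiding p. Half-balls to the left and to the
    -- right of p serve, and their closures together cover a ball.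
    have key : ∀ T : Set (ℝ × ℝ), Convex ℝ T → IsOpen T → p ∉ T →
        HasFDerivWithinAt Q L (closure (T ∩ Metric.ball p (r / 2))) p := by
      intro T hTc hTo hpT
      refine hasFDerivWithinAt_closure_of_tendsto_fderiv ?_ (hTc.inter (convex_ball p _))
        (hTo.inter Metric.isOpen_ball) ?_ ?_
      · intro z hz
        refine (hdiff z (Metric.ball_subset_ball (by linarith) hz.2) ?_).differentiableWithinAt
        rintro rfl; exact hpT hz.1
      · intro z hz
        have : z ∈ Metric.closedBall p (r / 2) :=
          Metric.closure_ball_subset_closedBall (closure_mono inter_subset_right hz)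
        exact (hcontB z (Metric.closedBall_subset_ball (by linarith) this)).continuousWithinAt
      · exact hLim.mono_left (nhdsWithin_mono _ fun z hz hzp => hpT (hzp ▸ hz.1))
    have k1 := key {z | z.1 < p.1} ((convex_Iio p.1).is_linear_preimage (f := Prod.fst)
      ⟨fun _ _ => rfl, fun _ _ => rfl⟩)
      (isOpen_lt continuous_fst continuous_const) (by simp)
    have k2 := key {z | p.1 < z.1} ((convex_Ioi p.1).is_linear_preimage (f := Prod.fst)
      ⟨fun _ _ => rfl, fun _ _ => rfl⟩)
      (isOpen_lt continuous_const continuous_fst) (by simp)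
    have k3 := k1.union k2
    refine k3.hasFDerivAt ?_
    rw [← closure_union, ← union_inter_distrib_right]
    refine mem_of_superset (Metric.ball_mem_nhds p (half_pos hr)) fun z hz => ?_
    refine mem_closure_iff_nhds.2 fun V hV => ?_
    have hd : Dense {w : ℝ × ℝ | w.1 ≠ p.1} := by
      have : {w : ℝ × ℝ | w.1 ≠ p.1} = Prod.fst ⁻¹' {p.1}ᶜ := rfl
      rw [this]
      exact (dense_compl_singleton p.1).preimage isOpenMap_fst
    obtain ⟨w, hw1, hw2⟩ := hd.inter_nhds_nonempty (inter_mem hV (Metric.isOpen_ball.mem_nhds hz))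
    refine ⟨w, hw2.1, ?_, hw2.2⟩
    rcases lt_or_gt_of_ne hw1 with h | h
    · exact Or.inl h
    · exact Or.inr h
  refine contDiffAt_one_of_fderiv (f' := fderiv ℝ Q) ?_ ?_
  · rw [← nhdsNE_sup_pure]
    refine eventually_sup.2 ⟨h.mono fun y hy => (hy.differentiableAt (by norm_num)).hasFDerivAt, ?_⟩
    simpa using hfd.differentiableAt.hasFDerivAt
  · rw [← nhdsNE_sup_pure]
    refine eventually_sup.2 ⟨h.mono fun y hy => hy.continuousAt_fderiv (by norm_num), ?_⟩
    have : ContinuousAt (fderiv ℝ Q) p := by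
      rw [continuousAt_iff_punctured_nhds, hfd.fderiv]; exact hLim
    simpa using this

end

section

/-! ### Solutions of the waiting equation with smooth fit at a point -/

/-- The parameter regime. -/
structure Regime (α δ lam : ℝ) : Prop where
  α_pos : 0 < α
  δ_pos : 0 < δ
  lam_pos : 0 < lam
  lam_lt : lam < α * δ
  star : (α * δ - lam) * (1 / (4 * δ ^ 2) + 1 / (δ * √(2 * α))) < lam / α

/-- The inequality λ* < λ with denominators cleared is `star`; in that form it compares x² +
2x/√(2α) at x = 1/(2δ) with its value at `f0`. -/
theorem regime_of_mem {α δ lam : ℝ} (hα : 0 < α) (hδ : 0 < δ)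
    (hlam : lam ∈ Ioo (lamStar α δ) (α * δ)) : Regime α δ lam := by
  have hk : 0 < √(2 * α) := Real.sqrt_pos.2 (by positivity)
  have hs : 0 < lamStar α δ := by unfold lamStar; positivity
  refine ⟨hα, hδ, hs.trans hlam.1, hlam.2, ?_⟩
  have h1 := hlam.1
  unfold lamStar at h1
  have hu : 0 < 1 / (4 * δ) + 1 / √(2 * α) := by positivity
  generalize hU : 1 / (4 * δ) + 1 / √(2 * α) = u at *
  have h2 : 1 / (4 * δ ^ 2) + 1 / (δ * √(2 * α)) = u / δ := by
    rw [← hU]; field_simp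
  rw [h2]
  rw [div_lt_iff₀ (by positivity)] at h1
  have h3 : lam * (1 + δ / α / u) * u = lam * u + lam * δ / α := by field_simp
  have h4 : (α * δ) * u < lam * u + lam * δ / α := by
    rw [← h3]; exact mul_lt_mul_of_pos_right h1 hu
  rw [← mul_div_assoc, div_lt_iff₀ hδ]
  have : lam / α * δ = lam * δ / α := by ring
  rw [this]; linarith

/-- The deviation of `δ (x - t)² + t` from the particular solution, at `x = z`. -/
def fitV (α δ lam t z : ℝ) : ℝ := δ * (z - t) ^ 2 + t - lam / α * z ^ 2 - lam / α ^ 2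

/-- The derivative of the deviation at `x = z`. -/
def fitD (α δ lam t z : ℝ) : ℝ := 2 * δ * (z - t) - 2 * (lam / α) * z

/-- The solution of `½ u'' - α u + λ x² = 0` that fits `δ (x - t)² + t` smoothly at `x = z`. -/
def sol (α δ lam t z x : ℝ) : ℝ :=
  fitV α δ lam t z * Real.cosh (√(2 * α) * (x - z))
    + fitD α δ lam t z / √(2 * α) * Real.sinh (√(2 * α) * (x - z)) + lam / α * x ^ 2 + lam / α ^ 2

def solX (α δ lam t z x : ℝ) : ℝ :=
  √(2 * α) * fitV α δ lam t z * Real.sinh (√(2 * α) * (x - z))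
    + fitD α δ lam t z * Real.cosh (√(2 * α) * (x - z)) + 2 * (lam / α) * x

def solXX (α δ lam t z x : ℝ) : ℝ :=
  2 * α * fitV α δ lam t z * Real.cosh (√(2 * α) * (x - z))
    + √(2 * α) * fitD α δ lam t z * Real.sinh (√(2 * α) * (x - z)) + 2 * (lam / α)

/-- Half the jump of the second derivative at the point of smooth fit, which is the generator term
of `δ (x - t)² + t` at `x = z`. -/
def gap (α δ lam t z : ℝ) : ℝ := δ - α * δ * (z - t) ^ 2 - α * t + lam * z ^ 2

/-- The derivative of `sol` when `t` and `z` move with velocities `τ` and `ζ`. -/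
def solC (α δ lam t z τ ζ x : ℝ) : ℝ :=
  (1 - 2 * δ * (z - t)) * τ * Real.cosh (√(2 * α) * (x - z))
    + (2 * gap α δ lam t z * ζ - 2 * δ * τ) / √(2 * α) * Real.sinh (√(2 * α) * (x - z))

def solXC (α δ lam t z τ ζ x : ℝ) : ℝ :=
  √(2 * α) * ((1 - 2 * δ * (z - t)) * τ) * Real.sinh (√(2 * α) * (x - z))
    + (2 * gap α δ lam t z * ζ - 2 * δ * τ) * Real.cosh (√(2 * α) * (x - z))

section

variable {α δ lam : ℝ}

theorem Regime.k_pos (H : Regime α δ lam) : 0 < √(2 * α) :=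
  Real.sqrt_pos.2 (mul_pos two_pos H.α_pos)

theorem Regime.k_sq (H : Regime α δ lam) : √(2 * α) ^ 2 = 2 * α :=
  Real.sq_sqrt (mul_pos two_pos H.α_pos).le

theorem hasDerivAt_lin {x z : ℝ → ℝ} {x' z' c : ℝ} (κ : ℝ) (hx : HasDerivAt x x' c)
    (hz : HasDerivAt z z' c) : HasDerivAt (fun c => κ * (x c - z c)) (κ * (x' - z')) c :=
  (hx.sub hz).const_mul κ

theorem hasDerivAt_fitV {t z : ℝ → ℝ} {t' z' c : ℝ} (ht : HasDerivAt t t' c)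
    (hz : HasDerivAt z z' c) : HasDerivAt (fun c => fitV α δ lam (t c) (z c))
      ((1 - 2 * δ * (z c - t c)) * t' + fitD α δ lam (t c) (z c) * z') c := by
  unfold fitV fitD
  refine ((((((hz.sub ht).pow 2).const_mul δ).add ht).sub ((hz.pow 2).const_mul (lam / α))).sub_const
    (lam / α ^ 2)).congr_deriv ?_
  simp only [Pi.sub_apply]
  push_cast
  ring

theorem hasDerivAt_fitD {t z : ℝ → ℝ} {t' z' c : ℝ} (ht : HasDerivAt t t' c)
    (hz : HasDerivAt z z' c) : HasDerivAt (fun c => fitD α δ lam (t c) (z c))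
      (2 * δ * (z' - t') - 2 * (lam / α) * z') c := by
  unfold fitD
  exact ((hz.sub ht).const_mul (2 * δ)).sub (hz.const_mul (2 * (lam / α)))

/-- Since value and slope are fitted at z, moving z changes only the slope to first order, by the
jump 2 `gap` of the second derivative. Hence the velocity of z enters `solC` only through the
coefficient of sinh. -/
theorem hasDerivAt_sol_curve (H : Regime α δ lam) {t z x : ℝ → ℝ} {t' z' x' c : ℝ}
    (ht : HasDerivAt t t' c) (hz : HasDerivAt z z' c) (hx : HasDerivAt x x' c) :
    HasDerivAt (fun c => sol α δ lam (t c) (z c) (x c))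
      (solC α δ lam (t c) (z c) t' z' (x c) + solX α δ lam (t c) (z c) (x c) * x') c := by
  have hl := hasDerivAt_lin √(2 * α) hx hz
  have hk := H.k_pos.ne'
  have hk2 := H.k_sq
  have hα := H.α_pos.ne'
  refine (((((hasDerivAt_fitV (α := α) (δ := δ) (lam := lam) ht hz).mul hl.cosh).add
    (((hasDerivAt_fitD (α := α) (δ := δ) (lam := lam) ht hz).div_const √(2 * α)).mul hl.sinh)).add
    ((hx.pow 2).const_mul (lam / α))).add_const (lam / α ^ 2)).congr_deriv ?_
  unfold solC solX gap fitV fitD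
  generalize Real.cosh _ = C
  generalize Real.sinh _ = S
  generalize √(2 * α) = k at *
  -- Eliminating α in favour of k = √(2α) leaves a rational identity, with cosh and sinh as free
  -- variables.
  obtain rfl : α = k ^ 2 / 2 := by linarith
  push_cast
  field_simp
  ring

theorem hasDerivAt_solX_curve (H : Regime α δ lam) {t z x : ℝ → ℝ} {t' z' x' c : ℝ}
    (ht : HasDerivAt t t' c) (hz : HasDerivAt z z' c) (hx : HasDerivAt x x' c) :
    HasDerivAt (fun c => solX α δ lam (t c) (z c) (x c))
      (solXC α δ lam (t c) (z c) t' z' (x c) + solXX α δ lam (t c) (z c) (x c) * x') c := by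
  have hl := hasDerivAt_lin √(2 * α) hx hz
  have hk := H.k_pos.ne'
  have hk2 := H.k_sq
  have hα := H.α_pos.ne'
  refine (((((hasDerivAt_fitV (α := α) (δ := δ) (lam := lam) ht hz).const_mul √(2 * α)).mul
    hl.sinh).add ((hasDerivAt_fitD (α := α) (δ := δ) (lam := lam) ht hz).mul hl.cosh)).add
    (hx.const_mul (2 * (lam / α)))).congr_deriv ?_
  unfold solXC solXX gap fitV fitD
  generalize Real.cosh _ = C
  generalize Real.sinh _ = S
  generalize √(2 * α) = k at *
  obtain rfl : α = k ^ 2 / 2 := by linarith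
  field_simp
  ring

theorem hasDerivAt_sol (H : Regime α δ lam) (t z x : ℝ) :
    HasDerivAt (sol α δ lam t z) (solX α δ lam t z x) x := by
  have := hasDerivAt_sol_curve H (hasDerivAt_const x t) (hasDerivAt_const x z) (hasDerivAt_id x)
  simpa [solC] using this

theorem hasDerivAt_solX (H : Regime α δ lam) (t z x : ℝ) :
    HasDerivAt (solX α δ lam t z) (solXX α δ lam t z x) x := by
  have := hasDerivAt_solX_curve H (hasDerivAt_const x t) (hasDerivAt_const x z) (hasDerivAt_id x)
  simpa [solXC] using this

theorem solXX_eq (H : Regime α δ lam) (t z x : ℝ) :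
    solXX α δ lam t z x = 2 * α * sol α δ lam t z x - 2 * lam * x ^ 2 := by
  have hk := H.k_pos.ne'
  have hk2 := H.k_sq
  have hα := H.α_pos.ne'
  unfold solXX sol
  generalize Real.cosh _ = C
  generalize Real.sinh _ = S
  generalize √(2 * α) = k at *
  obtain rfl : α = k ^ 2 / 2 := by linarith
  field_simp
  ring

theorem hasDerivAt_solXX (H : Regime α δ lam) (t z x : ℝ) :
    HasDerivAt (solXX α δ lam t z) (2 * α * solX α δ lam t z x - 4 * lam * x) x := by
  rw [show solXX α δ lam t z = fun x => 2 * α * sol α δ lam t z x - 2 * lam * x ^ 2 from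
    funext (solXX_eq H t z)]
  refine (((hasDerivAt_sol H t z x).const_mul (2 * α)).sub
    (((hasDerivAt_id x).pow 2).const_mul (2 * lam))).congr_deriv ?_
  simp; ring

theorem hasDerivAt_solC (H : Regime α δ lam) (t z τ ζ x : ℝ) :
    HasDerivAt (solC α δ lam t z τ ζ) (solXC α δ lam t z τ ζ x) x := by
  have hl := hasDerivAt_lin √(2 * α) (hasDerivAt_id x) (hasDerivAt_const x z)
  refine ((hl.cosh.const_mul ((1 - 2 * δ * (z - t)) * τ)).add (hl.sinh.const_mul
    ((2 * gap α δ lam t z * ζ - 2 * δ * τ) / √(2 * α)))).congr_deriv ?_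
  have hk := H.k_pos.ne'
  unfold solXC
  simp only [id]
  field_simp
  ring

theorem hasDerivAt_solXC (H : Regime α δ lam) (t z τ ζ x : ℝ) :
    HasDerivAt (solXC α δ lam t z τ ζ) (2 * α * solC α δ lam t z τ ζ x) x := by
  have hl := hasDerivAt_lin √(2 * α) (hasDerivAt_id x) (hasDerivAt_const x z)
  refine ((hl.sinh.const_mul (√(2 * α) * ((1 - 2 * δ * (z - t)) * τ))).add (hl.cosh.const_mul
    (2 * gap α δ lam t z * ζ - 2 * δ * τ))).congr_deriv ?_
  have hk := H.k_pos.ne'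
  have hk2 := H.k_sq
  unfold solC
  simp only [id]
  generalize Real.cosh _ = C
  generalize Real.sinh _ = S
  generalize √(2 * α) = k at *
  rw [← hk2]
  field_simp
  ring

@[simp] theorem sol_self (t z : ℝ) : sol α δ lam t z z = δ * (z - t) ^ 2 + t := by
  simp [sol, fitV]; ring

@[simp] theorem solX_self (t z : ℝ) : solX α δ lam t z z = 2 * δ * (z - t) := by
  simp [solX, fitD]

theorem solXX_self (H : Regime α δ lam) (t z : ℝ) :
    solXX α δ lam t z z = 2 * δ - 2 * gap α δ lam t z := by
  rw [solXX_eq H, sol_self, gap]; ring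

@[simp] theorem solC_self (t z τ ζ : ℝ) :
    solC α δ lam t z τ ζ z = (1 - 2 * δ * (z - t)) * τ := by
  simp [solC]

@[simp] theorem solXC_self (t z τ ζ : ℝ) :
    solXC α δ lam t z τ ζ z = 2 * gap α δ lam t z * ζ - 2 * δ * τ := by
  simp [solXC]

/-- The general solution is determined by its value and its derivative at a point. -/
theorem waitSol_eq_sol (H : Regime α δ lam) {a b t z : ℝ}
    (h0 : waitSol α lam a b z = δ * (z - t) ^ 2 + t)
    (h1 : HasDerivAt (waitSol α lam a b) (2 * δ * (z - t)) z) (x : ℝ) :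
    waitSol α lam a b x = sol α δ lam t z x := by
  have hk := H.k_pos.ne'
  have e1 : HasDerivAt (fun x : ℝ => Real.exp (x * √(2 * α)))
      (Real.exp (z * √(2 * α)) * √(2 * α)) z := by
    simpa using ((hasDerivAt_id z).mul_const √(2 * α)).exp
  have e2 : HasDerivAt (fun x : ℝ => Real.exp (-x * √(2 * α)))
      (Real.exp (-z * √(2 * α)) * (-√(2 * α))) z := by
    simpa using ((hasDerivAt_id z).neg.mul_const √(2 * α)).exp
  have hd : HasDerivAt (waitSol α lam a b) (a * (Real.exp (z * √(2 * α)) * √(2 * α))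
      + b * (Real.exp (-z * √(2 * α)) * (-√(2 * α))) + lam / α * (2 * z)) z := by
    unfold waitSol
    refine ((((e1.const_mul a).add (e2.const_mul b)).add
      (((hasDerivAt_id z).pow 2).const_mul (lam / α))).add_const (lam / α ^ 2)).congr_deriv ?_
    simp
  have h2 := h1.unique hd
  unfold waitSol at h0 ⊢
  unfold sol
  have x1 : Real.exp (x * √(2 * α)) = Real.exp (z * √(2 * α)) * Real.exp (√(2 * α) * (x - z)) := by
    rw [← Real.exp_add]; ring_nf
  have x2 : Real.exp (-x * √(2 * α)) = Real.exp (-z * √(2 * α)) *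
      Real.exp (-(√(2 * α) * (x - z))) := by
    rw [← Real.exp_add]; ring_nf
  rw [x1, x2, ← Real.cosh_add_sinh (√(2 * α) * (x - z)), ← Real.cosh_sub_sinh]
  generalize Real.cosh _ = C
  generalize Real.sinh _ = S
  have hV : fitV α δ lam t z = a * Real.exp (z * √(2 * α)) + b * Real.exp (-z * √(2 * α)) := by
    unfold fitV; linarith
  have hD : fitD α δ lam t z / √(2 * α) =
      a * Real.exp (z * √(2 * α)) - b * Real.exp (-z * √(2 * α)) := by
    rw [div_eq_iff hk]; unfold fitD; linarith
  rw [hV, hD]; ring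

theorem contDiff_sol : ContDiff ℝ 2 (fun p : ℝ × ℝ × ℝ => sol α δ lam p.1 p.2.1 p.2.2) := by
  unfold sol fitV fitD
  fun_prop

theorem contDiff_sol_right (t z : ℝ) : ContDiff ℝ 2 (sol α δ lam t z) := by
  unfold sol
  fun_prop

theorem continuous_solX : Continuous (fun p : ℝ × ℝ × ℝ => solX α δ lam p.1 p.2.1 p.2.2) := by
  unfold solX fitV fitD
  fun_prop

theorem continuous_solXX : Continuous (fun p : ℝ × ℝ × ℝ => solXX α δ lam p.1 p.2.1 p.2.2) := by
  unfold solXX fitV fitD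
  fun_prop

theorem continuous_gap : Continuous (fun p : ℝ × ℝ => gap α δ lam p.1 p.2) := by
  unfold gap
  fun_prop

/-- The function `q` governs the slope of `(∂/∂x + ∂/∂c) Q` at the upper boundary. -/
theorem q_eq (H : Regime α δ lam) (x z : ℝ) :
    Real.sinh (√(2 * α) * (x - z)) * solXX α δ lam 0 z x
      + √(2 * α) * Real.cosh (√(2 * α) * (x - z)) * (1 - solX α δ lam 0 z x)
      = √(2 * α) * Real.exp (-z * √(2 * α)) * q α δ lam x z := by
  have hk := H.k_pos.ne'
  have hk2 := H.k_sq
  have hα := H.α_pos.ne'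
  have hl := H.lam_pos.ne'
  have hd : α * δ - lam ≠ 0 := (sub_pos.2 H.lam_lt).ne'
  have e1 : Real.exp (2 * z * √(2 * α)) = Real.exp (z * √(2 * α)) * Real.exp (z * √(2 * α)) := by
    rw [← Real.exp_add]; ring_nf
  have e2 : Real.exp (-z * √(2 * α)) = (Real.exp (z * √(2 * α)))⁻¹ := by
    rw [← Real.exp_neg]; ring_nf
  have e3 : Real.exp (x * √(2 * α)) = Real.exp (z * √(2 * α)) *
      (Real.cosh (√(2 * α) * (x - z)) + Real.sinh (√(2 * α) * (x - z))) := by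
    rw [Real.cosh_add_sinh, ← Real.exp_add]; ring_nf
  have e4 : Real.exp (-x * √(2 * α)) = (Real.exp (z * √(2 * α)))⁻¹ *
      (Real.cosh (√(2 * α) * (x - z)) - Real.sinh (√(2 * α) * (x - z))) := by
    rw [Real.cosh_sub_sinh, ← Real.exp_neg, ← Real.exp_add]; ring_nf
  have hcs := Real.cosh_sq (√(2 * α) * (x - z))
  unfold q h1 h2 h3 h4 rho solX solXX fitV fitD
  rw [e1, e3, e4, e2]
  have hE := (Real.exp_pos (z * √(2 * α))).ne'
  generalize Real.exp (z * √(2 * α)) = E at *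
  generalize Real.cosh _ = C at *
  generalize Real.sinh _ = S at *
  generalize √(2 * α) = k at *
  obtain rfl : α = k ^ 2 / 2 := by linarith
  field_simp
  -- The only relation needed between cosh and sinh: it absorbs the product of the two hyperbolic
  -- terms.
  have : C ^ 2 = S ^ 2 + 1 := hcs
  ring_nf
  rw [this]
  ring

end

end

section

section

variable {α δ lam : ℝ}

/-! ### The problem without fuel -/

theorem Regime.diff_pos (H : Regime α δ lam) : 0 < α * δ - lam := sub_pos.2 H.lam_lt

theorem Regime.f0_pos (H : Regime α δ lam) : 0 < f0 α δ lam := by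
  have h := H.diff_pos
  have h1 : (1 : ℝ) < (α * δ + lam) / (α * δ - lam) := by
    rw [lt_div_iff₀ h]; linarith [H.lam_pos]
  have h2 : 1 < √((α * δ + lam) / (α * δ - lam)) := by
    rw [Real.lt_sqrt (by norm_num)]; simpa using h1
  exact mul_pos (one_div_pos.2 H.k_pos) (sub_pos.2 h2)

/-- `f0` is the positive root of `rho`: completing the square turns the equation into (√(2α) f₀ +
1)² = (αδ + λ)/(αδ - λ). -/
theorem Regime.f0_quad (H : Regime α δ lam) :
    (α * δ - lam) * (f0 α δ lam ^ 2 + 2 * f0 α δ lam / √(2 * α)) = lam / α := by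
  have h := H.diff_pos
  have hk := H.k_pos.ne'
  have hk2 := H.k_sq
  have hα := H.α_pos.ne'
  have hs : √((α * δ + lam) / (α * δ - lam)) ^ 2 = (α * δ + lam) / (α * δ - lam) :=
    Real.sq_sqrt (div_nonneg (by nlinarith [H.lam_pos, mul_pos H.α_pos H.δ_pos]) h.le)
  unfold f0
  generalize √((α * δ + lam) / (α * δ - lam)) = s at *
  have e : (1 / √(2 * α) * (s - 1)) ^ 2 + 2 * (1 / √(2 * α) * (s - 1)) / √(2 * α)
      = (s ^ 2 - 1) / (2 * α) := by
    generalize √(2 * α) = k at *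
    rw [← hk2]; field_simp; ring
  rw [e, hs]
  field_simp
  ring

/-- On x > 0 the function x² + 2x/√(2α) is increasing, and `star` says that its value at 1/(2δ) is
below its value at f₀. This is where the lower bound on λ is used. -/
theorem Regime.half_lt_f0 (H : Regime α δ lam) : 1 / (2 * δ) < f0 α δ lam := by
  by_contra! hle
  have hk := H.k_pos
  have hf := H.f0_pos
  have h1 : f0 α δ lam ^ 2 ≤ (1 / (2 * δ)) ^ 2 := pow_le_pow_left₀ hf.le hle 2
  have h2 : 2 * f0 α δ lam / √(2 * α) ≤ 2 * (1 / (2 * δ)) / √(2 * α) := by gcongr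
  have h3 : (1 / (2 * δ)) ^ 2 + 2 * (1 / (2 * δ)) / √(2 * α) =
      1 / (4 * δ ^ 2) + 1 / (δ * √(2 * α)) := by
    have := H.δ_pos.ne'
    generalize √(2 * α) = k at *
    field_simp
    ring
  have h4 := mul_le_mul_of_nonneg_left (add_le_add h1 h2) H.diff_pos.le
  rw [H.f0_quad, h3] at h4
  exact absurd H.star h4.not_gt

theorem Regime.half_lt_level (H : Regime α δ lam) : 1 / (2 * δ) < α / (2 * lam) := by
  have := H.δ_pos
  have := H.lam_pos
  rw [div_lt_div_iff₀ (by positivity) (by positivity)]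
  nlinarith [H.lam_lt]

/-- For t = 0 the gap is δ - (αδ - λ)z², decreasing in z ≥ 0; at f₀ the quadratic equation gives δ -
λ/α plus a positive term. -/
theorem Regime.gap_zero_pos (H : Regime α δ lam) {z : ℝ} (h0 : 0 ≤ z) (hz : z ≤ f0 α δ lam) :
    0 < gap α δ lam 0 z := by
  have h1 := H.f0_quad
  have h2 : 0 < 2 * f0 α δ lam / √(2 * α) := div_pos (mul_pos two_pos H.f0_pos) H.k_pos
  have h3 : lam / α < δ := by rw [div_lt_iff₀ H.α_pos]; nlinarith [H.lam_lt]
  have h4 : z ^ 2 ≤ f0 α δ lam ^ 2 := pow_le_pow_left₀ h0 hz 2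
  unfold gap
  nlinarith [H.diff_pos, mul_pos H.diff_pos h2, mul_le_mul_of_nonneg_left h4 H.diff_pos.le]

theorem Regime.fitV_f0 (H : Regime α δ lam) :
    fitV α δ lam 0 (f0 α δ lam) = -(2 * f0 α δ lam / (α * √(2 * α)) * (α * δ - lam)) := by
  have h1 := H.f0_quad
  have hα := H.α_pos.ne'
  have hk := H.k_pos.ne'
  unfold fitV
  generalize f0 α δ lam = f at *
  have h2 : (α * δ - lam) * f ^ 2 = lam / α - (α * δ - lam) * (2 * f / √(2 * α)) := by linarith
  have h3 : δ * (f - 0) ^ 2 + 0 - lam / α * f ^ 2 - lam / α ^ 2 =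
      ((α * δ - lam) * f ^ 2 - lam / α) / α := by field_simp; ring
  rw [h3, h2]; field_simp; ring

theorem Regime.fitV_f0_neg (H : Regime α δ lam) : fitV α δ lam 0 (f0 α δ lam) < 0 := by
  rw [H.fitV_f0]
  have := H.f0_pos
  have := H.diff_pos
  have := H.k_pos
  have := H.α_pos
  exact neg_neg_of_pos (by positivity)

/-- This is what singles out f₀: the solution fitted there has no growing exponential, so its slope
grows at most linearly. -/
theorem Regime.fitD_f0 (H : Regime α δ lam) :
    fitD α δ lam 0 (f0 α δ lam) = -(√(2 * α) * fitV α δ lam 0 (f0 α δ lam)) := by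
  have hα := H.α_pos.ne'
  have hk := H.k_pos.ne'
  rw [H.fitV_f0]
  unfold fitD
  field_simp
  ring

theorem Regime.sol_f0 (H : Regime α δ lam) (x : ℝ) :
    sol α δ lam 0 (f0 α δ lam) x = fitV α δ lam 0 (f0 α δ lam) *
      Real.exp (-(√(2 * α) * (x - f0 α δ lam))) + lam / α * x ^ 2 + lam / α ^ 2 := by
  have hk := H.k_pos.ne'
  unfold sol
  rw [H.fitD_f0, ← Real.cosh_sub_sinh]
  field_simp
  ring

theorem Regime.solX_f0 (H : Regime α δ lam) (x : ℝ) :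
    solX α δ lam 0 (f0 α δ lam) x = -(√(2 * α) * fitV α δ lam 0 (f0 α δ lam)) *
      Real.exp (-(√(2 * α) * (x - f0 α δ lam))) + 2 * (lam / α) * x := by
  unfold solX
  rw [H.fitD_f0, ← Real.cosh_sub_sinh]
  ring

theorem Regime.solX_f0_nonneg (H : Regime α δ lam) {x : ℝ} (hx : 0 ≤ x) :
    0 ≤ solX α δ lam 0 (f0 α δ lam) x := by
  rw [H.solX_f0]
  have h1 : 0 < -(√(2 * α) * fitV α δ lam 0 (f0 α δ lam)) := by
    nlinarith [H.k_pos, H.fitV_f0_neg, mul_pos H.k_pos (neg_pos.2 H.fitV_f0_neg)]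
  have := H.lam_pos
  have := H.α_pos
  positivity

theorem Regime.solX_f0_le (H : Regime α δ lam) {x : ℝ} (hx : f0 α δ lam ≤ x) :
    solX α δ lam 0 (f0 α δ lam) x ≤
      -(√(2 * α) * fitV α δ lam 0 (f0 α δ lam)) + 2 * (lam / α) * x := by
  rw [H.solX_f0]
  have h1 : 0 < -(√(2 * α) * fitV α δ lam 0 (f0 α δ lam)) := by
    nlinarith [H.k_pos, H.fitV_f0_neg, mul_pos H.k_pos (neg_pos.2 H.fitV_f0_neg)]
  have h2 : Real.exp (-(√(2 * α) * (x - f0 α δ lam))) ≤ 1 := by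
    rw [Real.exp_le_one_iff]
    nlinarith [mul_nonneg H.k_pos.le (sub_nonneg.2 hx)]
  nlinarith

theorem V0_of_le {x : ℝ} (hx : x ≤ f0 α δ lam) : V0 α δ lam x = δ * x ^ 2 := if_pos hx

theorem Regime.V0_of_ge (H : Regime α δ lam) {x : ℝ} (hx : f0 α δ lam ≤ x) :
    V0 α δ lam x = sol α δ lam 0 (f0 α δ lam) x := by
  rcases hx.eq_or_lt with h | h
  · rw [V0_of_le h.ge, ← h]; simp
  · rw [V0, if_neg h.not_ge, H.sol_f0, H.fitV_f0, B0]
    have : Real.exp (-(√(2 * α) * (x - f0 α δ lam))) =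
        Real.exp (f0 α δ lam * √(2 * α)) * Real.exp (-x * √(2 * α)) := by
      rw [← Real.exp_add]; ring_nf
    rw [this]; ring

def V0X (α δ lam x : ℝ) : ℝ :=
  if x ≤ f0 α δ lam then 2 * δ * x else solX α δ lam 0 (f0 α δ lam) x

theorem V0X_of_le {x : ℝ} (hx : x ≤ f0 α δ lam) : V0X α δ lam x = 2 * δ * x := if_pos hx

theorem V0X_of_ge {x : ℝ} (hx : f0 α δ lam ≤ x) :
    V0X α δ lam x = solX α δ lam 0 (f0 α δ lam) x := by
  rcases hx.eq_or_lt with h | h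
  · rw [V0X_of_le h.ge, ← h]; simp
  · rw [V0X, if_neg h.not_ge]

theorem hasDerivAt_sq_mul (x : ℝ) : HasDerivAt (fun y => δ * y ^ 2) (2 * δ * x) x := by
  refine (((hasDerivAt_id x).pow 2).const_mul δ).congr_deriv ?_
  simp; ring

theorem Regime.hasDerivAt_V0 (H : Regime α δ lam) (x : ℝ) :
    HasDerivAt (V0 α δ lam) (V0X α δ lam x) x := by
  rcases lt_trichotomy x (f0 α δ lam) with h | h | h
  · rw [V0X_of_le h.le]
    refine (hasDerivAt_sq_mul x).congr_of_eventuallyEq ?_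
    filter_upwards [Iio_mem_nhds h] with y hy using V0_of_le (le_of_lt hy)
  · have w1 : HasDerivWithinAt (V0 α δ lam) (V0X α δ lam x) (Iic x) x := by
      rw [V0X_of_le h.le]
      exact (hasDerivAt_sq_mul x).hasDerivWithinAt.congr (fun y hy => V0_of_le (hy.trans h.le))
        (V0_of_le h.le)
    have w2 : HasDerivWithinAt (V0 α δ lam) (V0X α δ lam x) (Ici x) x := by
      rw [V0X_of_ge h.ge]
      exact (hasDerivAt_sol H 0 _ x).hasDerivWithinAt.congr
        (fun y hy => H.V0_of_ge (h.ge.trans hy)) (H.V0_of_ge h.ge)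
    simpa using w1.union w2
  · rw [V0X_of_ge h.le]
    refine (hasDerivAt_sol H 0 _ x).congr_of_eventuallyEq ?_
    filter_upwards [Ioi_mem_nhds h] with y hy using H.V0_of_ge (le_of_lt hy)

theorem Regime.contDiff_V0 (H : Regime α δ lam) : ContDiff ℝ 1 (V0 α δ lam) := by
  rw [contDiff_iff_contDiffAt]
  intro x
  refine contDiffAt_one_of_deriv (Eventually.of_forall H.hasDerivAt_V0)
    (Eventually.of_forall fun y => ?_)
  have : Continuous (V0X α δ lam) := by
    unfold V0X
    refine Continuous.if_le (by fun_prop) ?_ continuous_id continuous_const ?_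
    · unfold solX; fun_prop
    · intro x hx; rw [show x = f0 α δ lam from hx]; simp
  exact this.continuousAt

theorem Regime.V0X_nonneg (H : Regime α δ lam) {x : ℝ} (hx : 0 ≤ x) : 0 ≤ V0X α δ lam x := by
  unfold V0X
  split_ifs
  · have := H.δ_pos; positivity
  · exact H.solX_f0_nonneg hx

/-- Beyond f₀ the exponential part of the slope of `V0` only decays and its linear part has
coefficient 2λ/α < 2δ, so the difference from δx², zero at f₀, increases. -/
theorem Regime.V0_le (H : Regime α δ lam) (x : ℝ) : V0 α δ lam x ≤ δ * x ^ 2 := by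
  rcases le_total x (f0 α δ lam) with h | h
  · exact (V0_of_le h).le
  rw [H.V0_of_ge h]
  have hd : ∀ y, HasDerivAt (fun y => δ * y ^ 2 - sol α δ lam 0 (f0 α δ lam) y)
      (2 * δ * y - solX α δ lam 0 (f0 α δ lam) y) y := fun y =>
    (hasDerivAt_sq_mul y).sub (hasDerivAt_sol H 0 _ y)
  have hm : MonotoneOn (fun y => δ * y ^ 2 - sol α δ lam 0 (f0 α δ lam) y)
      (Ici (f0 α δ lam)) := by
    refine monotoneOn_of_deriv_nonneg (convex_Ici _)
      (fun y _ => (hd y).continuousAt.continuousWithinAt)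
      (fun y _ => (hd y).differentiableAt.differentiableWithinAt) fun y hy => ?_
    rw [interior_Ici] at hy
    rw [(hd y).deriv]
    have h1 := H.solX_f0_le (le_of_lt hy)
    have h2 : solX α δ lam 0 (f0 α δ lam) (f0 α δ lam) = 2 * δ * (f0 α δ lam - 0) := solX_self _ _
    rw [H.solX_f0] at h2
    rw [sub_self, mul_zero, neg_zero, Real.exp_zero] at h2
    have h3 : lam / α < δ := by rw [div_lt_iff₀ H.α_pos]; nlinarith [H.lam_lt]
    have hy' : f0 α δ lam < y := hy
    nlinarith [mul_pos (sub_pos.2 h3) (sub_pos.2 hy')]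
  have := hm self_mem_Ici h h
  simp only [sol_self] at this
  simp at this
  linarith

/-! ### Comparison results for the waiting equation -/

/-- N = 1 - D solves N'' = 2αN + (4λx - 2α). Where the source is nonnegative, beyond α/(2λ), N ≥ 0
follows from the data at g; where it is negative, from the two endpoint values. If g lies below
α/(2λ), no slope condition at g is needed. -/
theorem solX_add_solC_le_one (H : Regime α δ lam) {t z τ ζ f g : ℝ}
    (hNf : solX α δ lam t z f + solC α δ lam t z τ ζ f ≤ 1)
    (hg : solX α δ lam t z g + solC α δ lam t z τ ζ g = 1)
    (hg1 : α / (2 * lam) ≤ g → 0 ≤ solXX α δ lam t z g + solXC α δ lam t z τ ζ g) {x : ℝ}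
    (hx : x ∈ Icc f g) : solX α δ lam t z x + solC α δ lam t z τ ζ x ≤ 1 := by
  have hl := H.lam_pos
  set N : ℝ → ℝ := fun x => 1 - (solX α δ lam t z x + solC α δ lam t z τ ζ x) with hNd
  set N1 : ℝ → ℝ := fun x => -(solXX α δ lam t z x + solXC α δ lam t z τ ζ x) with hN1d
  have hN : ∀ x, HasDerivAt N (N1 x) x := fun x =>
    ((hasDerivAt_solX H t z x).add (hasDerivAt_solC H t z τ ζ x)).const_sub 1
  have hN1 : ∀ x, HasDerivAt N1 (√(2 * α) ^ 2 * N x + (4 * lam * x - 2 * α)) x := fun x => by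
    refine ((hasDerivAt_solXX H t z x).add (hasDerivAt_solXC H t z τ ζ x)).neg.congr_deriv ?_
    rw [H.k_sq]; simp only [hNd]; ring
  have hneg : ∀ y, y < α / (2 * lam) → 4 * lam * y - 2 * α < 0 := fun y hy => by
    rw [lt_div_iff₀ (by positivity)] at hy; linarith
  have hpos : ∀ y, α / (2 * lam) ≤ y → 0 ≤ 4 * lam * y - 2 * α := fun y hy => by
    rw [div_le_iff₀ (by positivity)] at hy; linarith
  suffices 0 ≤ N x by simp only [hNd] at this; linarith
  have hNf' : 0 ≤ N f := by simp only [hNd]; linarith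
  have hNg : 0 ≤ N g := by simp only [hNd]; linarith
  rcases le_total g (α / (2 * lam)) with hgm | hgm
  · exact nonneg_of_ode_of_endpoints hN hN1 (fun y hy => hneg y (hy.2.trans_le hgm)) hNf' hNg hx
  · have hA : ∀ y ∈ Icc (α / (2 * lam)) g, 0 ≤ N y := fun y hy =>
      nonneg_left_of_ode hN hN1 (fun y hy => hpos y hy.1) hNg
        (by simp only [hN1d]; linarith [hg1 hgm]) hy
    rcases le_total x (α / (2 * lam)) with hxm | hxm
    · exact nonneg_of_ode_of_endpoints hN hN1 (fun y hy => hneg y hy.2) hNf'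
        (hA _ (left_mem_Icc.2 hgm)) ⟨hx.1, hxm⟩
    · exact hA x ⟨hxm, hx.2⟩

/-- The slope satisfies u'' = 2αu - 4λx, whose source is negative for x > 0, so the minimum
principle applies. -/
theorem solX_nonneg (H : Regime α δ lam) {t z f g : ℝ} (hf : 0 ≤ f)
    (hNf : 0 ≤ solX α δ lam t z f) (hg : 0 ≤ solX α δ lam t z g) {x : ℝ}
    (hx : x ∈ Icc f g) : 0 ≤ solX α δ lam t z x := by
  refine nonneg_of_ode_of_endpoints (κ := √(2 * α)) (r := fun x => -(4 * lam * x))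
    (hasDerivAt_solX H t z) (fun x => ?_) (fun y hy => ?_) hNf hg hx
  · rw [H.k_sq]; exact (hasDerivAt_solXX H t z x).congr_deriv (by ring)
  · have := H.lam_pos
    have : 0 < y := hf.trans_lt hy.1
    simp only [neg_lt_zero]; positivity

theorem cosh_le_exp_of_nonneg {u : ℝ} (hu : 0 ≤ u) : Real.cosh u ≤ Real.exp u := by
  rw [← Real.cosh_add_sinh]; linarith [Real.sinh_nonneg_iff.2 hu]

theorem abs_sinh_le_cosh (u : ℝ) : |Real.sinh u| ≤ Real.cosh u := by
  rw [abs_le]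
  constructor
  · linarith [Real.cosh_add_sinh u, Real.exp_pos u]
  · exact (Real.sinh_lt_cosh u).le

theorem abs_hyp_le {a b u B : ℝ} (hB : Real.cosh u ≤ B) :
    |a * Real.sinh u + b * Real.cosh u| ≤ (|a| + |b|) * B := by
  have h0 := (Real.cosh_pos u).le
  calc |a * Real.sinh u + b * Real.cosh u| ≤ |a| * |Real.sinh u| + |b| * |Real.cosh u| := by
        rw [← abs_mul, ← abs_mul]; exact abs_add_le _ _
    _ ≤ |a| * B + |b| * B := by
        gcongr
        · exact (abs_sinh_le_cosh u).trans hB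
        · rwa [abs_of_nonneg h0]
    _ = _ := by ring

theorem cosh_shift_le (H : Regime α δ lam) {z x : ℝ} (hz : 0 ≤ z) (hx : z ≤ x) :
    Real.cosh (√(2 * α) * (x - z)) ≤ Real.exp (√(2 * α) * x) := by
  refine (cosh_le_exp_of_nonneg (mul_nonneg H.k_pos.le (sub_nonneg.2 hx))).trans ?_
  rw [Real.exp_le_exp]
  nlinarith [mul_nonneg H.k_pos.le hz]

/-- Uniform bounds for the first two derivatives of the fitted solutions. -/
theorem exists_sol_bound (H : Regime α δ lam) (T Z : ℝ) : ∃ M : ℝ, 0 < M ∧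
    ∀ t ∈ Icc 0 T, ∀ z ∈ Icc 0 Z, ∀ x, z ≤ x →
      |solX α δ lam t z x| ≤ M * Real.exp (√(2 * α) * x) + 2 * (lam / α) * x ∧
      |solXX α δ lam t z x| ≤ M * Real.exp (√(2 * α) * x) := by
  have hcV : Continuous (fun p : ℝ × ℝ => fitV α δ lam p.1 p.2) := by unfold fitV; fun_prop
  have hcD : Continuous (fun p : ℝ × ℝ => fitD α δ lam p.1 p.2) := by unfold fitD; fun_prop
  obtain ⟨A, hA⟩ := ((isCompact_Icc (a := (0 : ℝ)) (b := T)).prod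
    (isCompact_Icc (a := (0 : ℝ)) (b := Z))).exists_bound_of_continuousOn hcV.continuousOn
  obtain ⟨B, hB⟩ := ((isCompact_Icc (a := (0 : ℝ)) (b := T)).prod
    (isCompact_Icc (a := (0 : ℝ)) (b := Z))).exists_bound_of_continuousOn hcD.continuousOn
  have hk := H.k_pos
  have hα := H.α_pos
  have hl := H.lam_pos
  set k := √(2 * α) with hkd
  refine ⟨k * |A| + |B| + (2 * α * |A| + k * |B|) + 2 * (lam / α), by positivity,
    fun t ht z hz x hx => ?_⟩
  have hx0 : 0 ≤ x := hz.1.trans hx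
  have hE := cosh_shift_le H hz.1 hx
  rw [← hkd] at hE
  have hE1 : 1 ≤ Real.exp (k * x) := Real.one_le_exp (by positivity)
  have hV : |fitV α δ lam t z| ≤ |A| := (hA (t, z) ⟨ht, hz⟩).trans (le_abs_self A)
  have hD : |fitD α δ lam t z| ≤ |B| := (hB (t, z) ⟨ht, hz⟩).trans (le_abs_self B)
  constructor
  · have h1 := abs_hyp_le (a := k * fitV α δ lam t z) (b := fitD α δ lam t z) hE
    rw [abs_mul, abs_of_pos hk] at h1
    have h2 : (k * |fitV α δ lam t z| + |fitD α δ lam t z|) * Real.exp (k * x) ≤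
        (k * |A| + |B| + (2 * α * |A| + k * |B|) + 2 * (lam / α)) * Real.exp (k * x) := by
      refine mul_le_mul_of_nonneg_right ?_ (Real.exp_pos _).le
      have : k * |fitV α δ lam t z| ≤ k * |A| := by gcongr
      have : 0 ≤ 2 * α * |A| + k * |B| + 2 * (lam / α) := by positivity
      linarith
    have h3 : |2 * (lam / α) * x| = 2 * (lam / α) * x := abs_of_nonneg (by positivity)
    unfold solX
    refine (abs_add_le _ _).trans ?_
    rw [h3]
    linarith
  · have h1 := abs_hyp_le (a := k * fitD α δ lam t z) (b := 2 * α * fitV α δ lam t z) hE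
    rw [abs_mul k, abs_mul (2 * α), abs_of_pos hk, abs_of_pos (by positivity : 0 < 2 * α)] at h1
    have h2 : (k * |fitD α δ lam t z| + 2 * α * |fitV α δ lam t z| + 2 * (lam / α)) *
        Real.exp (k * x) ≤
        (k * |A| + |B| + (2 * α * |A| + k * |B|) + 2 * (lam / α)) * Real.exp (k * x) := by
      refine mul_le_mul_of_nonneg_right ?_ (Real.exp_pos _).le
      have : k * |fitD α δ lam t z| ≤ k * |B| := by gcongr
      have : 2 * α * |fitV α δ lam t z| ≤ 2 * α * |A| := by gcongr
      have : 0 ≤ k * |A| + |B| := by positivity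
      linarith
    have h3 : |2 * (lam / α)| = 2 * (lam / α) := abs_of_nonneg (by positivity)
    have h4 : 2 * (lam / α) ≤ 2 * (lam / α) * Real.exp (k * x) :=
      le_mul_of_one_le_right (by positivity) hE1
    unfold solXX
    refine (abs_add_le _ _).trans ?_
    rw [h3, add_comm (2 * α * _ * _)]
    rw [← hkd]
    linarith

end

end

section

/-! ### Geometry of the boundaries -/

theorem lt_of_strictAntiOn_of_tendsto {f : ℝ → ℝ} {s : Set ℝ} {l c : ℝ} (hs : Ioc 0 c ⊆ s)
    (hf : StrictAntiOn f s) (hl : Tendsto f (𝓝[>] 0) (𝓝 l)) (hc : 0 < c) : f c < l := by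
  -- Passing to the limit yields only a weak inequality; comparing through the intermediate point
  -- c/2 keeps it strict.
  have h2 : c / 2 ∈ s := hs ⟨by linarith, by linarith⟩
  have h1 : f c < f (c / 2) := hf h2 (hs ⟨hc, le_rfl⟩) (by linarith)
  refine h1.trans_le (ge_of_tendsto hl ?_)
  filter_upwards [Ioo_mem_nhdsGT (half_pos hc)] with d hd
  exact (hf (hs ⟨hd.1, by linarith [hd.2]⟩) h2 hd.2).le

theorem gt_of_strictMonoOn_of_tendsto {f : ℝ → ℝ} {s : Set ℝ} {l c : ℝ} (hs : Ioc 0 c ⊆ s)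
    (hf : StrictMonoOn f s) (hl : Tendsto f (𝓝[>] 0) (𝓝 l)) (hc : 0 < c) : l < f c := by
  have := lt_of_strictAntiOn_of_tendsto (f := fun x => -f x) hs hf.neg hl.neg hc
  linarith

namespace AdmissibleBoundaries

variable {α δ lam cI cbar g0 : ℝ} {F G Fb Gb : ℝ → ℝ}

theorem F_contDiffAt (B : AdmissibleBoundaries α δ lam cI cbar g0 F G Fb Gb) {c : ℝ} (hc : 0 < c)
    (hne : c ≠ cbar) : ContDiffAt ℝ 1 F c :=
  B.F_C1.contDiffAt ((isOpen_Ioi.sdiff isClosed_singleton).mem_nhds ⟨hc, hne⟩)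

theorem G_contDiffAt (B : AdmissibleBoundaries α δ lam cI cbar g0 F G Fb Gb) {c : ℝ} (hc : 0 < c)
    (hne : c ≠ cbar) : ContDiffAt ℝ 1 G c :=
  B.G_C1.contDiffAt ((isOpen_Ioi.sdiff isClosed_singleton).mem_nhds ⟨hc, hne⟩)

theorem Fb_contDiffAt (B : AdmissibleBoundaries α δ lam cI cbar g0 F G Fb Gb) {c : ℝ}
    (hc : c ∈ Ioo 0 cI) : ContDiffAt ℝ 1 Fb c :=
  B.Fb_C1.contDiffAt (isOpen_Ioo.mem_nhds hc)

theorem Gb_contDiffAt (B : AdmissibleBoundaries α δ lam cI cbar g0 F G Fb Gb) {c : ℝ}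
    (hc : c ∈ Ioo 0 cI) : ContDiffAt ℝ 1 Gb c :=
  B.Gb_C1.contDiffAt (isOpen_Ioo.mem_nhds hc)

theorem F_continuousAt (B : AdmissibleBoundaries α δ lam cI cbar g0 F G Fb Gb) {c : ℝ}
    (hc : 0 < c) : ContinuousAt F c := B.F_cont.continuousAt (Ioi_mem_nhds hc)

theorem G_continuousAt (B : AdmissibleBoundaries α δ lam cI cbar g0 F G Fb Gb) {c : ℝ}
    (hc : 0 < c) : ContinuousAt G c := B.G_cont.continuousAt (Ioi_mem_nhds hc)

theorem G_hasDerivAt (B : AdmissibleBoundaries α δ lam cI cbar g0 F G Fb Gb) {c : ℝ} (hc : 0 < c)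
    (hne : c ≠ cbar) : HasDerivAt G (deriv G c) c :=
  ((B.G_contDiffAt hc hne).differentiableAt (by norm_num)).hasDerivAt

theorem Fb_hasDerivAt (B : AdmissibleBoundaries α δ lam cI cbar g0 F G Fb Gb) {c : ℝ}
    (hc : c ∈ Ioo 0 cI) : HasDerivAt Fb (deriv Fb c) c :=
  ((B.Fb_contDiffAt hc).differentiableAt (by norm_num)).hasDerivAt

theorem Gb_hasDerivAt (B : AdmissibleBoundaries α δ lam cI cbar g0 F G Fb Gb) {c : ℝ}
    (hc : c ∈ Ioo 0 cI) : HasDerivAt Gb (deriv Gb c) c :=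
  ((B.Gb_contDiffAt hc).differentiableAt (by norm_num)).hasDerivAt

theorem Ioc_union_Ici_cbar (B : AdmissibleBoundaries α δ lam cI cbar g0 F G Fb Gb) :
    Ioc 0 cbar ∪ Ici cbar = Ioi 0 := Ioc_union_Ici_eq_Ioi B.cbar_pos

theorem F_strictAntiOn (B : AdmissibleBoundaries α δ lam cI cbar g0 F G Fb Gb) :
    StrictAntiOn F (Ioi 0) := by
  rw [← B.Ioc_union_Ici_cbar]
  refine StrictAntiOn.union (c := cbar) ?_ ?_ (isGreatest_Ioc B.cbar_pos) isLeast_Ici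
  · refine strictAntiOn_of_deriv_neg (convex_Ioc _ _) (B.F_cont.mono Ioc_subset_Ioi_self)
      fun c hc => ?_
    rw [interior_Ioc] at hc
    exact B.F_deriv c hc.1 hc.2.ne
  · refine strictAntiOn_of_deriv_neg (convex_Ici _)
      (B.F_cont.mono fun c hc => B.cbar_pos.trans_le hc) fun c hc => ?_
    rw [interior_Ici] at hc
    exact B.F_deriv c (B.cbar_pos.trans hc) (ne_of_gt hc)

/-- G(c) - c labels the diagonal through the boundary point. As G' > 1 below c̄, a diagonal followed
downwards from G stays above G there; beyond c̄, where G' < 1, it enters region II instead. -/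
theorem diag_strictMonoOn (B : AdmissibleBoundaries α δ lam cI cbar g0 F G Fb Gb) :
    StrictMonoOn (fun c => G c - c) (Ioc 0 cbar) := by
  refine strictMonoOn_of_deriv_pos (convex_Ioc _ _)
    ((B.G_cont.mono Ioc_subset_Ioi_self).sub continuousOn_id) fun c hc => ?_
  rw [interior_Ioc] at hc
  rw [show deriv (fun c => G c - c) c = _ from
    ((B.G_hasDerivAt hc.1 hc.2.ne).sub (hasDerivAt_id c)).deriv]
  linarith [B.G_deriv_low c hc]

theorem diag_strictAntiOn (B : AdmissibleBoundaries α δ lam cI cbar g0 F G Fb Gb) :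
    StrictAntiOn (fun c => G c - c) (Ici cbar) := by
  refine strictAntiOn_of_deriv_neg (convex_Ici _)
    ((B.G_cont.mono fun c hc => B.cbar_pos.trans_le hc).sub continuousOn_id) fun c hc => ?_
  rw [interior_Ici] at hc
  rw [show deriv (fun c => G c - c) c = _ from
    ((B.G_hasDerivAt (B.cbar_pos.trans hc) (ne_of_gt hc)).sub (hasDerivAt_id c)).deriv]
  linarith [(B.G_deriv_high c hc).2]

/-- The label increases up to c̄ and decreases afterwards, so diagonals with a label above G(c̄) -
c̄ never meet G. -/
theorem diag_le (B : AdmissibleBoundaries α δ lam cI cbar g0 F G Fb Gb) {c : ℝ} (hc : 0 < c) :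
    G c - c ≤ G cbar - cbar := by
  rcases le_total c cbar with h | h
  · exact B.diag_strictMonoOn.monotoneOn ⟨hc, h⟩ ⟨B.cbar_pos, le_rfl⟩ h
  · exact B.diag_strictAntiOn.antitoneOn self_mem_Ici h h

theorem G_strictMonoOn (B : AdmissibleBoundaries α δ lam cI cbar g0 F G Fb Gb) :
    StrictMonoOn G (Ioi 0) := by
  rw [← B.Ioc_union_Ici_cbar]
  refine StrictMonoOn.union (c := cbar) ?_ ?_ (isGreatest_Ioc B.cbar_pos) isLeast_Ici
  · intro a ha b hb hab
    have := B.diag_strictMonoOn ha hb hab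
    simp only at this
    linarith
  · refine strictMonoOn_of_deriv_pos (convex_Ici _)
      (B.G_cont.mono fun c hc => B.cbar_pos.trans_le hc) fun c hc => ?_
    rw [interior_Ici] at hc
    exact (B.G_deriv_high c hc).1

theorem F_lt (B : AdmissibleBoundaries α δ lam cI cbar g0 F G Fb Gb) {c : ℝ} (hc : 0 < c) :
    F c < 1 / (2 * δ) := by
  obtain ⟨l, hl, hle⟩ := B.F_lim
  exact (lt_of_strictAntiOn_of_tendsto Ioc_subset_Ioi_self B.F_strictAntiOn hl hc).trans_le hle

theorem half_lt_diag (B : AdmissibleBoundaries α δ lam cI cbar g0 F G Fb Gb) {c : ℝ}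
    (hc : c ∈ Ioc 0 cbar) : 1 / (2 * δ) < G c - c := by
  obtain ⟨l, hl, hle⟩ := B.G_lim
  have h0 : Tendsto (fun c => G c - c) (𝓝[>] 0) (𝓝 (l - 0)) :=
    hl.sub (tendsto_id.mono_left nhdsWithin_le_nhds)
  have := gt_of_strictMonoOn_of_tendsto (Ioc_subset_Ioc_right hc.2) B.diag_strictMonoOn h0 hc.1
  linarith

theorem half_lt_G (B : AdmissibleBoundaries α δ lam cI cbar g0 F G Fb Gb) {c : ℝ} (hc : 0 < c) :
    1 / (2 * δ) < G c := by
  obtain ⟨l, hl, hle⟩ := B.G_lim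
  exact hle.trans_lt (gt_of_strictMonoOn_of_tendsto Ioc_subset_Ioi_self B.G_strictMonoOn hl hc)

theorem F_lt_G (B : AdmissibleBoundaries α δ lam cI cbar g0 F G Fb Gb) {c : ℝ} (hc : 0 < c) :
    F c < G c := (B.F_lt hc).trans (B.half_lt_G hc)

theorem level_le_G (B : AdmissibleBoundaries α δ lam cI cbar g0 F G Fb Gb) {c : ℝ}
    (hc : cbar ≤ c) : α / (2 * lam) ≤ G c := by
  rcases hc.eq_or_lt with rfl | h
  · have h1 : Tendsto G (𝓝[>] cbar) (𝓝 (G cbar)) :=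
      (B.G_continuousAt B.cbar_pos).continuousWithinAt
    exact ge_of_tendsto h1 (by filter_upwards [self_mem_nhdsWithin] with c hc using B.G_ge c hc)
  · exact B.G_ge c h

theorem Fb_strictMonoOn (B : AdmissibleBoundaries α δ lam cI cbar g0 F G Fb Gb) :
    StrictMonoOn Fb (Ioc 0 cI) := by
  refine strictMonoOn_of_deriv_pos (convex_Ioc _ _) B.Fb_cont fun c hc => ?_
  rw [interior_Ioc] at hc
  exact (B.Fb_deriv c hc).1

theorem Fb_diag_strictAntiOn (B : AdmissibleBoundaries α δ lam cI cbar g0 F G Fb Gb) :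
    StrictAntiOn (fun c => Fb c - c) (Ioc 0 cI) := by
  refine strictAntiOn_of_deriv_neg (convex_Ioc _ _) (B.Fb_cont.sub continuousOn_id) fun c hc => ?_
  rw [interior_Ioc] at hc
  rw [show deriv (fun c => Fb c - c) c = _ from
    ((B.Fb_hasDerivAt hc).sub (hasDerivAt_id c)).deriv]
  linarith [(B.Fb_deriv c hc).2]

theorem Gb_strictAntiOn (B : AdmissibleBoundaries α δ lam cI cbar g0 F G Fb Gb) :
    StrictAntiOn Gb (Ioc 0 cI) := by
  refine strictAntiOn_of_deriv_neg (convex_Ioc _ _) B.Gb_cont fun c hc => ?_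
  rw [interior_Ioc] at hc
  exact B.Gb_deriv c hc

theorem Gb_diag_strictAntiOn (B : AdmissibleBoundaries α δ lam cI cbar g0 F G Fb Gb) :
    StrictAntiOn (fun c => Gb c - c) (Ioc 0 cI) := fun a ha b hb hab => by
  have := B.Gb_strictAntiOn ha hb hab
  simp only
  linarith

theorem Fb_lt_level (B : AdmissibleBoundaries α δ lam cI cbar g0 F G Fb Gb) {c : ℝ}
    (hc : c ∈ Ioo 0 cI) : Fb c < α / (2 * lam) := by
  rw [← B.Fb_end (hc.1.trans hc.2)]
  exact B.Fb_strictMonoOn ⟨hc.1, hc.2.le⟩ ⟨hc.1.trans hc.2, le_rfl⟩ hc.2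

theorem Fb_le_level (B : AdmissibleBoundaries α δ lam cI cbar g0 F G Fb Gb) {c : ℝ}
    (hc : c ∈ Ioc 0 cI) : Fb c ≤ α / (2 * lam) := by
  rw [← B.Fb_end (hc.1.trans_le hc.2)]
  exact B.Fb_strictMonoOn.monotoneOn hc ⟨hc.1.trans_le hc.2, le_rfl⟩ hc.2

theorem level_lt_Gb (B : AdmissibleBoundaries α δ lam cI cbar g0 F G Fb Gb) {c : ℝ}
    (hc : c ∈ Ioo 0 cI) : α / (2 * lam) < Gb c := by
  rw [← B.Gb_end (hc.1.trans hc.2)]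
  exact B.Gb_strictAntiOn ⟨hc.1, hc.2.le⟩ ⟨hc.1.trans hc.2, le_rfl⟩ hc.2

theorem Fb_lt_Gb (B : AdmissibleBoundaries α δ lam cI cbar g0 F G Fb Gb) {c : ℝ}
    (hc : c ∈ Ioo 0 cI) : Fb c < Gb c := (B.Fb_lt_level hc).trans (B.level_lt_Gb hc)

theorem G_lt_Gb (B : AdmissibleBoundaries α δ lam cI cbar g0 F G Fb Gb) {c : ℝ}
    (hc : c ∈ Ioc 0 cI) : G c < Gb c := by
  refine (B.G_lt_Fb c hc).trans_le ?_
  rcases hc.2.eq_or_lt with rfl | h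
  · rw [B.Fb_end hc.1, B.Gb_end hc.1]
  · exact (B.Fb_lt_Gb ⟨hc.1, h⟩).le

/-- If cI ≥ c̄, then cI > 0 and G(cI) ≥ α/(2λ) = F̄(cI), contradicting G < F̄. -/
theorem cI_lt_cbar (B : AdmissibleBoundaries α δ lam cI cbar g0 F G Fb Gb) : cI < cbar := by
  by_contra! h
  have h1 := B.level_le_G h
  have hI : 0 < cI := B.cbar_pos.trans_le h
  have h2 := B.G_lt_Fb cI ⟨hI, le_rfl⟩
  rw [B.Fb_end hI] at h2
  linarith

theorem f0_lt_Fb (B : AdmissibleBoundaries α δ lam cI cbar g0 F G Fb Gb) {c : ℝ}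
    (hc : c ∈ Ioc 0 cI) : f0 α δ lam < Fb c :=
  gt_of_strictMonoOn_of_tendsto (Ioc_subset_Ioc_right hc.2) B.Fb_strictMonoOn
    (B.Fb_lim (hc.1.trans_le hc.2)) hc.1

theorem Fb_diag_lt (B : AdmissibleBoundaries α δ lam cI cbar g0 F G Fb Gb) {c : ℝ}
    (hc : c ∈ Ioc 0 cI) : Fb c - c < f0 α δ lam := by
  have h0 : Tendsto (fun c => Fb c - c) (𝓝[>] 0) (𝓝 (f0 α δ lam - 0)) :=
    (B.Fb_lim (hc.1.trans_le hc.2)).sub (tendsto_id.mono_left nhdsWithin_le_nhds)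
  have := lt_of_strictAntiOn_of_tendsto (Ioc_subset_Ioc_right hc.2) B.Fb_diag_strictAntiOn h0 hc.1
  linarith

theorem Gb_lt_g0 (B : AdmissibleBoundaries α δ lam cI cbar g0 F G Fb Gb) {c : ℝ}
    (hc : c ∈ Ioc 0 cI) : Gb c < g0 :=
  lt_of_strictAntiOn_of_tendsto (Ioc_subset_Ioc_right hc.2) B.Gb_strictAntiOn
    (B.Gb_lim (hc.1.trans_le hc.2)) hc.1

theorem f0_lt_level (B : AdmissibleBoundaries α δ lam cI cbar g0 F G Fb Gb) (hI : 0 < cI) :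
    f0 α δ lam < α / (2 * lam) := by
  rw [← B.Fb_end hI]
  exact B.f0_lt_Fb ⟨hI, le_rfl⟩

theorem Fb_diag_ge (B : AdmissibleBoundaries α δ lam cI cbar g0 F G Fb Gb) {c : ℝ}
    (hc : c ∈ Ioc 0 cI) : α / (2 * lam) - cI ≤ Fb c - c := by
  have hI := hc.1.trans_le hc.2
  have := B.Fb_diag_strictAntiOn.antitoneOn hc ⟨hI, le_rfl⟩ hc.2
  simp only [B.Fb_end hI] at this
  exact this

theorem diag_cI_lt (B : AdmissibleBoundaries α δ lam cI cbar g0 F G Fb Gb) (hI : 0 < cI) :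
    G cI - cI < α / (2 * lam) - cI := by
  have := B.G_lt_Fb cI ⟨hI, le_rfl⟩
  rw [B.Fb_end hI] at this
  linarith

theorem half_lt_level_sub (B : AdmissibleBoundaries α δ lam cI cbar g0 F G Fb Gb) (hI : 0 < cI) :
    1 / (2 * δ) < α / (2 * lam) - cI :=
  (B.half_lt_diag ⟨hI, B.cI_lt_cbar.le⟩).trans (B.diag_cI_lt hI)

end AdmissibleBoundaries

end

section

/-! ### Transport along the diagonals -/

section

variable {α δ lam cI cbar g0 : ℝ} {F G Fb Gb : ℝ → ℝ} {Q : ℝ → ℝ → ℝ}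

theorem mem_regionIV {x c : ℝ} (hc : 0 < c) (hx : G c ≤ x) (h : c < cI → x ≤ Fb c ∨ Gb c ≤ x) :
    (x, c) ∈ regionIV cI G Fb Gb := by
  refine ⟨⟨hc, hx⟩, fun h' => ?_⟩
  rcases h h'.2.1 with h1 | h1
  · exact absurd h'.2.2.1 h1.not_gt
  · exact absurd h'.2.2.2 h1.not_gt

/-- No exit occurs during the first t units of fuel, so the exit set from (x, c) is the exit set
from (x - t, c - t) translated by t, and the infimum commutes with translation. -/
theorem zeta_shift {x c t : ℝ} (ht : 0 ≤ t) (htc : t < c)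
    (h : ∀ u ∈ Icc 0 t, (x - u, c - u) ∈ regionIV cI G Fb Gb) :
    zeta cI G Fb Gb x c = zeta cI G Fb Gb (x - t) (c - t) + t := by
  unfold zeta
  set S := {u | u ∈ Ioc 0 (c - t) ∧ (x - t - u, c - t - u) ∉ regionIV cI G Fb Gb} with hS
  have hne : S.Nonempty := by
    refine ⟨c - t, ⟨by linarith, le_rfl⟩, fun h' => ?_⟩
    have := h'.1.1
    simp at this
  have hbd : BddBelow S := ⟨0, fun u hu => hu.1.1.le⟩
  have himg : {u | u ∈ Ioc 0 c ∧ (x - u, c - u) ∉ regionIV cI G Fb Gb} =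
      (OrderIso.addRight t) '' S := by
    ext u
    simp only [mem_image, OrderIso.addRight_apply, mem_ofPred_eq]
    constructor
    · rintro ⟨hu, hn⟩
      refine ⟨u - t, ⟨⟨?_, by linarith [hu.2]⟩, ?_⟩, by ring⟩
      · by_contra! hle
        exact hn (h u ⟨hu.1.le, by linarith⟩)
      · rw [show x - t - (u - t) = x - u by ring, show c - t - (u - t) = c - u by ring]
        exact hn
    · rintro ⟨v, ⟨hv, hn⟩, rfl⟩
      refine ⟨⟨by linarith [hv.1], by linarith [hv.2]⟩, ?_⟩
      rw [show x - (v + t) = x - t - v by ring, show c - (v + t) = c - t - v by ring]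
      exact hn
  rw [himg, ← OrderIso.map_csInf' _ hne hbd]
  rfl

theorem IsCandidate.continuousWithinAt (C : IsCandidate α δ lam cI cbar F G Fb Gb Q) {x c : ℝ}
    (hx : 0 ≤ x) (hc : 0 ≤ c) :
    ContinuousWithinAt (fun p : ℝ × ℝ => Q p.1 p.2) (Ici 0 ×ˢ Ici 0) (x, c) := C.cont _ ⟨hx, hc⟩

/-- Two points of one diagonal segment in IV share their exit point, so Q - c is constant on the
segment. The lower end c₁ need not lie in IV: it is reached by continuity of Q, which covers c₁ = 0.
-/
theorem IsCandidate.diag_shift (C : IsCandidate α δ lam cI cbar F G Fb Gb Q) {y c₁ c₂ : ℝ}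
    (h0 : 0 ≤ c₁) (h12 : c₁ ≤ c₂) (hy : 0 ≤ y + c₁)
    (h : ∀ c ∈ Ioc c₁ c₂, (y + c, c) ∈ regionIV cI G Fb Gb) :
    Q (y + c₂) c₂ - c₂ = Q (y + c₁) c₁ - c₁ := by
  rcases h12.eq_or_lt with rfl | h12
  · rfl
  have step : ∀ d ∈ Ioc c₁ c₂, Q (y + c₂) c₂ - c₂ = Q (y + d) d - d := by
    intro d hd
    have hz := zeta_shift (cI := cI) (G := G) (Fb := Fb) (Gb := Gb) (x := y + c₂) (c := c₂)
      (t := c₂ - d) (by linarith [hd.2]) (by linarith [hd.1]) (fun u hu => by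
        have := h (c₂ - u) ⟨by linarith [hu.2, hd.1], by linarith [hu.1]⟩
        rwa [show y + (c₂ - u) = y + c₂ - u by ring] at this)
    rw [show y + c₂ - (c₂ - d) = y + d by ring, show c₂ - (c₂ - d) = d by ring] at hz
    have e1 := C.onIV _ _ (h c₂ ⟨h12, le_rfl⟩)
    have e2 := C.onIV _ _ (h d hd)
    rw [hz] at e1
    rw [show y + c₂ - (zeta cI G Fb Gb (y + d) d + (c₂ - d)) = y + d - zeta cI G Fb Gb (y + d) d by
      ring, show c₂ - (zeta cI G Fb Gb (y + d) d + (c₂ - d)) = d - zeta cI G Fb Gb (y + d) d by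
      ring] at e1
    linarith
  have hcont : Tendsto (fun d => Q (y + d) d - d) (𝓝[>] c₁) (𝓝 (Q (y + c₁) c₁ - c₁)) := by
    refine Tendsto.sub ?_ (tendsto_id.mono_left nhdsWithin_le_nhds)
    have hm : Tendsto (fun d : ℝ => (y + d, d)) (𝓝[>] c₁) (𝓝[Ici 0 ×ˢ Ici 0] (y + c₁, c₁)) := by
      refine tendsto_nhdsWithin_iff.2 ⟨?_, ?_⟩
      · exact (Continuous.tendsto (by fun_prop) c₁).mono_left nhdsWithin_le_nhds
      · filter_upwards [self_mem_nhdsWithin] with d hd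
        have hd' : c₁ < d := hd
        exact ⟨by simp only [mem_Ici]; linarith, by simp only [mem_Ici]; linarith⟩
    exact (C.continuousWithinAt hy h0).tendsto.comp hm
  refine tendsto_nhds_unique (tendsto_const_nhds.congr' ?_) hcont
  filter_upwards [Ioo_mem_nhdsGT h12] with d hd using step d ⟨hd.1, hd.2.le⟩

/-- The profile of `Q` on the level `C`, as a function of the diagonal. -/
def profile (Q : ℝ → ℝ → ℝ) (C y : ℝ) : ℝ := Q (y + C) C - C

theorem IsCandidate.continuousAt_profile (C : IsCandidate α δ lam cI cbar F G Fb Gb Q) {C₀ y : ℝ}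
    (h0 : 0 ≤ C₀) (hy : 0 < y + C₀) : ContinuousAt (profile Q C₀) y := by
  unfold profile
  refine ContinuousAt.sub ?_ continuousAt_const
  have hm : Tendsto (fun y : ℝ => (y + C₀, C₀)) (𝓝 y) (𝓝[Ici 0 ×ˢ Ici 0] (y + C₀, C₀)) := by
    refine tendsto_nhdsWithin_iff.2 ⟨Continuous.tendsto (by fun_prop) y, ?_⟩
    filter_upwards [lt_mem_nhds (show -C₀ < y by linarith)] with d hd
    exact ⟨by simp only [mem_Ici]; linarith, h0⟩
  exact (C.continuousWithinAt hy.le h0).tendsto.comp hm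

/-- The standing assumptions. -/
structure Model (α δ lam cI cbar g0 : ℝ) (F G Fb Gb : ℝ → ℝ) (Q : ℝ → ℝ → ℝ) : Prop where
  reg : Regime α δ lam
  regime : cI = 0 → α / (2 * lam) ≤ f0 α δ lam
  bd : AdmissibleBoundaries α δ lam cI cbar g0 F G Fb Gb
  cand : IsCandidate α δ lam cI cbar F G Fb Gb Q

namespace Model

variable (M : Model α δ lam cI cbar g0 F G Fb Gb Q)

include M

/-- Going down the diagonal, G(c) - c decreases and F̄(c) - c increases, so the point remains
between G and F̄ until the fuel is gone. It arrives at x - c < f₀, where the value is the stopping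
payoff. -/
theorem lower_eq {x c : ℝ} (hc : c ∈ Ioc 0 cI) (hG : G c ≤ x) (hF : x ≤ Fb c) :
    Q x c = δ * (x - c) ^ 2 + c := by
  have hcb : c ≤ cbar := hc.2.trans M.bd.cI_lt_cbar.le
  have hd := M.bd.half_lt_diag ⟨hc.1, hcb⟩
  have hδ : 0 < 1 / (2 * δ) := by have := M.reg.δ_pos; positivity
  have hy : 0 ≤ x - c := by linarith
  have := M.cand.diag_shift (y := x - c) le_rfl hc.1.le (by linarith) (fun c' hc' => by
    refine mem_regionIV hc'.1 ?_ fun h => Or.inl ?_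
    · have := (M.bd.diag_strictMonoOn.monotoneOn ⟨hc'.1, hc'.2.trans hcb⟩ ⟨hc.1, hcb⟩ hc'.2)
      linarith
    · have := (M.bd.Fb_diag_strictAntiOn.antitoneOn ⟨hc'.1, h.le⟩ hc hc'.2)
      linarith)
  rw [sub_add_cancel, add_zero, M.cand.noFuel _ hy,
    V0_of_le (by linarith [M.bd.Fb_diag_lt hc])] at this
  linarith

/-- Either condition in `h` keeps the diagonal above G down to level cI; above that level region III
is absent. -/
theorem upper_eq {x c : ℝ} (h0 : 0 < c) (hc : cI ≤ c) (hG : G c ≤ x)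
    (h : c ≤ cbar ∨ G cbar - cbar ≤ x - c) : Q x c = profile Q cI (x - c) + c := by
  have hδ : 0 < 1 / (2 * δ) := by have := M.reg.δ_pos; positivity
  have hd : ∀ c' ∈ Ioc cI c, G c' - c' ≤ x - c := by
    intro c' hc'
    have hp : 0 < c' := M.bd.cI_nonneg.trans_lt hc'.1
    rcases h with h | h
    · have := (M.bd.diag_strictMonoOn.monotoneOn ⟨hp, hc'.2.trans h⟩ ⟨h0, h⟩ hc'.2)
      linarith
    · exact (M.bd.diag_le hp).trans h
  have hy : 0 ≤ x - c := by
    rcases h with h | h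
    · linarith [M.bd.half_lt_diag ⟨h0, h⟩]
    · linarith [M.bd.half_lt_diag ⟨M.bd.cbar_pos, le_rfl⟩]
  have := M.cand.diag_shift (y := x - c) M.bd.cI_nonneg hc (by linarith [M.bd.cI_nonneg]) (fun c' hc' =>
    mem_regionIV (M.bd.cI_nonneg.trans_lt hc'.1) (by linarith [hd c' hc'])
      fun h => absurd hc'.1 (not_lt.2 h.le))
  rw [sub_add_cancel] at this
  unfold profile
  linarith

/-- Here the profile level cI lies above c: Ḡ(c) - c decreases, so the diagonal followed upwards
stays above Ḡ. -/
theorem upper_eq_of_lt {x c : ℝ} (hc : c ∈ Ioo 0 cI) (hG : Gb c ≤ x) :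
    Q x c = profile Q cI (x - c) + c := by
  have hx : 0 < x := (M.bd.Gb_pos c ⟨hc.1, hc.2.le⟩).trans_le hG
  have := M.cand.diag_shift (y := x - c) hc.1.le hc.2.le (by linarith) (fun c' hc' => by
    have hm : c' ∈ Ioc 0 cI := ⟨hc.1.trans hc'.1, hc'.2⟩
    have hd := (M.bd.Gb_diag_strictAntiOn.antitoneOn ⟨hc.1, hc.2.le⟩ hm hc'.1.le)
    exact mem_regionIV hm.1 (by linarith [M.bd.G_lt_Gb hm]) fun h => Or.inr (by linarith))
  rw [sub_add_cancel] at this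
  unfold profile
  linarith

theorem top_eq {x c C₀ : ℝ} (hc : cbar ≤ c) (hC : c ≤ C₀) (hG : G c ≤ x) :
    Q x c = profile Q C₀ (x - c) + c := by
  have h0 : 0 < c := M.bd.cbar_pos.trans_le hc
  have hx : 0 < x := (M.bd.G_pos c h0).trans_le hG
  have := M.cand.diag_shift (y := x - c) h0.le hC (by linarith) (fun c' hc' => by
    have hd := (M.bd.diag_strictAntiOn.antitoneOn hc (hc.trans hc'.1.le) hc'.1.le)
    exact mem_regionIV (h0.trans hc'.1) (by linarith) fun h =>
      absurd (M.bd.cI_lt_cbar.trans_le (hc.trans hc'.1.le)) (not_lt.2 h.le))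
  rw [sub_add_cancel] at this
  unfold profile
  linarith

/-- For cI > 0 the profile at level cI has three pieces: the square up to α/(2λ) - cI, the trace of
Ḡ up to g₀, and the value without fuel beyond g₀. For cI = 0 it is the value without fuel. -/
theorem profile_outer (hI : 0 < cI) {y : ℝ} (hy : g0 ≤ y) : profile Q cI y = V0 α δ lam y := by
  have hp : 0 < g0 := (M.bd.Gb_pos cI ⟨hI, le_rfl⟩).trans (M.bd.Gb_lt_g0 ⟨hI, le_rfl⟩)
  have := M.cand.diag_shift (y := y) le_rfl hI.le (by linarith) (fun c' hc' => by
    have h1 := M.bd.Gb_lt_g0 hc'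
    exact mem_regionIV hc'.1 (by linarith [M.bd.G_lt_Gb hc', hc'.1])
      fun h => Or.inr (by linarith [hc'.1]))
  rw [add_zero, M.cand.noFuel _ (by linarith)] at this
  unfold profile
  linarith

theorem profile_inner (hI : 0 < cI) {y : ℝ} (h1 : G cI - cI ≤ y) (h2 : y ≤ α / (2 * lam) - cI) :
    profile Q cI y = δ * y ^ 2 := by
  have := M.lower_eq (x := y + cI) ⟨hI, le_rfl⟩ (by linarith)
    (by rw [M.bd.Fb_end hI]; linarith)
  unfold profile
  rw [this]; ring_nf

theorem profile_zero (hI : cI = 0) {y : ℝ} (hy : 0 ≤ y) : profile Q cI y = V0 α δ lam y := by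
  subst hI
  simp [profile, M.cand.noFuel y hy]

theorem profile_top_eq {C₀ y : ℝ} (hC : cbar ≤ C₀) (hy : G cbar - cbar ≤ y) :
    profile Q C₀ y = profile Q cI y := by
  have h0 : 0 < C₀ := M.bd.cbar_pos.trans_le hC
  have := M.upper_eq (x := y + C₀) h0 (M.bd.cI_lt_cbar.le.trans hC)
    (by linarith [M.bd.diag_le h0]) (Or.inr (by linarith))
  unfold profile at *
  rw [this]; ring_nf

end Model

end

end

/-! ### Explicit form of Q on the regions, and first consequences of the fit conditions -/

section

/-- No regularity of φ is assumed: it is differentiable because Q(·, c) is, and its derivative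
cancels in the sum of the two partials. -/
theorem diag_sum_eq_one {Q : ℝ → ℝ → ℝ} {φ : ℝ → ℝ} {x c qx qc : ℝ}
    (h : ∀ᶠ p : ℝ × ℝ in 𝓝 (x, c), Q p.1 p.2 = φ (p.1 - p.2) + p.2)
    (hx : HasDerivAt (fun z => Q z c) qx x) (hc : HasDerivAt (fun d => Q x d) qc c) :
    qx + qc = 1 := by
  have h1 : ∀ᶠ z in 𝓝 x, Q z c = φ (z - c) + c :=
    (Continuous.tendsto (by fun_prop : Continuous fun z : ℝ => (z, c)) x).eventually h
  have h2 : ∀ᶠ d in 𝓝 c, Q x d = φ (x - d) + d :=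
    (Continuous.tendsto (by fun_prop : Continuous fun d : ℝ => (x, d)) c).eventually h
  have hφ : HasDerivAt φ qx (x - c) := by
    have hx' : HasDerivAt (fun z => Q z c) qx (x - c + c) := by rwa [sub_add_cancel]
    have k := (hx'.comp_add_const (x - c) c).sub_const c
    refine k.congr_of_eventuallyEq ?_
    have ht : Tendsto (fun y => y + c) (𝓝 (x - c)) (𝓝 x) := by
      have := (Continuous.tendsto (by fun_prop : Continuous fun y : ℝ => y + c) (x - c))
      rwa [sub_add_cancel] at this
    filter_upwards [ht.eventually h1] with y hy
    simp only [hy]; ring_nf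
  have k2 : HasDerivAt (fun d => φ (x - d) + d) (-qx + 1) c :=
    (hφ.comp_const_sub x c).add (hasDerivAt_id c)
  have := hc.unique (k2.congr_of_eventuallyEq h2)
  linarith

theorem hasDerivAt_sq_shift {δ : ℝ} (c x : ℝ) :
    HasDerivAt (fun y => δ * (y - c) ^ 2 + c) (2 * δ * (x - c)) x := by
  refine (((((hasDerivAt_id x).sub_const c).pow 2).const_mul δ).add_const c).congr_deriv ?_
  simp; ring

namespace Model

variable {α δ lam cI cbar g0 : ℝ} {F G Fb Gb : ℝ → ℝ} {Q : ℝ → ℝ → ℝ}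
  (M : Model α δ lam cI cbar g0 F G Fb Gb Q)

include M

theorem continuousAt {x c : ℝ} (hx : 0 < x) (hc : 0 < c) :
    ContinuousAt (fun p : ℝ × ℝ => Q p.1 p.2) (x, c) :=
  (M.cand.continuousWithinAt hx.le hc.le).continuousAt
    (prod_mem_nhds (Ici_mem_nhds hx) (Ici_mem_nhds hc))

theorem continuousAt_slice {x c : ℝ} (hx : 0 < x) (hc : 0 < c) :
    ContinuousAt (fun y => Q y c) x :=
  ContinuousAt.comp (f := fun y : ℝ => (y, c)) (M.continuousAt hx hc) (by fun_prop)

/-- Smooth fit at F(c) prescribes value and slope, hence both unknown coefficients; continuity of Q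
adds the endpoint G(c). -/
theorem eq_on_II {x c : ℝ} (hc : 0 < c) (hF : F c ≤ x) (hG : x ≤ G c) :
    Q x c = sol α δ lam 0 (F c) x := by
  obtain ⟨A, B, hAB⟩ := M.cand.onII
  have hFp := M.bd.F_pos c hc.le
  have hFG := M.bd.F_lt_G hc
  have hsf : DifferentiableAt ℝ (fun y => Q y c) (F c) :=
    (M.cand.sf1_F c hc).differentiableAt (by norm_num)
  have hw : Differentiable ℝ (waitSol α lam (A c) (B c)) := by unfold waitSol; fun_prop
  obtain ⟨v1, v2, d1, d2⟩ := fit_of_differentiableAt (g₁ := fun y => δ * y ^ 2)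
    (g₂ := waitSol α lam (A c) (B c)) hsf
    (by filter_upwards [Ioo_mem_nhdsLT hFp] with y hy using M.cand.onI y c ⟨hc, hy.1.le, hy.2.le⟩)
    (by filter_upwards [Ioo_mem_nhdsGT hFG] with y hy using hAB y c ⟨hc, hy.1, hy.2⟩)
    (hasDerivAt_sq_mul (F c)) (hw (F c)).hasDerivAt
  have hsol := waitSol_eq_sol M.reg (t := 0) (z := F c) (a := A c) (b := B c)
    (by rw [v2, ← v1]; ring)
    (by have := (hw (F c)).hasDerivAt; rw [d2, ← d1] at this; simpa using this)
  have hin : ∀ y ∈ Ioo (F c) (G c), Q y c = sol α δ lam 0 (F c) y := fun y hy => by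
    rw [hAB y c ⟨hc, hy.1, hy.2⟩, hsol]
  rcases hF.eq_or_lt with rfl | hF
  · rw [M.cand.onI _ c ⟨hc, hFp.le, le_rfl⟩]; simp
  rcases hG.eq_or_lt with rfl | hG
  · have t1 : Tendsto (fun y => Q y c) (𝓝[<] (G c)) (𝓝 (Q (G c) c)) :=
      (M.continuousAt_slice (hFp.trans hF) hc).continuousWithinAt
    have t2 : Tendsto (sol α δ lam 0 (F c)) (𝓝[<] (G c)) (𝓝 (sol α δ lam 0 (F c) (G c))) :=
      (hasDerivAt_sol M.reg 0 (F c) (G c)).continuousAt.continuousWithinAt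
    refine tendsto_nhds_unique t1 (t2.congr' ?_)
    filter_upwards [Ioo_mem_nhdsLT hF] with y hy using (hin y hy).symm
  · exact hin x ⟨hF, hG⟩

theorem eq_on_III {x c : ℝ} (hc : c ∈ Ioo 0 cI) (hF : Fb c ≤ x) (hG : x ≤ Gb c) :
    Q x c = sol α δ lam c (Fb c) x := by
  obtain ⟨A, B, hAB⟩ := M.cand.onIII
  have hc' : c ∈ Ioc 0 cI := ⟨hc.1, hc.2.le⟩
  have hGp := M.bd.G_pos c hc.1
  have hGF := M.bd.G_lt_Fb c hc'
  have hFG := M.bd.Fb_lt_Gb hc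
  have hsf : DifferentiableAt ℝ (fun y => Q y c) (Fb c) :=
    (M.cand.sf1_Fb c hc).differentiableAt (by norm_num)
  have hw : Differentiable ℝ (waitSol α lam (A c) (B c)) := by unfold waitSol; fun_prop
  obtain ⟨v1, v2, d1, d2⟩ := fit_of_differentiableAt (g₁ := fun y => δ * (y - c) ^ 2 + c)
    (g₂ := waitSol α lam (A c) (B c)) hsf
    (by filter_upwards [Ioo_mem_nhdsLT hGF] with y hy using M.lower_eq hc' hy.1.le hy.2.le)
    (by filter_upwards [Ioo_mem_nhdsGT hFG] with y hy using hAB y c ⟨hc.1, hc.2, hy.1, hy.2⟩)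
    (hasDerivAt_sq_shift c (Fb c)) (hw (Fb c)).hasDerivAt
  have hsol := waitSol_eq_sol M.reg (t := c) (z := Fb c) (a := A c) (b := B c)
    (by rw [v2, ← v1])
    (by have := (hw (Fb c)).hasDerivAt; rwa [d2, ← d1] at this)
  have hin : ∀ y ∈ Ioo (Fb c) (Gb c), Q y c = sol α δ lam c (Fb c) y := fun y hy => by
    rw [hAB y c ⟨hc.1, hc.2, hy.1, hy.2⟩, hsol]
  rcases hF.eq_or_lt with rfl | hF
  · rw [M.lower_eq hc' hGF.le le_rfl, sol_self]
  rcases hG.eq_or_lt with rfl | hG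
  · have t1 : Tendsto (fun y => Q y c) (𝓝[<] (Gb c)) (𝓝 (Q (Gb c) c)) :=
      (M.continuousAt_slice ((hGp.trans hGF).trans hF) hc.1).continuousWithinAt
    have t2 : Tendsto (sol α δ lam c (Fb c)) (𝓝[<] (Gb c)) (𝓝 (sol α δ lam c (Fb c) (Gb c))) :=
      (hasDerivAt_sol M.reg c (Fb c) (Gb c)).continuousAt.continuousWithinAt
    refine tendsto_nhds_unique t1 (t2.congr' ?_)
    filter_upwards [Ioo_mem_nhdsLT hF] with y hy using (hin y hy).symm
  · exact hin x ⟨hF, hG⟩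

/-! ### Local representation of `Q` on region IV -/

theorem rep_lower {x c : ℝ} (hc : c ∈ Ioo 0 cI) (hG : G c < x) (hF : x < Fb c) :
    ∀ᶠ p : ℝ × ℝ in 𝓝 (x, c), Q p.1 p.2 = δ * (p.1 - p.2) ^ 2 + p.2 := by
  have e1 : ∀ᶠ p : ℝ × ℝ in 𝓝 (x, c), p.2 ∈ Ioo 0 cI :=
    (continuous_snd.tendsto (x, c)).eventually (isOpen_Ioo.mem_nhds hc)
  have e2 : ∀ᶠ p : ℝ × ℝ in 𝓝 (x, c), G p.2 < p.1 :=
    ((M.bd.G_continuousAt hc.1).comp' (f := Prod.snd) continuous_snd.continuousAt).eventually_lt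
      continuous_fst.continuousAt hG
  have e3 : ∀ᶠ p : ℝ × ℝ in 𝓝 (x, c), p.1 < Fb p.2 :=
    continuous_fst.continuousAt.eventually_lt
    ((M.bd.Fb_hasDerivAt hc).continuousAt.comp' (f := Prod.snd) continuous_snd.continuousAt) hF
  filter_upwards [e1, e2, e3] with p k1 k2 k3 using M.lower_eq ⟨k1.1, k1.2.le⟩ k2.le k3.le

theorem rep_lower_end {x : ℝ} (hI : 0 < cI) (hG : G cI < x) (hx : x < α / (2 * lam)) :
    ∀ᶠ p : ℝ × ℝ in 𝓝 (x, cI), Q p.1 p.2 = δ * (p.1 - p.2) ^ 2 + p.2 := by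
  have e1 : ∀ᶠ p : ℝ × ℝ in 𝓝 (x, cI), p.2 ∈ Ioo 0 cbar :=
    (continuous_snd.tendsto (x, cI)).eventually (isOpen_Ioo.mem_nhds ⟨hI, M.bd.cI_lt_cbar⟩)
  have e2 : ∀ᶠ p : ℝ × ℝ in 𝓝 (x, cI), G p.2 < p.1 :=
    ((M.bd.G_continuousAt hI).comp' (f := Prod.snd) continuous_snd.continuousAt).eventually_lt
      continuous_fst.continuousAt hG
  obtain ⟨m, hm1, hm2⟩ := exists_between hx
  have e3 : ∀ᶠ p : ℝ × ℝ in 𝓝 (x, cI), p.1 < m :=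
    (continuous_fst.tendsto (x, cI)).eventually (gt_mem_nhds hm1)
  have e4 : ∀ᶠ p : ℝ × ℝ in 𝓝 (x, cI), p.2 ≤ cI → m < Fb p.2 := by
    have h1 : ∀ᶠ c in 𝓝[Ioc 0 cI] cI, m < Fb c :=
      (M.bd.Fb_cont cI ⟨hI, le_rfl⟩).tendsto.eventually
        (lt_mem_nhds (by rwa [M.bd.Fb_end hI]))
    filter_upwards [(continuous_snd.tendsto (x, cI)).eventually (eventually_nhdsWithin_iff.1 h1),
      e1] with p k1 k2 k3 using k1 ⟨k2.1, k3⟩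
  have e5 : ∀ᶠ p : ℝ × ℝ in 𝓝 (x, cI), p.1 - p.2 < α / (2 * lam) - cI ∧ G cI - cI < p.1 - p.2 :=
    (Continuous.tendsto (by fun_prop : Continuous fun p : ℝ × ℝ => p.1 - p.2) (x, cI)).eventually
      ((gt_mem_nhds (by simpa using hx)).and (lt_mem_nhds (by simpa using hG)))
  filter_upwards [e1, e2, e3, e4, e5] with p k1 k2 k3 k4 k5
  rcases le_total p.2 cI with h | h
  · exact M.lower_eq ⟨k1.1, h⟩ k2.le (k3.trans (k4 h)).le
  · rw [M.upper_eq k1.1 h k2.le (Or.inl k1.2.le), M.profile_inner hI k5.2.le k5.1.le]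

theorem rep_upper_lt {x c : ℝ} (hc : c ∈ Ioo 0 cI) (hG : Gb c < x) :
    ∀ᶠ p : ℝ × ℝ in 𝓝 (x, c), Q p.1 p.2 = profile Q cI (p.1 - p.2) + p.2 := by
  have e1 : ∀ᶠ p : ℝ × ℝ in 𝓝 (x, c), p.2 ∈ Ioo 0 cI :=
    (continuous_snd.tendsto (x, c)).eventually (isOpen_Ioo.mem_nhds hc)
  have e2 : ∀ᶠ p : ℝ × ℝ in 𝓝 (x, c), Gb p.2 < p.1 :=
    ((M.bd.Gb_hasDerivAt hc).continuousAt.comp' (f := Prod.snd)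
      continuous_snd.continuousAt).eventually_lt continuous_fst.continuousAt hG
  filter_upwards [e1, e2] with p k1 k2 using M.upper_eq_of_lt k1 k2.le

theorem rep_upper_end {x : ℝ} (hI : 0 < cI) (hx : α / (2 * lam) < x) :
    ∀ᶠ p : ℝ × ℝ in 𝓝 (x, cI), Q p.1 p.2 = profile Q cI (p.1 - p.2) + p.2 := by
  have hGI := M.bd.G_lt_Gb ⟨hI, le_rfl⟩
  rw [M.bd.Gb_end hI] at hGI
  have e1 : ∀ᶠ p : ℝ × ℝ in 𝓝 (x, cI), p.2 ∈ Ioo 0 cbar :=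
    (continuous_snd.tendsto (x, cI)).eventually (isOpen_Ioo.mem_nhds ⟨hI, M.bd.cI_lt_cbar⟩)
  have e2 : ∀ᶠ p : ℝ × ℝ in 𝓝 (x, cI), G p.2 < p.1 :=
    ((M.bd.G_continuousAt hI).comp' (f := Prod.snd) continuous_snd.continuousAt).eventually_lt
      continuous_fst.continuousAt (hGI.trans hx)
  obtain ⟨m, hm1, hm2⟩ := exists_between hx
  have e3 : ∀ᶠ p : ℝ × ℝ in 𝓝 (x, cI), m < p.1 :=
    (continuous_fst.tendsto (x, cI)).eventually (lt_mem_nhds hm2)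
  have e4 : ∀ᶠ p : ℝ × ℝ in 𝓝 (x, cI), p.2 ≤ cI → Gb p.2 < m := by
    have h1 : ∀ᶠ c in 𝓝[Ioc 0 cI] cI, Gb c < m :=
      (M.bd.Gb_cont cI ⟨hI, le_rfl⟩).tendsto.eventually
        (gt_mem_nhds (by rwa [M.bd.Gb_end hI]))
    filter_upwards [(continuous_snd.tendsto (x, cI)).eventually (eventually_nhdsWithin_iff.1 h1),
      e1] with p k1 k2 k3 using k1 ⟨k2.1, k3⟩
  filter_upwards [e1, e2, e3, e4] with p k1 k2 k3 k4
  rcases lt_or_ge p.2 cI with h | h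
  · exact M.upper_eq_of_lt ⟨k1.1, h⟩ ((k4 h.le).trans k3).le
  · exact M.upper_eq k1.1 h k2.le (Or.inl k1.2.le)

theorem rep_mid {x c : ℝ} (hc : c ∈ Ioc cI cbar) (hG : G c < x) :
    ∀ᶠ p : ℝ × ℝ in 𝓝 (x, c), Q p.1 p.2 = profile Q cI (p.1 - p.2) + p.2 := by
  have h0 : 0 < c := M.bd.cI_nonneg.trans_lt hc.1
  have e1 : ∀ᶠ p : ℝ × ℝ in 𝓝 (x, c), cI < p.2 :=
    (continuous_snd.tendsto (x, c)).eventually (lt_mem_nhds hc.1)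
  have e2 : ∀ᶠ p : ℝ × ℝ in 𝓝 (x, c), G p.2 < p.1 :=
    ((M.bd.G_continuousAt h0).comp' (f := Prod.snd) continuous_snd.continuousAt).eventually_lt
      continuous_fst.continuousAt hG
  have e3 : ∀ᶠ p : ℝ × ℝ in 𝓝 (x, c), p.2 ≤ cbar ∨ G cbar - cbar ≤ p.1 - p.2 := by
    rcases hc.2.eq_or_lt with rfl | h
    · have : ∀ᶠ p : ℝ × ℝ in 𝓝 (x, c), G c - c < p.1 - p.2 :=
        (Continuous.tendsto (by fun_prop : Continuous fun p : ℝ × ℝ => p.1 - p.2)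
          (x, c)).eventually (lt_mem_nhds (by simpa using hG))
      exact this.mono fun p hp => Or.inr hp.le
    · exact ((continuous_snd.tendsto (x, c)).eventually (gt_mem_nhds h)).mono
        fun p hp => Or.inl hp.le
  filter_upwards [e1, e2, e3] with p k1 k2 k3
  exact M.upper_eq (M.bd.cI_nonneg.trans_lt k1) k1.le k2.le k3

theorem rep_top {x c C₀ : ℝ} (hc : cbar < c) (hC : c < C₀) (hG : G c < x) :
    ∀ᶠ p : ℝ × ℝ in 𝓝 (x, c), Q p.1 p.2 = profile Q C₀ (p.1 - p.2) + p.2 := by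
  have h0 : 0 < c := M.bd.cbar_pos.trans hc
  have e1 : ∀ᶠ p : ℝ × ℝ in 𝓝 (x, c), p.2 ∈ Ioo cbar C₀ :=
    (continuous_snd.tendsto (x, c)).eventually (isOpen_Ioo.mem_nhds ⟨hc, hC⟩)
  have e2 : ∀ᶠ p : ℝ × ℝ in 𝓝 (x, c), G p.2 < p.1 :=
    ((M.bd.G_continuousAt h0).comp' (f := Prod.snd) continuous_snd.continuousAt).eventually_lt
      continuous_fst.continuousAt hG
  filter_upwards [e1, e2] with p k1 k2 using M.top_eq k1.1.le k1.2.le k2.le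

/-! ### The smooth fit conditions on the diagonal derivative -/

/-- Beyond Ḡ one has D = 1 identically. A differentiable extension of D across Ḡ therefore has value
1 and slope 0 there, and so does its expression from inside III. -/
theorem diag_fit_Gb {c : ℝ} (hc : c ∈ Ioo 0 cI) :
    solX α δ lam c (Fb c) (Gb c) + solC α δ lam c (Fb c) 1 (deriv Fb c) (Gb c) = 1 ∧
    solXX α δ lam c (Fb c) (Gb c) + solXC α δ lam c (Fb c) 1 (deriv Fb c) (Gb c) = 0 := by
  obtain ⟨u, hu, hev⟩ := M.cand.sf2_Gb c hc
  have hFG := M.bd.Fb_lt_Gb hc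
  have hleft : u =ᶠ[𝓝[<] (Gb c)] fun x =>
      solX α δ lam c (Fb c) x + solC α δ lam c (Fb c) 1 (deriv Fb c) x := by
    filter_upwards [nhdsLT_le_nhdsNE _ hev, Ioo_mem_nhdsLT hFG] with y ⟨qx, qc, h1, h2, h3⟩ hy
    have k1 : HasDerivAt (fun z => Q z c) (solX α δ lam c (Fb c) y) y := by
      refine (hasDerivAt_sol M.reg c (Fb c) y).congr_of_eventuallyEq ?_
      filter_upwards [isOpen_Ioo.mem_nhds hy] with z hz using M.eq_on_III hc hz.1.le hz.2.le
    have k2 : HasDerivAt (fun d => Q y d) (solC α δ lam c (Fb c) 1 (deriv Fb c) y) c := by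
      have := hasDerivAt_sol_curve M.reg (hasDerivAt_id c) (M.bd.Fb_hasDerivAt hc)
        (hasDerivAt_const c y)
      rw [mul_zero, add_zero] at this
      refine this.congr_of_eventuallyEq ?_
      filter_upwards [isOpen_Ioo.mem_nhds hc,
        (M.bd.Fb_hasDerivAt hc).continuousAt.eventually_lt continuousAt_const hy.1,
        continuousAt_const.eventually_lt (M.bd.Gb_hasDerivAt hc).continuousAt hy.2] with d d1 d2 d3
      exact M.eq_on_III d1 d2.le d3.le
    rw [h3, h1.unique k1, h2.unique k2]
  have hright : u =ᶠ[𝓝[>] (Gb c)] fun _ => (1 : ℝ) := by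
    filter_upwards [nhdsGT_le_nhdsNE _ hev, self_mem_nhdsWithin] with y ⟨qx, qc, h1, h2, h3⟩ hy
    rw [h3]
    exact diag_sum_eq_one (M.rep_upper_lt hc hy) h1 h2
  obtain ⟨v1, v2, d1, d2⟩ := fit_of_differentiableAt (hu.differentiableAt (by norm_num)) hleft
    hright ((hasDerivAt_solX M.reg c (Fb c) (Gb c)).add (hasDerivAt_solC M.reg c (Fb c) 1 _ (Gb c)))
    (hasDerivAt_const _ _)
  exact ⟨by rw [v1, ← v2], by rw [d1, ← d2]⟩

theorem diag_fit_G {c F' : ℝ} (hc : cbar < c) (hF : HasDerivAt F F' c) :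
    solX α δ lam 0 (F c) (G c) + solC α δ lam 0 (F c) 0 F' (G c) = 1 ∧
    solXX α δ lam 0 (F c) (G c) + solXC α δ lam 0 (F c) 0 F' (G c) = 0 := by
  obtain ⟨u, hu, hev⟩ := M.cand.sf2_G c hc
  have h0 := M.bd.cbar_pos.trans hc
  have hFG := M.bd.F_lt_G h0
  have hleft : u =ᶠ[𝓝[<] (G c)] fun x =>
      solX α δ lam 0 (F c) x + solC α δ lam 0 (F c) 0 F' x := by
    filter_upwards [nhdsLT_le_nhdsNE _ hev, Ioo_mem_nhdsLT hFG] with y ⟨qx, qc, h1, h2, h3⟩ hy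
    have k1 : HasDerivAt (fun z => Q z c) (solX α δ lam 0 (F c) y) y := by
      refine (hasDerivAt_sol M.reg 0 (F c) y).congr_of_eventuallyEq ?_
      filter_upwards [isOpen_Ioo.mem_nhds hy] with z hz using M.eq_on_II h0 hz.1.le hz.2.le
    have k2 : HasDerivAt (fun d => Q y d) (solC α δ lam 0 (F c) 0 F' y) c := by
      have := hasDerivAt_sol_curve M.reg (hasDerivAt_const c 0) hF (hasDerivAt_const c y)
      rw [mul_zero, add_zero] at this
      refine this.congr_of_eventuallyEq ?_
      filter_upwards [lt_mem_nhds h0,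
        hF.continuousAt.eventually_lt continuousAt_const hy.1,
        continuousAt_const.eventually_lt (M.bd.G_continuousAt h0) hy.2] with d d1 d2 d3
      exact M.eq_on_II d1 d2.le d3.le
    rw [h3, h1.unique k1, h2.unique k2]
  have hright : u =ᶠ[𝓝[>] (G c)] fun _ => (1 : ℝ) := by
    filter_upwards [nhdsGT_le_nhdsNE _ hev, self_mem_nhdsWithin] with y ⟨qx, qc, h1, h2, h3⟩ hy
    rw [h3]
    exact diag_sum_eq_one (M.rep_top hc (lt_add_one c) hy) h1 h2
  obtain ⟨v1, v2, d1, d2⟩ := fit_of_differentiableAt (hu.differentiableAt (by norm_num)) hleft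
    hright ((hasDerivAt_solX M.reg 0 (F c) (G c)).add (hasDerivAt_solC M.reg 0 (F c) 0 F' (G c)))
    (hasDerivAt_const _ _)
  exact ⟨by rw [v1, ← v2], by rw [d1, ← d2]⟩

end Model

end

/-! ### Transport of second-order data along diagonals; regularity of the profiles -/

section

theorem contDiffAt_two_of_deriv {f f' f'' : ℝ → ℝ} {x : ℝ}
    (h : ∀ᶠ y in 𝓝 x, HasDerivAt f (f' y) y) (h' : ∀ᶠ y in 𝓝 x, HasDerivAt f' (f'' y) y)
    (hc : ∀ᶠ y in 𝓝 x, ContinuousAt f'' y) : ContDiffAt ℝ 2 f x := by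
  obtain ⟨u, hu, huo, hxu⟩ := eventually_nhds_iff.1 (h.and (h'.and hc))
  have : ContDiffOn ℝ (1 + 1) f u := by
    rw [contDiffOn_succ_iff_deriv_of_isOpen huo]
    refine ⟨fun y hy => (hu y hy).1.differentiableAt.differentiableWithinAt, by simp, ?_⟩
    have h1 : ContDiffOn ℝ 1 f' u := fun y hy =>
      (contDiffAt_one_of_deriv (f' := f'')
        (by filter_upwards [huo.mem_nhds hy] with w hw using (hu w hw).2.1)
        (by filter_upwards [huo.mem_nhds hy] with w hw using (hu w hw).2.2)).contDiffWithinAt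
    exact h1.congr fun y hy => (hu y hy).1.deriv
  exact (this.contDiffAt (huo.mem_nhds hxu)).of_le (by norm_num)

/-- The profile `φ` is twice continuously differentiable at `y`, and its 2-jet is inherited from a
fitted solution at the point `(y + c₂, c₂)` of the diagonal. -/
structure Inherits (α δ lam : ℝ) (φ : ℝ → ℝ) (y c₂ t z : ℝ) : Prop where
  contDiffAt : ContDiffAt ℝ 2 φ y
  val : φ y = sol α δ lam t z (y + c₂) - c₂
  slope : deriv φ y = solX α δ lam t z (y + c₂)
  curv : deriv (deriv φ) y = solXX α δ lam t z (y + c₂)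

section

variable {α δ lam : ℝ}

theorem Inherits.of_eventuallyEq (H : Regime α δ lam) {φ : ℝ → ℝ} {y t z : ℝ}
    (h : φ =ᶠ[𝓝 y] sol α δ lam t z) : Inherits α δ lam φ y 0 t z := by
  have hd : deriv (sol α δ lam t z) = solX α δ lam t z :=
    funext fun x => (hasDerivAt_sol H t z x).deriv
  refine ⟨((contDiff_sol_right t z).contDiffAt).congr_of_eventuallyEq h, ?_, ?_, ?_⟩
  · rw [h.self_of_nhds]; simp
  · rw [h.deriv_eq, hd, add_zero]
  · rw [h.deriv.deriv_eq, hd, (hasDerivAt_solX H t z y).deriv, add_zero]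

/-- Transport of the 2-jet of a fitted solution along the diagonals, from a boundary `g` on which
the diagonal derivative is `1` with vanishing slope. -/
theorem Inherits.of_boundary (H : Regime α δ lam) {φ g t z t' z' : ℝ → ℝ} {c : ℝ}
    (hg : ContDiffAt ℝ 1 g c) (hg1 : deriv g c < 1)
    (ht : ∀ᶠ d in 𝓝 c, HasDerivAt t (t' d) d) (hz : ∀ᶠ d in 𝓝 c, HasDerivAt z (z' d) d)
    (hfit : ∀ᶠ d in 𝓝 c, solX α δ lam (t d) (z d) (g d) +
        solC α δ lam (t d) (z d) (t' d) (z' d) (g d) = 1 ∧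
      solXX α δ lam (t d) (z d) (g d) + solXC α δ lam (t d) (z d) (t' d) (z' d) (g d) = 0)
    (hφ : ∀ᶠ d in 𝓝 c, φ (g d - d) = sol α δ lam (t d) (z d) (g d) - d) :
    Inherits α δ lam φ (g c - c) c (t c) (z c) := by
  have hg1' : ∀ᶠ d in 𝓝 c, deriv g d < 1 :=
    (continuousAt_deriv_of_contDiffAt hg).eventually_lt continuousAt_const hg1
  have hη : ∀ᶠ d in 𝓝 c, HasStrictDerivAt (fun d => g d - d) (deriv g d - 1) d := by
    filter_upwards [hg.eventually (by norm_num)] with d hd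
    exact (hd.hasStrictDerivAt (by norm_num)).sub (hasStrictDerivAt_id d)
  have s1 : ∀ᶠ d in 𝓝 c, HasDerivAt φ (solX α δ lam (t d) (z d) (g d)) (g d - d) := by
    filter_upwards [hg1', hη, ht, hz, hfit, eventually_eventually_nhds.2 hφ,
      hg.eventually (by norm_num)] with d k1 k2 k3 k4 k5 k6 k7
    -- Along the boundary the right side has derivative `solC` + `solX` g' - 1, which equals `solX`
    -- (g' - 1) because D = 1; the factor g' - 1 is the derivative of η.
    refine hasDerivAt_of_comp (η := fun d => g d - d) k2 (sub_ne_zero.2 k1.ne) k6 ?_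
    have hgd := (k7.differentiableAt (by norm_num)).hasDerivAt
    refine ((hasDerivAt_sol_curve H k3 k4 hgd).sub (hasDerivAt_id d)).congr_deriv ?_
    linear_combination k5.1
  have s2 : ∀ᶠ d in 𝓝 c, HasDerivAt (deriv φ) (solXX α δ lam (t d) (z d) (g d)) (g d - d) := by
    filter_upwards [hg1', hη, ht, hz, hfit, eventually_eventually_nhds.2 s1,
      hg.eventually (by norm_num)] with d k1 k2 k3 k4 k5 k6 k7
    -- The same cancellation one order higher: D_x = 0 turns `solXC` + `solXX` g' into `solXX` (g' -
    -- 1).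
    refine hasDerivAt_of_comp (η := fun d => g d - d) k2 (sub_ne_zero.2 k1.ne) (k6.mono fun e he => he.deriv) ?_
    have hgd := (k7.differentiableAt (by norm_num)).hasDerivAt
    refine (hasDerivAt_solX_curve H k3 k4 hgd).congr_deriv ?_
    linear_combination k5.2
  have s3 : ∀ᶠ d in 𝓝 c, ContinuousAt (deriv (deriv φ)) (g d - d) := by
    filter_upwards [hg1', hη, ht, hz, eventually_eventually_nhds.2 s2,
      hg.eventually (by norm_num)] with d k1 k2 k3 k4 k6 k7
    refine continuousAt_of_comp (η := fun d => g d - d) k2 (sub_ne_zero.2 k1.ne)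
      (k6.mono fun e he => he.deriv) ?_
    have hgd := (k7.differentiableAt (by norm_num)).continuousAt
    exact ContinuousAt.comp (f := fun e => (t e, z e, g e))
      continuous_solXX.continuousAt (k3.continuousAt.prodMk (k4.continuousAt.prodMk hgd))
  have hne := sub_ne_zero.2 hg1.ne
  have hηc := hη.self_of_nhds
  refine ⟨?_, ?_, ?_, ?_⟩
  · refine contDiffAt_two_of_deriv (f' := deriv φ) (f'' := deriv (deriv φ)) ?_ ?_ ?_
    · exact eventually_of_comp (η := fun d => g d - d) hηc hne
        (s1.mono fun d hd => hd.differentiableAt.hasDerivAt)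
    · exact eventually_of_comp (η := fun d => g d - d) hηc hne
        (s2.mono fun d hd => hd.differentiableAt.hasDerivAt)
    · exact eventually_of_comp (η := fun d => g d - d) hηc hne s3
  · rw [hφ.self_of_nhds]; ring_nf
  · rw [s1.self_of_nhds.deriv]; ring_nf
  · rw [s2.self_of_nhds.deriv]; ring_nf

end

namespace Model

variable {α δ lam cI cbar g0 : ℝ} {F G Fb Gb : ℝ → ℝ} {Q : ℝ → ℝ → ℝ}
  (M : Model α δ lam cI cbar g0 F G Fb Gb Q)

include M

theorem inherits_Gb {c : ℝ} (hc : c ∈ Ioo 0 cI) :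
    Inherits α δ lam (profile Q cI) (Gb c - c) c c (Fb c) := by
  have hop := isOpen_Ioo.mem_nhds hc
  refine Inherits.of_boundary M.reg (t := id) (t' := fun _ => 1) (z := Fb) (z' := deriv Fb)
    (M.bd.Gb_contDiffAt hc) (by linarith [M.bd.Gb_deriv c hc])
    (Eventually.of_forall fun d => hasDerivAt_id d) ?_ ?_ ?_
  · filter_upwards [hop] with d hd using M.bd.Fb_hasDerivAt hd
  · filter_upwards [hop] with d hd using M.diag_fit_Gb hd
  · filter_upwards [hop] with d hd
    have h1 := M.upper_eq_of_lt hd le_rfl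
    rw [M.eq_on_III hd (M.bd.Fb_lt_Gb hd).le le_rfl] at h1
    simp only [id]
    linarith

theorem F_hasDerivAt {c : ℝ} (hc : 0 < c) (hne : c ≠ cbar) : HasDerivAt F (deriv F c) c :=
  ((M.bd.F_contDiffAt hc hne).differentiableAt (by norm_num)).hasDerivAt

theorem inherits_G {c C₀ : ℝ} (hc : c ∈ Ioo cbar C₀) :
    Inherits α δ lam (profile Q C₀) (G c - c) c 0 (F c) := by
  have hop := isOpen_Ioo.mem_nhds hc
  have hp : ∀ d ∈ Ioo cbar C₀, 0 < d := fun d hd => M.bd.cbar_pos.trans hd.1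
  refine Inherits.of_boundary M.reg (t := fun _ => 0) (t' := fun _ => 0) (z := F) (z' := deriv F)
    (M.bd.G_contDiffAt (hp c hc) hc.1.ne') (M.bd.G_deriv_high c hc.1).2
    (Eventually.of_forall fun d => hasDerivAt_const d 0) ?_ ?_ ?_
  · filter_upwards [hop] with d hd using M.F_hasDerivAt (hp d hd) hd.1.ne'
  · filter_upwards [hop] with d hd using M.diag_fit_G hd.1 (M.F_hasDerivAt (hp d hd) hd.1.ne')
  · filter_upwards [hop] with d hd
    have h1 := M.top_eq hd.1.le hd.2.le le_rfl
    rw [M.eq_on_II (hp d hd) (M.bd.F_lt_G (hp d hd)).le le_rfl] at h1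
    linarith

theorem exists_Gb_diag (hI : 0 < cI) {y : ℝ} (h1 : α / (2 * lam) - cI < y) (h2 : y < g0) :
    ∃ c ∈ Ioo 0 cI, Gb c - c = y := by
  have h0 : Tendsto (fun c => Gb c - c) (𝓝[>] 0) (𝓝 (g0 - 0)) :=
    (M.bd.Gb_lim hI).sub (tendsto_id.mono_left nhdsWithin_le_nhds)
  rw [sub_zero] at h0
  obtain ⟨d, hd, hd'⟩ := ((h0.eventually (lt_mem_nhds h2)).and (Ioo_mem_nhdsGT hI)).exists
  have hcont : ContinuousOn (fun c => Gb c - c) (Icc d cI) :=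
    (M.bd.Gb_cont.mono fun c hc => ⟨hd'.1.trans_le hc.1, hc.2⟩).sub continuousOn_id
  obtain ⟨c, hc, rfl⟩ := intermediate_value_Icc' hd'.2.le hcont
    ⟨by simp only [M.bd.Gb_end hI]; exact h1.le, hd.le⟩
  refine ⟨c, ⟨hd'.1.trans_le hc.1, lt_of_le_of_ne hc.2 ?_⟩, rfl⟩
  rintro rfl
  simp [M.bd.Gb_end hI] at h1

theorem exists_G_diag {C₀ y : ℝ} (hC : cbar < C₀) (h1 : G C₀ - C₀ < y) (h2 : y < G cbar - cbar) :
    ∃ c ∈ Ioo cbar C₀, G c - c = y := by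
  have hcont : ContinuousOn (fun c => G c - c) (Icc cbar C₀) :=
    (M.bd.G_cont.mono fun c hc => M.bd.cbar_pos.trans_le hc.1).sub continuousOn_id
  obtain ⟨c, hc, rfl⟩ := intermediate_value_Ioo' hC.le hcont ⟨h1, h2⟩
  exact ⟨c, hc, rfl⟩

theorem g0_gt (hI : 0 < cI) : α / (2 * lam) < g0 := (M.bd.g0_mem hI).1

theorem inherits_outer (hI : 0 < cI) {y : ℝ} (hy : g0 < y) :
    Inherits α δ lam (profile Q cI) y 0 0 (f0 α δ lam) := by
  refine Inherits.of_eventuallyEq M.reg ?_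
  filter_upwards [lt_mem_nhds hy] with w hw
  rw [M.profile_outer hI hw.le,
    M.reg.V0_of_ge (((M.bd.f0_lt_level hI).trans (M.g0_gt hI)).trans hw).le]

theorem inherits_zero (hI : cI = 0) {y : ℝ} (hy : f0 α δ lam < y) :
    Inherits α δ lam (profile Q cI) y 0 0 (f0 α δ lam) := by
  refine Inherits.of_eventuallyEq M.reg ?_
  filter_upwards [lt_mem_nhds hy] with w hw
  rw [M.profile_zero hI (M.reg.f0_pos.trans hw).le, M.reg.V0_of_ge hw.le]

theorem profile_eventuallyEq_inner (hI : 0 < cI) {y : ℝ} (h1 : G cI - cI < y)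
    (h2 : y < α / (2 * lam) - cI) : profile Q cI =ᶠ[𝓝 y] fun y => δ * y ^ 2 := by
  filter_upwards [isOpen_Ioo.mem_nhds ⟨h1, h2⟩] with w hw
    using M.profile_inner hI hw.1.le hw.2.le

/-- The slope of the profile on the level `cI` has the right limits at the two exceptional
diagonals. -/
theorem tendsto_slope_Gb_right (hI : 0 < cI) :
    Tendsto (deriv (profile Q cI)) (𝓝[>] (α / (2 * lam) - cI))
      (𝓝 (2 * δ * (α / (2 * lam) - cI))) := by
  have hFb : Tendsto Fb (𝓝[<] cI) (𝓝 (α / (2 * lam))) := by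
    rw [← M.bd.Fb_end hI]
    exact (M.bd.Fb_cont cI ⟨hI, le_rfl⟩).tendsto.mono_left
      (nhdsWithin_le_of_mem (mem_of_superset (Ioo_mem_nhdsLT hI) Ioo_subset_Ioc_self))
  have hGb : Tendsto Gb (𝓝[<] cI) (𝓝 (α / (2 * lam))) := by
    rw [← M.bd.Gb_end hI]
    exact (M.bd.Gb_cont cI ⟨hI, le_rfl⟩).tendsto.mono_left
      (nhdsWithin_le_of_mem (mem_of_superset (Ioo_mem_nhdsLT hI) Ioo_subset_Ioc_self))
  have hid : Tendsto (fun c : ℝ => c) (𝓝[<] cI) (𝓝 cI) := tendsto_id.mono_left nhdsWithin_le_nhds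
  refine tendsto_right_of_comp_anti (η := fun c => Gb c - c) hI
    ((M.bd.Gb_cont.mono Ioo_subset_Ioc_self).sub continuousOn_id) (hGb.sub hid) ?_ ?_
  · intro c hc; linarith [M.bd.level_lt_Gb hc, hc.2]
  · have h1 := (continuous_solX (α := α) (δ := δ) (lam := lam)).tendsto
      (cI, α / (2 * lam), α / (2 * lam)) |>.comp (hid.prodMk_nhds (hFb.prodMk_nhds hGb))
    simp only [solX_self] at h1
    refine h1.congr' ?_
    filter_upwards [Ioo_mem_nhdsLT hI] with c hc
    rw [(M.inherits_Gb hc).slope]; simp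

theorem tendsto_slope_Gb_left (hI : 0 < cI) :
    Tendsto (deriv (profile Q cI)) (𝓝[<] g0) (𝓝 (solX α δ lam 0 (f0 α δ lam) g0)) := by
  have hid : Tendsto (fun c : ℝ => c) (𝓝[>] 0) (𝓝 0) := tendsto_id.mono_left nhdsWithin_le_nhds
  have hη := (M.bd.Gb_lim hI).sub hid
  rw [sub_zero] at hη
  refine tendsto_left_of_comp_anti (η := fun c => Gb c - c) hI
    ((M.bd.Gb_cont.mono Ioo_subset_Ioc_self).sub continuousOn_id) hη ?_ ?_
  · intro c hc; linarith [M.bd.Gb_lt_g0 ⟨hc.1, hc.2.le⟩, hc.1]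
  · have h1 := (continuous_solX (α := α) (δ := δ) (lam := lam)).tendsto
      (0, f0 α δ lam, g0) |>.comp (hid.prodMk_nhds ((M.bd.Fb_lim hI).prodMk_nhds (M.bd.Gb_lim hI)))
    refine h1.congr' ?_
    filter_upwards [Ioo_mem_nhdsGT hI] with c hc
    rw [(M.inherits_Gb hc).slope]; simp

/-- Each piece of the profile is C¹. At the junctions α/(2λ) - cI and g₀, which are the ends of the
trace of Ḡ, the one-sided limits of the slope agree, so the singularity is removable. -/
theorem contDiffAt_profile {y : ℝ} (h1 : 0 < cI → G cI - cI < y) (h0 : 0 < y) :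
    ContDiffAt ℝ 1 (profile Q cI) y := by
  rcases M.bd.cI_nonneg.eq_or_lt with hI | hI
  · refine M.reg.contDiff_V0.contDiffAt.congr_of_eventuallyEq ?_
    filter_upwards [lt_mem_nhds h0] with w hw using M.profile_zero hI.symm hw.le
  have hcont : ContinuousAt (profile Q cI) y :=
    M.cand.continuousAt_profile hI.le (by linarith)
  have inner : ∀ y, G cI - cI < y → y < α / (2 * lam) - cI → ContDiffAt ℝ 1 (profile Q cI) y :=
    fun y a b => ContDiffAt.congr_of_eventuallyEq (by fun_prop)
      (M.profile_eventuallyEq_inner hI a b)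
  have mid : ∀ y, α / (2 * lam) - cI < y → y < g0 → ContDiffAt ℝ 1 (profile Q cI) y := by
    intro y a b
    obtain ⟨c, hc, rfl⟩ := M.exists_Gb_diag hI a b
    exact (M.inherits_Gb hc).contDiffAt.of_le (by norm_num)
  have outer : ∀ y, g0 < y → ContDiffAt ℝ 1 (profile Q cI) y := fun y a =>
    (M.inherits_outer hI a).contDiffAt.of_le (by norm_num)
  have hlg := M.g0_gt hI
  rcases lt_trichotomy y (α / (2 * lam) - cI) with h | h | h
  · exact inner y (h1 hI) h
  · refine (contDiffAt_one_of_punctured (l := 2 * δ * y) hcont ?_ ?_).1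
    · rw [← nhdsLT_sup_nhdsGT]
      refine eventually_sup.2 ⟨?_, ?_⟩
      · filter_upwards [Ioo_mem_nhdsLT (h1 hI)] with w hw using inner w hw.1 (h ▸ hw.2)
      · filter_upwards [Ioo_mem_nhdsGT (show y < g0 by linarith)] with w hw
          using mid w (h ▸ hw.1) hw.2
    · rw [← nhdsLT_sup_nhdsGT]
      refine Tendsto.sup ?_ ?_
      · have : Tendsto (fun w => 2 * δ * w) (𝓝[<] y) (𝓝 (2 * δ * y)) :=
          (Continuous.tendsto (by fun_prop) y).mono_left nhdsWithin_le_nhds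
        refine this.congr' ?_
        filter_upwards [Ioo_mem_nhdsLT (h1 hI)] with w hw
        rw [(M.profile_eventuallyEq_inner hI hw.1 (h ▸ hw.2)).deriv_eq]
        exact (hasDerivAt_sq_mul w).deriv.symm
      · rw [h]; exact M.tendsto_slope_Gb_right hI
  rcases lt_trichotomy y g0 with h' | h' | h'
  · exact mid y h h'
  · refine (contDiffAt_one_of_punctured (l := solX α δ lam 0 (f0 α δ lam) y) hcont ?_ ?_).1
    · rw [← nhdsLT_sup_nhdsGT]
      refine eventually_sup.2 ⟨?_, ?_⟩
      · filter_upwards [Ioo_mem_nhdsLT h] with w hw using mid w hw.1 (h' ▸ hw.2)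
      · filter_upwards [self_mem_nhdsWithin] with w hw using outer w (h' ▸ hw)
    · rw [← nhdsLT_sup_nhdsGT]
      refine Tendsto.sup ?_ ?_
      · rw [h']; exact M.tendsto_slope_Gb_left hI
      · have : Tendsto (solX α δ lam 0 (f0 α δ lam)) (𝓝[>] y)
            (𝓝 (solX α δ lam 0 (f0 α δ lam) y)) :=
          (hasDerivAt_solX M.reg _ _ y).continuousAt.continuousWithinAt
        refine this.congr' ?_
        filter_upwards [self_mem_nhdsWithin] with w hw
        rw [(M.inherits_outer hI (h' ▸ hw)).slope, add_zero]
  · exact outer y h'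

/-! ### Smooth fit at `G` below the level `cbar` -/

theorem diag_pos {c : ℝ} (hc : c ∈ Ioc 0 cbar) : 0 < G c - c := by
  have : 0 < 1 / (2 * δ) := by have := M.reg.δ_pos; positivity
  linarith [M.bd.half_lt_diag hc]

theorem contDiffAt_profile_diag {c : ℝ} (hc : c ∈ Ioc cI cbar) :
    ContDiffAt ℝ 1 (profile Q cI) (G c - c) := by
  have h0 := M.bd.cI_nonneg.trans_lt hc.1
  refine M.contDiffAt_profile (fun hI => ?_) (M.diag_pos ⟨h0, hc.2⟩)
  exact M.bd.diag_strictMonoOn ⟨hI, M.bd.cI_lt_cbar.le⟩ ⟨h0, hc.2⟩ hc.1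

theorem solX_G_upper {c : ℝ} (hc : c ∈ Ioc cI cbar) :
    solX α δ lam 0 (F c) (G c) = deriv (profile Q cI) (G c - c) := by
  have h0 := M.bd.cI_nonneg.trans_lt hc.1
  have hφ := ((M.contDiffAt_profile_diag hc).differentiableAt (by norm_num)).hasDerivAt
  obtain ⟨v1, v2, d1, d2⟩ := fit_of_differentiableAt (f := fun y => Q y c)
    (g₁ := sol α δ lam 0 (F c)) (g₂ := fun y => profile Q cI (y - c) + c) (z := G c)
    ((M.cand.sf1_G c ⟨h0, hc.2⟩).differentiableAt (by norm_num))
    (by filter_upwards [Ioo_mem_nhdsLT (M.bd.F_lt_G h0)] with y hy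
          using M.eq_on_II h0 hy.1.le hy.2.le)
    (by filter_upwards [self_mem_nhdsWithin] with y hy
          using M.upper_eq h0 hc.1.le (le_of_lt hy) (Or.inl hc.2))
    (hasDerivAt_sol M.reg 0 (F c) (G c)) ((hφ.comp_sub_const (G c) c).add_const c)
  rw [d1, ← d2]

theorem solX_G_lower {c : ℝ} (hc : c ∈ Ioc 0 cI) :
    solX α δ lam 0 (F c) (G c) = 2 * δ * (G c - c) := by
  obtain ⟨v1, v2, d1, d2⟩ := fit_of_differentiableAt (f := fun y => Q y c)
    (g₁ := sol α δ lam 0 (F c)) (g₂ := fun y => δ * (y - c) ^ 2 + c) (z := G c)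
    ((M.cand.sf1_G c ⟨hc.1, hc.2.trans M.bd.cI_lt_cbar.le⟩).differentiableAt (by norm_num))
    (by filter_upwards [Ioo_mem_nhdsLT (M.bd.F_lt_G hc.1)] with y hy
          using M.eq_on_II hc.1 hy.1.le hy.2.le)
    (by filter_upwards [Ioo_mem_nhdsGT (M.bd.G_lt_Fb c hc)] with y hy
          using M.lower_eq hc hy.1.le hy.2.le)
    (hasDerivAt_sol M.reg 0 (F c) (G c)) (hasDerivAt_sq_shift c (G c))
  rw [d1, ← d2]

/-- The trace of G over (c̄, C₀) meets the profile from level cI at the diagonal of (G(c̄), c̄); SF1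
at that point matches the slopes. -/
theorem contDiffAt_profile_top {C₀ y : ℝ} (hC : cbar < C₀) (h1 : G C₀ - C₀ < y) :
    ContDiffAt ℝ 1 (profile Q C₀) y := by
  have hp := M.bd.cbar_pos
  have low : ∀ y, G C₀ - C₀ < y → y < G cbar - cbar → ContDiffAt ℝ 1 (profile Q C₀) y := by
    intro y a b
    obtain ⟨c, hc, rfl⟩ := M.exists_G_diag hC a b
    exact (M.inherits_G hc).contDiffAt.of_le (by norm_num)
  have hpos := M.diag_pos ⟨hp, le_rfl⟩
  have hdlt : 0 < cI → G cI - cI < G cbar - cbar := fun hI =>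
    M.bd.diag_strictMonoOn ⟨hI, M.bd.cI_lt_cbar.le⟩ ⟨hp, le_rfl⟩ M.bd.cI_lt_cbar
  have heq : ∀ y, G cbar - cbar < y → profile Q C₀ =ᶠ[𝓝 y] profile Q cI := fun y hy => by
    filter_upwards [lt_mem_nhds hy] with w hw using M.profile_top_eq hC.le hw.le
  have high : ∀ y, G cbar - cbar < y → ContDiffAt ℝ 1 (profile Q C₀) y := fun y hy =>
    (M.contDiffAt_profile (fun hI => (hdlt hI).trans hy) (hpos.trans hy)).congr_of_eventuallyEq
      (heq y hy)
  rcases lt_trichotomy y (G cbar - cbar) with h | h | h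
  · exact low y h1 h
  · have hy0 : 0 < y + C₀ := by linarith [M.bd.G_pos C₀ (hp.trans hC)]
    refine (contDiffAt_one_of_punctured (l := deriv (profile Q cI) y)
      (M.cand.continuousAt_profile (hp.trans hC).le hy0) ?_ ?_).1
    · rw [← nhdsLT_sup_nhdsGT]
      refine eventually_sup.2 ⟨?_, ?_⟩
      · filter_upwards [Ioo_mem_nhdsLT h1] with w hw using low w hw.1 (h ▸ hw.2)
      · filter_upwards [self_mem_nhdsWithin] with w hw using high w (h ▸ hw)
    · rw [← nhdsLT_sup_nhdsGT]
      have hm : cbar ∈ Ioc cI cbar := ⟨M.bd.cI_lt_cbar, le_rfl⟩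
      refine Tendsto.sup ?_ ?_
      · have hid : Tendsto (fun c : ℝ => c) (𝓝[>] cbar) (𝓝 cbar) :=
          tendsto_id.mono_left nhdsWithin_le_nhds
        have hF : Tendsto F (𝓝[>] cbar) (𝓝 (F cbar)) :=
          (M.bd.F_continuousAt hp).continuousWithinAt
        have hG : Tendsto G (𝓝[>] cbar) (𝓝 (G cbar)) :=
          (M.bd.G_continuousAt hp).continuousWithinAt
        rw [h]
        refine tendsto_left_of_comp_anti (η := fun c => G c - c) hC
          ((M.bd.G_cont.mono fun c hc => hp.trans hc.1).sub continuousOn_id) (hG.sub hid) ?_ ?_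
        · intro c hc; exact M.bd.diag_strictAntiOn self_mem_Ici hc.1.le hc.1
        · have h2 := (continuous_solX (α := α) (δ := δ) (lam := lam)).tendsto
            (0, F cbar, G cbar) |>.comp (tendsto_const_nhds.prodMk_nhds (hF.prodMk_nhds hG))
          rw [← M.solX_G_upper hm]
          refine h2.congr' ?_
          filter_upwards [Ioo_mem_nhdsGT hC] with c hc
          rw [(M.inherits_G hc).slope]; simp
      · have h2 : Tendsto (deriv (profile Q cI)) (𝓝[>] y) (𝓝 (deriv (profile Q cI) y)) := by
          have := M.contDiffAt_profile_diag hm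
          rw [← h] at this
          exact (continuousAt_deriv_of_contDiffAt this).continuousWithinAt
        refine h2.congr' ?_
        filter_upwards [self_mem_nhdsWithin] with w hw
        exact ((heq w (h ▸ hw)).deriv_eq).symm
  · exact high y h

end Model

end

/-! ### The velocity of F, the gradient bound on II and III, and the sign of the gap -/

section

theorem deriv_nonpos_of_le_right {f : ℝ → ℝ} {a b f' : ℝ} (hab : a < b) (hf : HasDerivAt f f' a)
    (h : ∀ x ∈ Ioo a b, f x ≤ f a) : f' ≤ 0 := by
  have ht := (hasDerivWithinAt_iff_tendsto_slope' (s := Ioi a) (by simp)).1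
    (hf.hasDerivWithinAt (s := Ioi a))
  refine le_of_tendsto ht ?_
  filter_upwards [Ioo_mem_nhdsGT hab] with x hx
  rw [slope_def_field]
  exact div_nonpos_of_nonpos_of_nonneg (sub_nonpos.2 (h x hx)) (sub_nonneg.2 hx.1.le)

theorem solC_zero {α δ lam z ζ x : ℝ} : solC α δ lam 0 z 0 ζ x =
    2 * gap α δ lam 0 z * ζ / √(2 * α) * Real.sinh (√(2 * α) * (x - z)) := by
  simp [solC]

theorem solXC_zero {α δ lam z ζ x : ℝ} : solXC α δ lam 0 z 0 ζ x =
    2 * gap α δ lam 0 z * ζ * Real.cosh (√(2 * α) * (x - z)) := by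
  simp [solXC]

/-- The velocity of the lower boundary, expressed through the smooth fit at the upper one. -/
def vel (α δ lam : ℝ) (F G : ℝ → ℝ) (c : ℝ) : ℝ :=
  √(2 * α) * (1 - solX α δ lam 0 (F c) (G c)) /
    (2 * gap α δ lam 0 (F c) * Real.sinh (√(2 * α) * (G c - F c)))

namespace Model

variable {α δ lam cI cbar g0 : ℝ} {F G Fb Gb : ℝ → ℝ} {Q : ℝ → ℝ → ℝ}
  (M : Model α δ lam cI cbar g0 F G Fb Gb Q)

include M

/-! ### Region II -/

theorem gap_F_pos {c : ℝ} (hc : 0 < c) : 0 < gap α δ lam 0 (F c) :=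
  M.reg.gap_zero_pos (M.bd.F_pos c hc.le).le ((M.bd.F_lt hc).trans M.reg.half_lt_f0).le

theorem sinh_pos {c : ℝ} (hc : 0 < c) : 0 < Real.sinh (√(2 * α) * (G c - F c)) :=
  Real.sinh_pos_iff.2 (mul_pos M.reg.k_pos (sub_pos.2 (M.bd.F_lt_G hc)))

theorem G_lt_level_of_le {c : ℝ} (hc : c ∈ Ioc 0 cI) : G c < α / (2 * lam) :=
  (M.bd.G_lt_Fb c hc).trans_le (M.bd.Fb_le_level hc)

theorem diag_gt_cI {c : ℝ} (hI : 0 < cI) (hc : c ∈ Ioc cI cbar) : G cI - cI < G c - c :=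
  M.bd.diag_strictMonoOn ⟨hI, M.bd.cI_lt_cbar.le⟩ ⟨hI.trans hc.1, hc.2⟩ hc.1

/-- Below α/(2λ) the diagonal through the point of G leads to the square piece of the profile: by
the shape of F̄ if cI > 0, and by α/(2λ) ≤ f₀ if cI = 0. -/
theorem eq_G_of_lt_level {c : ℝ} (hc : c ∈ Ioc 0 cbar) (hG : G c < α / (2 * lam)) :
    Q (G c) c = δ * (G c - c) ^ 2 + c := by
  rcases le_or_gt c cI with h | h
  · exact M.lower_eq ⟨hc.1, h⟩ le_rfl (M.bd.G_lt_Fb c ⟨hc.1, h⟩).le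
  rw [M.upper_eq hc.1 h.le le_rfl (Or.inl hc.2)]
  rcases M.bd.cI_nonneg.eq_or_lt with hI | hI
  · rw [M.profile_zero hI.symm (M.diag_pos hc).le,
      V0_of_le (by linarith [M.regime hI.symm, hc.1])]
  · rw [M.profile_inner hI (M.diag_gt_cI hI ⟨h, hc.2⟩).le (by linarith)]

theorem solX_G_of_lt_level {c : ℝ} (hc : c ∈ Ioc 0 cbar) (hG : G c < α / (2 * lam)) :
    solX α δ lam 0 (F c) (G c) = 2 * δ * (G c - c) := by
  rcases le_or_gt c cI with h | h
  · exact M.solX_G_lower ⟨hc.1, h⟩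
  rw [M.solX_G_upper ⟨h, hc.2⟩]
  rcases M.bd.cI_nonneg.eq_or_lt with hI | hI
  · have he : profile Q cI =ᶠ[𝓝 (G c - c)] V0 α δ lam := by
      filter_upwards [lt_mem_nhds (M.diag_pos hc)] with w hw using M.profile_zero hI.symm hw.le
    rw [he.deriv_eq, (M.reg.hasDerivAt_V0 _).deriv,
      V0X_of_le (by linarith [M.regime hI.symm, hc.1])]
  · rw [(M.profile_eventuallyEq_inner hI (M.diag_gt_cI hI ⟨h, hc.2⟩) (by linarith)).deriv_eq]
    exact (hasDerivAt_sq_mul _).deriv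

/-- Below c̄ only SF1 is available on G. Differentiating Q(G(d), d) = φ(G(d) - d) + d and inserting
`solX` = φ' cancels the terms with G' and leaves D = 1. -/
theorem diag_fit_G_low {c F' : ℝ} (hc : c ∈ Ioo 0 cbar) (hF : HasDerivAt F F' c) :
    solX α δ lam 0 (F c) (G c) + solC α δ lam 0 (F c) 0 F' (G c) = 1 := by
  have hGd := M.bd.G_hasDerivAt hc.1 hc.2.ne
  have hd := hasDerivAt_sol_curve M.reg (hasDerivAt_const c 0) hF hGd
  have hII : ∀ᶠ d in 𝓝 c, Q (G d) d = sol α δ lam 0 (F d) (G d) := by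
    filter_upwards [lt_mem_nhds hc.1] with d hd using M.eq_on_II hd (M.bd.F_lt_G hd).le le_rfl
  have key : ∀ φ : ℝ → ℝ, ∀ s, HasDerivAt φ s (G c - c) →
      (∀ᶠ d in 𝓝 c, Q (G d) d = φ (G d - d) + d) → solX α δ lam 0 (F c) (G c) = s →
      solX α δ lam 0 (F c) (G c) + solC α δ lam 0 (F c) 0 F' (G c) = 1 := by
    intro φ s hφ hev hs
    have h1 : HasDerivAt (fun d => φ (G d - d) + d) (s * (deriv G c - 1) + 1) c :=
      (HasDerivAt.comp (h := fun d => G d - d) c hφ (hGd.sub (hasDerivAt_id c))).add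
        (hasDerivAt_id c)
    have h2 := hd.unique (h1.congr_of_eventuallyEq (by
      filter_upwards [hII, hev] with d e1 e2 using by rw [← e1, e2]))
    rw [hs] at h2 ⊢
    linarith
  rcases le_or_gt c cI with h | h
  · have hlev := M.G_lt_level_of_le ⟨hc.1, h⟩
    refine key (fun y => δ * y ^ 2) _ (hasDerivAt_sq_mul _) ?_
      (M.solX_G_of_lt_level ⟨hc.1, hc.2.le⟩ hlev)
    filter_upwards [isOpen_Ioo.mem_nhds hc,
      hGd.continuousAt.eventually_lt continuousAt_const hlev] with d e1 e2
    exact M.eq_G_of_lt_level ⟨e1.1, e1.2.le⟩ e2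
  · refine key (profile Q cI) _
      ((M.contDiffAt_profile_diag ⟨h, hc.2.le⟩).differentiableAt (by norm_num)).hasDerivAt ?_
      (M.solX_G_upper ⟨h, hc.2.le⟩)
    filter_upwards [isOpen_Ioo.mem_nhds ⟨h, hc.2⟩] with d hd
    exact M.upper_eq (M.bd.cI_nonneg.trans_lt hd.1) hd.1.le le_rfl (Or.inl hd.2.le)

theorem vel_fit {c : ℝ} (hc : 0 < c) :
    solX α δ lam 0 (F c) (G c) + solC α δ lam 0 (F c) 0 (vel α δ lam F G c) (G c) = 1 := by
  have h1 := (M.gap_F_pos hc).ne'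
  have h2 := (M.sinh_pos hc).ne'
  have h3 := M.reg.k_pos.ne'
  rw [solC_zero, vel]
  field_simp
  ring

theorem deriv_F {c : ℝ} (hc : 0 < c) (hne : c ≠ cbar) : deriv F c = vel α δ lam F G c := by
  have hF := M.F_hasDerivAt hc hne
  have h : solX α δ lam 0 (F c) (G c) + solC α δ lam 0 (F c) 0 (deriv F c) (G c) = 1 := by
    rcases lt_or_gt_of_ne hne with h | h
    · exact M.diag_fit_G_low ⟨hc, h⟩ hF
    · exact (M.diag_fit_G h hF).1
  have h' := M.vel_fit hc
  have h1 := (M.gap_F_pos hc).ne'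
  have h2 := (M.sinh_pos hc).ne'
  have h3 := M.reg.k_pos.ne'
  rw [solC_zero] at h h'
  have h4 : 2 * gap α δ lam 0 (F c) * deriv F c / √(2 * α) *
      Real.sinh (√(2 * α) * (G c - F c)) = 2 * gap α δ lam 0 (F c) * vel α δ lam F G c /
      √(2 * α) * Real.sinh (√(2 * α) * (G c - F c)) := by linarith
  field_simp at h4
  exact h4

theorem continuousAt_vel {c : ℝ} (hc : 0 < c) : ContinuousAt (vel α δ lam F G) c := by
  have hF := M.bd.F_continuousAt hc
  have hG := M.bd.G_continuousAt hc
  have h1 := (M.gap_F_pos hc).ne'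
  have h2 := (M.sinh_pos hc).ne'
  have hs : ContinuousAt (fun c => solX α δ lam 0 (F c) (G c)) c :=
    ContinuousAt.comp (f := fun c => ((0 : ℝ), F c, G c)) continuous_solX.continuousAt
      (continuousAt_const.prodMk (hF.prodMk hG))
  have hg : ContinuousAt (fun c => gap α δ lam 0 (F c)) c :=
    ContinuousAt.comp (f := fun c => ((0 : ℝ), F c)) continuous_gap.continuousAt
      (continuousAt_const.prodMk hF)
  have hsh : ContinuousAt (fun c => Real.sinh (√(2 * α) * (G c - F c))) c :=
    Real.continuous_sinh.continuousAt.comp (continuousAt_const.mul (hG.sub hF))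
  unfold vel
  exact (continuousAt_const.mul (continuousAt_const.sub hs)).div
    ((continuousAt_const.mul hg).mul hsh) (mul_ne_zero (mul_ne_zero two_ne_zero h1) h2)

/-- D = 1 on G determines F' by a formula that is continuous in c even at c̄, so F has no kink
there. -/
theorem F_contDiffAt {c : ℝ} (hc : 0 < c) :
    ContDiffAt ℝ 1 F c ∧ deriv F c = vel α δ lam F G c := by
  by_cases hne : c = cbar
  · refine contDiffAt_one_of_punctured (M.bd.F_continuousAt hc) ?_ ?_
    · filter_upwards [self_mem_nhdsWithin, mem_nhdsWithin_of_mem_nhds (lt_mem_nhds hc)] with d h1 h2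
      exact M.bd.F_contDiffAt h2 (hne ▸ h1)
    · refine ((M.continuousAt_vel hc).tendsto.mono_left nhdsWithin_le_nhds).congr' ?_
      filter_upwards [self_mem_nhdsWithin, mem_nhdsWithin_of_mem_nhds (lt_mem_nhds hc)] with d h1 h2
      exact (M.deriv_F h2 (hne ▸ h1)).symm
  · exact ⟨M.bd.F_contDiffAt hc hne, M.deriv_F hc hne⟩

theorem F_hasDerivAt_vel {c : ℝ} (hc : 0 < c) : HasDerivAt F (vel α δ lam F G c) c := by
  have h := M.F_contDiffAt hc
  rw [← h.2]
  exact (h.1.differentiableAt (by norm_num)).hasDerivAt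

theorem vel_nonpos {c : ℝ} (hc : 0 < c) : vel α δ lam F G c ≤ 0 := by
  have h1 : Tendsto (vel α δ lam F G) (𝓝[>] c) (𝓝 (vel α δ lam F G c)) :=
    (M.continuousAt_vel hc).continuousWithinAt
  refine le_of_tendsto h1 ?_
  have hne : ∀ᶠ d in 𝓝[>] c, d ≠ cbar := by
    rcases lt_or_ge c cbar with h | h
    · filter_upwards [Ioo_mem_nhdsGT h] with d hd using hd.2.ne
    · filter_upwards [self_mem_nhdsWithin] with d hd using (h.trans_lt hd).ne'
  filter_upwards [hne, self_mem_nhdsWithin] with d h2 h3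
  rw [← M.deriv_F (hc.trans h3) h2]
  exact (M.bd.F_deriv d (hc.trans h3) h2).le

/-- Eliminating F' by D = 1, the slope of D at G times the positive sinh becomes the left side of
`q_eq`, so it has the sign of q. -/
theorem slope_G_pos {c : ℝ} (hc : c ∈ Ioo 0 cbar) :
    0 < solXX α δ lam 0 (F c) (G c) + solXC α δ lam 0 (F c) 0 (vel α δ lam F G c) (G c) := by
  have hs := M.sinh_pos hc.1
  have h3 := M.reg.k_pos
  have hq := q_eq M.reg (G c) (F c)
  have hfit := M.vel_fit hc.1
  rw [solC_zero] at hfit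
  have hpos : 0 < √(2 * α) * Real.exp (-F c * √(2 * α)) * q α δ lam (G c) (F c) :=
    mul_pos (mul_pos h3 (Real.exp_pos _)) (M.bd.q_pos c hc)
  rw [← hq] at hpos
  refine pos_of_mul_pos_right (b := _) (a := Real.sinh (√(2 * α) * (G c - F c))) ?_ hs.le
  rw [solXC_zero]
  have h4 : 2 * gap α δ lam 0 (F c) * vel α δ lam F G c *
      Real.sinh (√(2 * α) * (G c - F c)) = √(2 * α) * (1 - solX α δ lam 0 (F c) (G c)) := by
    have : 2 * gap α δ lam 0 (F c) * vel α δ lam F G c *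
      Real.sinh (√(2 * α) * (G c - F c)) = √(2 * α) * (2 * gap α δ lam 0 (F c) *
        vel α δ lam F G c / √(2 * α) * Real.sinh (√(2 * α) * (G c - F c))) := by
      field_simp
    rw [this]; congr 1; linarith
  calc 0 < _ := hpos
    _ = _ := by linear_combination (-Real.cosh (√(2 * α) * (G c - F c))) * h4

theorem slope_G_nonneg {c : ℝ} (hc : 0 < c) :
    0 ≤ solXX α δ lam 0 (F c) (G c) + solXC α δ lam 0 (F c) 0 (vel α δ lam F G c) (G c) := by
  have htop : ∀ d, cbar < d → solXX α δ lam 0 (F d) (G d) +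
      solXC α δ lam 0 (F d) 0 (vel α δ lam F G d) (G d) = 0 := fun d hd =>
    (M.diag_fit_G hd (M.F_hasDerivAt_vel (M.bd.cbar_pos.trans hd))).2
  rcases lt_trichotomy c cbar with h | h | h
  · exact (M.slope_G_pos ⟨hc, h⟩).le
  -- At c̄ itself q > 0 is not assumed; the slope is continuous in c and vanishes for c > c̄.
  · have hF := M.bd.F_continuousAt hc
    have hG := M.bd.G_continuousAt hc
    have hs : ContinuousAt (fun c => solXX α δ lam 0 (F c) (G c)) c :=
      ContinuousAt.comp (f := fun c => ((0 : ℝ), F c, G c)) continuous_solXX.continuousAt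
        (continuousAt_const.prodMk (hF.prodMk hG))
    have hg : ContinuousAt (fun c => gap α δ lam 0 (F c)) c :=
      ContinuousAt.comp (f := fun c => ((0 : ℝ), F c)) continuous_gap.continuousAt
        (continuousAt_const.prodMk hF)
    have hch : ContinuousAt (fun c => Real.cosh (√(2 * α) * (G c - F c))) c :=
      Real.continuous_cosh.continuousAt.comp (continuousAt_const.mul (hG.sub hF))
    have hcont : ContinuousAt (fun c => solXX α δ lam 0 (F c) (G c) +
        solXC α δ lam 0 (F c) 0 (vel α δ lam F G c) (G c)) c := by
      simp only [solXC_zero]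
      exact hs.add (((continuousAt_const.mul hg).mul (M.continuousAt_vel hc)).mul hch)
    have ht : Tendsto _ (𝓝[>] c) _ := hcont.continuousWithinAt
    refine ge_of_tendsto ht ?_
    filter_upwards [self_mem_nhdsWithin] with d hd using (htop d (h ▸ hd)).ge
  · exact (htop c h).ge

theorem solC_II_nonpos {x c : ℝ} (hc : 0 < c) (hx : F c ≤ x) :
    solC α δ lam 0 (F c) 0 (vel α δ lam F G c) x ≤ 0 := by
  rw [solC_zero]
  have h1 : 0 ≤ Real.sinh (√(2 * α) * (x - F c)) :=
    Real.sinh_nonneg_iff.2 (mul_nonneg M.reg.k_pos.le (sub_nonneg.2 hx))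
  refine mul_nonpos_of_nonpos_of_nonneg (div_nonpos_of_nonpos_of_nonneg ?_ M.reg.k_pos.le) h1
  exact mul_nonpos_of_nonneg_of_nonpos (mul_nonneg two_pos.le (M.gap_F_pos hc).le)
    (M.vel_nonpos hc)

theorem diag_le_one_II {x c : ℝ} (hc : 0 < c) (hx : x ∈ Icc (F c) (G c)) :
    solX α δ lam 0 (F c) x + solC α δ lam 0 (F c) 0 (vel α δ lam F G c) x ≤ 1 := by
  refine solX_add_solC_le_one M.reg ?_ (M.vel_fit hc) (fun _ => M.slope_G_nonneg hc) hx
  have h := M.bd.F_lt hc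
  have hδ := M.reg.δ_pos
  rw [lt_div_iff₀ (by positivity)] at h
  simp
  linarith

/-- Endpoint data for the minimum principle: the slope is 2δF at F, and 1 - Q_c ≥ 1 at G, because F
is decreasing and the gap at F is positive. -/
theorem solX_II_nonneg {x c : ℝ} (hc : 0 < c) (hx : x ∈ Icc (F c) (G c)) :
    0 ≤ solX α δ lam 0 (F c) x := by
  have hF := M.bd.F_pos c hc.le
  have hδ := M.reg.δ_pos
  refine solX_nonneg M.reg hF.le (by simp; positivity) ?_ hx
  linarith [M.vel_fit hc, M.solC_II_nonpos hc (M.bd.F_lt_G hc).le]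

/-- Differentiating the slope fit `solX` = 2δ(G - c) along G and subtracting gives (2δ - `solXX`)(G'
- 1) = D_x > 0. The first factor is twice the gap, and G' > 1. -/
theorem gap_G_nonneg {c : ℝ} (hc : c ∈ Ioo 0 cbar) (hG : G c < α / (2 * lam)) :
    0 ≤ gap α δ lam c (G c) := by
  have hGd := M.bd.G_hasDerivAt hc.1 hc.2.ne
  have hd := hasDerivAt_solX_curve M.reg (hasDerivAt_const c 0) (M.F_hasDerivAt_vel hc.1) hGd
  have h1 : HasDerivAt (fun d => 2 * δ * (G d - d)) (2 * δ * (deriv G c - 1)) c :=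
    (hGd.sub (hasDerivAt_id c)).const_mul (2 * δ)
  have h2 := hd.unique (h1.congr_of_eventuallyEq (by
    filter_upwards [isOpen_Ioo.mem_nhds hc,
      hGd.continuousAt.eventually_lt continuousAt_const hG] with d e1 e2
    exact M.solX_G_of_lt_level ⟨e1.1, e1.2.le⟩ e2))
  have h3 := M.slope_G_pos hc
  have h4 := M.bd.G_deriv_low c hc
  have h5 := solXX_eq M.reg 0 (F c) (G c)
  rw [← M.eq_on_II hc.1 (M.bd.F_lt_G hc.1).le le_rfl,
    M.eq_G_of_lt_level ⟨hc.1, hc.2.le⟩ hG] at h5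
  have h6 : 2 * gap α δ lam c (G c) = 2 * δ - solXX α δ lam 0 (F c) (G c) := by
    rw [h5, gap]; ring
  have h7 : 0 < (2 * gap α δ lam c (G c)) * (deriv G c - 1) := by rw [h6]; linarith
  have h8 := pos_of_mul_pos_left h7 (by linarith)
  linarith

/-! ### Region III -/

theorem half_lt_Fb_diag {c : ℝ} (hc : c ∈ Ioc 0 cI) : 1 / (2 * δ) < Fb c - c :=
  (M.bd.half_lt_level_sub (hc.1.trans_le hc.2)).trans_le (M.bd.Fb_diag_ge hc)

theorem diag_le_one_III {x c : ℝ} (hc : c ∈ Ioo 0 cI) (hx : x ∈ Icc (Fb c) (Gb c)) :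
    solX α δ lam c (Fb c) x + solC α δ lam c (Fb c) 1 (deriv Fb c) x ≤ 1 := by
  have h := M.diag_fit_Gb hc
  exact solX_add_solC_le_one M.reg (by simp) h.1 (fun _ => h.2.ge) hx

/-- D ≤ 1 on III with equality at F̄, so D_x ≤ 0 there; this derivative is 2 `gap` (F̄' - 1), and
F̄' < 1. -/
theorem gap_Fb_nonneg {c : ℝ} (hc : c ∈ Ioo 0 cI) : 0 ≤ gap α δ lam c (Fb c) := by
  have hd := (hasDerivAt_solX M.reg c (Fb c) (Fb c)).add
    (hasDerivAt_solC M.reg c (Fb c) 1 (deriv Fb c) (Fb c))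
  have h := deriv_nonpos_of_le_right (M.bd.Fb_lt_Gb hc) hd (fun x hx => by
    have := M.diag_le_one_III hc (Ioo_subset_Icc_self hx)
    simpa using this)
  rw [solXX_self M.reg, solXC_self] at h
  have := (M.bd.Fb_deriv c hc).2
  by_contra! hneg
  nlinarith [mul_pos (neg_pos.2 hneg) (sub_pos.2 this)]

/-- With y = F̄ - c the gap is δ - (αδ - λ)y² - c(α - 2λF̄) - λc², and F̄ < α/(2λ). -/
theorem gap_Fb_lt {c : ℝ} (hc : c ∈ Ioo 0 cI) : gap α δ lam c (Fb c) < δ := by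
  have h1 := M.bd.Fb_lt_level hc
  have h2 := M.half_lt_Fb_diag ⟨hc.1, hc.2.le⟩
  have hδ : 0 < 1 / (2 * δ) := by have := M.reg.δ_pos; positivity
  have hl := M.reg.lam_pos
  rw [lt_div_iff₀ (by positivity)] at h1
  have hy : 0 < Fb c - c := hδ.trans h2
  unfold gap
  obtain ⟨y, hyd⟩ : ∃ y, y = Fb c - c := ⟨_, rfl⟩
  have hF : Fb c = y + c := by linarith
  rw [hF] at h1 ⊢
  have hy' : 0 < y := by linarith
  have := mul_pos M.reg.diff_pos (pow_pos hy' 2)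
  have := mul_pos hc.1 (sub_pos.2 h1)
  have := mul_pos hl (pow_pos hc.1 2)
  nlinarith

theorem solXC_III_nonpos {x c : ℝ} (hc : c ∈ Ioo 0 cI) (hx : Fb c ≤ x) :
    solXC α δ lam c (Fb c) 1 (deriv Fb c) x ≤ 0 := by
  have hδ := M.reg.δ_pos
  have h1 := M.half_lt_Fb_diag ⟨hc.1, hc.2.le⟩
  rw [div_lt_iff₀ (by positivity)] at h1
  have h2 : gap α δ lam c (Fb c) * deriv Fb c ≤ δ := by
    have a := M.gap_Fb_nonneg hc
    have b := M.gap_Fb_lt hc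
    have := M.bd.Fb_deriv c hc
    nlinarith [mul_nonneg a (sub_nonneg.2 this.2.le)]
  have hs : 0 ≤ Real.sinh (√(2 * α) * (x - Fb c)) :=
    Real.sinh_nonneg_iff.2 (mul_nonneg M.reg.k_pos.le (sub_nonneg.2 hx))
  have hch := (Real.cosh_pos (√(2 * α) * (x - Fb c))).le
  unfold solXC
  have a : √(2 * α) * ((1 - 2 * δ * (Fb c - c)) * 1) * Real.sinh (√(2 * α) * (x - Fb c)) ≤ 0 :=
    mul_nonpos_of_nonpos_of_nonneg (mul_nonpos_of_nonneg_of_nonpos M.reg.k_pos.le (by linarith)) hs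
  have b : (2 * gap α δ lam c (Fb c) * deriv Fb c - 2 * δ * 1) *
      Real.cosh (√(2 * α) * (x - Fb c)) ≤ 0 :=
    mul_nonpos_of_nonpos_of_nonneg (by linarith) hch
  linarith

/-- Besides the sign of Q_c, this bounds Q_c on III by its values on F̄ and Ḡ, which involve no F̄';
that matters near the tip, where F̄' is not known to converge. -/
theorem solC_III_antitoneOn {c : ℝ} (hc : c ∈ Ioo 0 cI) :
    AntitoneOn (solC α δ lam c (Fb c) 1 (deriv Fb c)) (Ici (Fb c)) := by
  have hd := hasDerivAt_solC M.reg c (Fb c) 1 (deriv Fb c)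
  refine antitoneOn_of_deriv_nonpos (convex_Ici _)
    (fun y _ => (hd y).continuousAt.continuousWithinAt)
      (fun y _ => (hd y).differentiableAt.differentiableWithinAt) fun y hy => ?_
  rw [interior_Ici] at hy
  rw [(hd y).deriv]
  exact M.solXC_III_nonpos hc (le_of_lt hy)

theorem solC_III_nonpos {x c : ℝ} (hc : c ∈ Ioo 0 cI) (hx : Fb c ≤ x) :
    solC α δ lam c (Fb c) 1 (deriv Fb c) x ≤ 0 := by
  refine (M.solC_III_antitoneOn hc self_mem_Ici hx hx).trans ?_
  have hδ := M.reg.δ_pos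
  have h1 := M.half_lt_Fb_diag ⟨hc.1, hc.2.le⟩
  rw [div_lt_iff₀ (by positivity)] at h1
  simp
  linarith

theorem solX_III_nonneg {x c : ℝ} (hc : c ∈ Ioo 0 cI) (hx : x ∈ Icc (Fb c) (Gb c)) :
    0 ≤ solX α δ lam c (Fb c) x := by
  have hδ := M.reg.δ_pos
  have hc' : c ∈ Ioc 0 cI := ⟨hc.1, hc.2.le⟩
  have h1 : 0 < Fb c - c := lt_trans (by positivity) (M.half_lt_Fb_diag hc')
  refine solX_nonneg M.reg (M.bd.Fb_pos c hc').le (by simp only [solX_self]; positivity) ?_ hx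
  linarith [(M.diag_fit_Gb hc).1, M.solC_III_nonpos hc (M.bd.Fb_lt_Gb hc).le]

/-! ### The generator term on region IV -/

theorem gap_cI_level (hI : 0 < cI) : 0 ≤ gap α δ lam cI (α / (2 * lam)) := by
  have hFb : Tendsto Fb (𝓝[<] cI) (𝓝 (α / (2 * lam))) := by
    rw [← M.bd.Fb_end hI]
    exact (M.bd.Fb_cont cI ⟨hI, le_rfl⟩).tendsto.mono_left
      (nhdsWithin_le_of_mem (mem_of_superset (Ioo_mem_nhdsLT hI) Ioo_subset_Ioc_self))
  have hid : Tendsto (fun c : ℝ => c) (𝓝[<] cI) (𝓝 cI) := tendsto_id.mono_left nhdsWithin_le_nhds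
  have h1 := (continuous_gap (α := α) (δ := δ) (lam := lam)).tendsto (cI, α / (2 * lam)) |>.comp
    (hid.prodMk_nhds hFb)
  refine ge_of_tendsto h1 ?_
  filter_upwards [Ioo_mem_nhdsLT hI] with c hc using M.gap_Fb_nonneg hc

/-- With x fixed at α/(2λ) the gap increases with c as long as x - c ≥ 1/(2δ), which holds because x
≥ G(c). At level cI it is nonnegative as a limit of `gap_Fb_nonneg`, or, if cI = 0, because α/(2λ) ≤
f₀. -/
theorem gap_level_nonneg {c : ℝ} (hc : c ∈ Ioc 0 cbar) (hcI : cI ≤ c) (hG : G c ≤ α / (2 * lam)) :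
    0 ≤ gap α δ lam c (α / (2 * lam)) := by
  have h0 : 0 ≤ gap α δ lam cI (α / (2 * lam)) := by
    rcases M.bd.cI_nonneg.eq_or_lt with hI | hI
    · rw [← hI]
      refine (M.reg.gap_zero_pos ?_ (M.regime hI.symm)).le
      have := M.reg.α_pos
      have := M.reg.lam_pos
      positivity
    · exact M.gap_cI_level hI
  have hδ := M.reg.δ_pos
  have h1 := M.bd.half_lt_diag hc
  rw [div_lt_iff₀ (by positivity)] at h1
  generalize α / (2 * lam) = L at *
  have h2 : gap α δ lam c L = gap α δ lam cI L + α * (c - cI) * (δ * (2 * L - c - cI) - 1) := by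
    unfold gap; ring
  rw [h2]
  have h3 : 0 ≤ δ * (2 * L - c - cI) - 1 := by nlinarith
  have := mul_nonneg (mul_nonneg M.reg.α_pos.le (sub_nonneg.2 hcI)) h3
  linarith

/-- The gap is quadratic in x with leading coefficient -(αδ - λ) < 0. -/
theorem gap_concave {c a b x : ℝ} (ha : 0 ≤ gap α δ lam c a) (hb : 0 ≤ gap α δ lam c b)
    (h1 : a ≤ x) (h2 : x ≤ b) : 0 ≤ gap α δ lam c x := by
  rcases h1.eq_or_lt with rfl | h1
  · exact ha
  have e : (b - a) * gap α δ lam c x = (b - x) * gap α δ lam c a + (x - a) * gap α δ lam c b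
      + (α * δ - lam) * ((x - a) * (b - x) * (b - a)) := by
    unfold gap; ring
  have hba : 0 < b - a := by linarith
  have s1 : 0 ≤ x - a := by linarith
  have s2 : 0 ≤ b - x := by linarith
  have hd := M.reg.diff_pos
  have : 0 ≤ (b - a) * gap α δ lam c x := by rw [e]; positivity
  exact nonneg_of_mul_nonneg_right this hba

/-- Along x = y + c the gap has derivative 2λx - α in c, nonnegative beyond α/(2λ). -/
theorem gap_diag {y c c' : ℝ} (hcc : c' ≤ c) (hL : α / (2 * lam) ≤ y + c')
    (h : 0 ≤ gap α δ lam c' (y + c')) : 0 ≤ gap α δ lam c (y + c) := by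
  have hl := M.reg.lam_pos
  rw [div_le_iff₀ (by positivity)] at hL
  have e : gap α δ lam c (y + c) = gap α δ lam c' (y + c') +
      (c - c') * (lam * (2 * y + c + c') - α) := by unfold gap; ring
  rw [e]
  have h2 : 0 ≤ lam * (2 * y + c + c') - α := by nlinarith
  have := mul_nonneg (sub_nonneg.2 hcc) h2
  linarith

/-- Left of α/(2λ), concavity interpolates between G and either F̄ or α/(2λ). Right of it, one
descends the diagonal to its crossing with x = α/(2λ), or, if cI = 0 and there is no crossing, to c
= 0 with x - c ≤ f₀. -/
theorem gap_nonneg {x c : ℝ} (hc : c ∈ Ioc 0 cbar) (hG : G c ≤ x) (h1 : c < cI → x ≤ Fb c)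
    (h2 : cI ≤ c → 0 < cI → x - c ≤ α / (2 * lam) - cI) (h3 : cI = 0 → x - c ≤ f0 α δ lam) :
    0 ≤ gap α δ lam c x := by
  rcases lt_or_ge x (α / (2 * lam)) with hx | hx
  · have hcb : c < cbar := lt_of_le_of_ne hc.2 fun h => by
      have := M.bd.level_le_G h.ge
      linarith
    have hGa := M.gap_G_nonneg ⟨hc.1, hcb⟩ (hG.trans_lt hx)
    rcases lt_or_ge c cI with h | h
    · exact M.gap_concave hGa (M.gap_Fb_nonneg ⟨hc.1, h⟩) hG (h1 h)
    · exact M.gap_concave hGa (M.gap_level_nonneg hc h (hG.trans hx.le)) hG hx.le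
  · have hcI : cI ≤ c := by
      by_contra! h
      linarith [h1 h, M.bd.Fb_lt_level ⟨hc.1, h⟩]
    have key : cI ≤ α / (2 * lam) - (x - c) → 0 < α / (2 * lam) - (x - c) →
        0 ≤ gap α δ lam c x := by
      intro k1 k2
      have hcc : α / (2 * lam) - (x - c) ≤ c := by linarith
      have hm := M.bd.diag_strictMonoOn.monotoneOn ⟨k2, hcc.trans hc.2⟩ hc hcc
      have k3 := M.gap_level_nonneg ⟨k2, hcc.trans hc.2⟩ k1 (by linarith)
      have := M.gap_diag (y := x - c) hcc (by linarith) (by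
        rw [show x - c + (α / (2 * lam) - (x - c)) = α / (2 * lam) by ring]; exact k3)
      rwa [sub_add_cancel] at this
    rcases M.bd.cI_nonneg.eq_or_lt with hI | hI
    · rcases lt_or_ge (x - c) (α / (2 * lam)) with h | h
      · exact key (by linarith) (by linarith)
      · have hp := M.diag_pos hc
        have := M.gap_diag (y := x - c) hc.1.le (by linarith) (by
          rw [add_zero]; exact (M.reg.gap_zero_pos (by linarith) (h3 hI.symm)).le)
        rwa [sub_add_cancel] at this
    · have := h2 hcI hI
      exact key (by linarith) (by linarith)

theorem gap_nonneg_top {x c : ℝ} (hc : cbar ≤ c) (hy : G cbar - cbar ≤ x - c)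
    (h2 : 0 < cI → x - c ≤ α / (2 * lam) - cI) (h3 : cI = 0 → x - c ≤ f0 α δ lam) :
    0 ≤ gap α δ lam c x := by
  have hcI := M.bd.cI_lt_cbar
  have h := M.gap_nonneg (x := x - c + cbar) (c := cbar) ⟨M.bd.cbar_pos, le_rfl⟩ (by linarith)
    (fun h => absurd hcI (not_lt.2 h.le)) (fun _ hI => by linarith [h2 hI])
    (fun hI => by linarith [h3 hI])
  have := M.gap_diag (y := x - c) hc (by linarith [M.bd.level_le_G le_rfl]) h
  rwa [sub_add_cancel] at this

end Model

end

section

/-! ### Continuous differentiability of `Q` -/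

theorem dense_off_graphs {E : Set ℝ} (hE : E.Countable) {N : ℝ → Set ℝ}
    (hN : ∀ c, (N c).Countable) : Dense {z : ℝ × ℝ | z.2 ∉ E ∧ z.1 ∉ N z.2} := by
  intro z
  refine mem_closure_iff_nhds.2 fun V hV => ?_
  obtain ⟨U₁, hU₁, U₂, hU₂, hsub⟩ := mem_nhds_prod_iff.1 hV
  obtain ⟨c, hc1, hc2⟩ := (hE.dense_compl ℝ).inter_nhds_nonempty hU₂
  obtain ⟨x, hx1, hx2⟩ := ((hN c).dense_compl ℝ).inter_nhds_nonempty hU₁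
  exact ⟨(x, c), hsub ⟨hx2, hc2⟩, hc1, hx1⟩

theorem contDiffAt_of_rep {Q : ℝ → ℝ → ℝ} {φ : ℝ → ℝ} {x c : ℝ}
    (h : ∀ᶠ p : ℝ × ℝ in 𝓝 (x, c), Q p.1 p.2 = φ (p.1 - p.2) + p.2)
    (hφ : ContDiffAt ℝ 1 φ (x - c)) :
    ContDiffAt ℝ 1 (fun p : ℝ × ℝ => Q p.1 p.2) (x, c) := by
  have : ContDiffAt ℝ 1 (fun p : ℝ × ℝ => φ (p.1 - p.2) + p.2) (x, c) :=
    (ContDiffAt.comp (f := fun p : ℝ × ℝ => p.1 - p.2) (x, c) hφ (by fun_prop)).add (by fun_prop)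
  exact this.congr_of_eventuallyEq h

theorem grad_of_slices {f : ℝ × ℝ → ℝ} {x c a b : ℝ} (h : ContDiffAt ℝ 1 f (x, c))
    (ha : HasDerivAt (fun y => f (y, c)) a x) (hb : HasDerivAt (fun d => f (x, d)) b c) :
    fderiv ℝ f (x, c) (1, 0) = a ∧ fderiv ℝ f (x, c) (0, 1) = b :=
  ⟨(hasDerivAt_fst_slice h).unique ha, (hasDerivAt_snd_slice h).unique hb⟩

theorem slices_of_rep {Q : ℝ → ℝ → ℝ} {φ : ℝ → ℝ} {x c : ℝ}
    (h : ∀ᶠ p : ℝ × ℝ in 𝓝 (x, c), Q p.1 p.2 = φ (p.1 - p.2) + p.2)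
    (hφ : DifferentiableAt ℝ φ (x - c)) :
    HasDerivAt (fun y => Q y c) (deriv φ (x - c)) x ∧
      HasDerivAt (fun d => Q x d) (1 - deriv φ (x - c)) c := by
  have h1 : ∀ᶠ z in 𝓝 x, Q z c = φ (z - c) + c :=
    (Continuous.tendsto (by fun_prop : Continuous fun z : ℝ => (z, c)) x).eventually h
  have h2 : ∀ᶠ d in 𝓝 c, Q x d = φ (x - d) + d :=
    (Continuous.tendsto (by fun_prop : Continuous fun d : ℝ => (x, d)) c).eventually h
  constructor
  · exact ((hφ.hasDerivAt.comp_sub_const x c).add_const c).congr_of_eventuallyEq h1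
  · have k := (hφ.hasDerivAt.comp_const_sub x c).add (hasDerivAt_id c)
    exact (k.congr_of_eventuallyEq h2).congr_deriv (by ring)

theorem grad_of_rep {Q : ℝ → ℝ → ℝ} {φ : ℝ → ℝ} {x c : ℝ}
    (h : ∀ᶠ p : ℝ × ℝ in 𝓝 (x, c), Q p.1 p.2 = φ (p.1 - p.2) + p.2)
    (hφ : ContDiffAt ℝ 1 φ (x - c)) :
    fderiv ℝ (fun p : ℝ × ℝ => Q p.1 p.2) (x, c) (1, 0) = deriv φ (x - c) ∧
      fderiv ℝ (fun p : ℝ × ℝ => Q p.1 p.2) (x, c) (0, 1) = 1 - deriv φ (x - c) := by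
  have hs := slices_of_rep h (hφ.differentiableAt (by norm_num))
  exact grad_of_slices (contDiffAt_of_rep h hφ) hs.1 hs.2

theorem eventually_snd {x c : ℝ} {U : Set ℝ} (hU : U ∈ 𝓝 c) :
    ∀ᶠ p : ℝ × ℝ in 𝓝 (x, c), p.2 ∈ U := (continuous_snd.tendsto (x, c)).eventually hU

theorem contDiffAt_sol_curve {α δ lam : ℝ} {t z : ℝ → ℝ} {x c : ℝ} (ht : ContDiffAt ℝ 1 t c)
    (hz : ContDiffAt ℝ 1 z c) :
    ContDiffAt ℝ 1 (fun p : ℝ × ℝ => sol α δ lam (t p.2) (z p.2) p.1) (x, c) := by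
  have h1 : ContDiffAt ℝ 1 (fun p : ℝ × ℝ => t p.2) (x, c) :=
    ContDiffAt.comp (f := Prod.snd) (x, c) ht contDiffAt_snd
  have h2 : ContDiffAt ℝ 1 (fun p : ℝ × ℝ => z p.2) (x, c) :=
    ContDiffAt.comp (f := Prod.snd) (x, c) hz contDiffAt_snd
  exact ContDiffAt.comp (f := fun p : ℝ × ℝ => (t p.2, z p.2, p.1)) (x, c)
    ((contDiff_sol (α := α) (δ := δ) (lam := lam)).contDiffAt.of_le (by norm_num))
    (h1.prodMk (h2.prodMk contDiffAt_fst))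

namespace Model

variable {α δ lam cI cbar g0 : ℝ} {F G Fb Gb : ℝ → ℝ} {Q : ℝ → ℝ → ℝ}
  (M : Model α δ lam cI cbar g0 F G Fb Gb Q)

include M

theorem eventually_G_lt {x c : ℝ} (hc : 0 < c) (h : G c < x) :
    ∀ᶠ p : ℝ × ℝ in 𝓝 (x, c), G p.2 < p.1 :=
  ((M.bd.G_continuousAt hc).comp' (f := Prod.snd) continuous_snd.continuousAt).eventually_lt
    continuous_fst.continuousAt h

theorem eventually_lt_G {x c : ℝ} (hc : 0 < c) (h : x < G c) :
    ∀ᶠ p : ℝ × ℝ in 𝓝 (x, c), p.1 < G p.2 :=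
  continuous_fst.continuousAt.eventually_lt
    ((M.bd.G_continuousAt hc).comp' (f := Prod.snd) continuous_snd.continuousAt) h

theorem eventually_F_lt {x c : ℝ} (hc : 0 < c) (h : F c < x) :
    ∀ᶠ p : ℝ × ℝ in 𝓝 (x, c), F p.2 < p.1 :=
  ((M.bd.F_continuousAt hc).comp' (f := Prod.snd) continuous_snd.continuousAt).eventually_lt
    continuous_fst.continuousAt h

theorem eventually_lt_F {x c : ℝ} (hc : 0 < c) (h : x < F c) :
    ∀ᶠ p : ℝ × ℝ in 𝓝 (x, c), p.1 < F p.2 :=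
  continuous_fst.continuousAt.eventually_lt
    ((M.bd.F_continuousAt hc).comp' (f := Prod.snd) continuous_snd.continuousAt) h

theorem eventually_Fb_lt {x c : ℝ} (hc : c ∈ Ioo 0 cI) (h : Fb c < x) :
    ∀ᶠ p : ℝ × ℝ in 𝓝 (x, c), Fb p.2 < p.1 :=
  ((M.bd.Fb_hasDerivAt hc).continuousAt.comp' (f := Prod.snd)
    continuous_snd.continuousAt).eventually_lt continuous_fst.continuousAt h

theorem eventually_lt_Gb {x c : ℝ} (hc : c ∈ Ioo 0 cI) (h : x < Gb c) :
    ∀ᶠ p : ℝ × ℝ in 𝓝 (x, c), p.1 < Gb p.2 :=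
  continuous_fst.continuousAt.eventually_lt
    ((M.bd.Gb_hasDerivAt hc).continuousAt.comp' (f := Prod.snd) continuous_snd.continuousAt) h

theorem eventually_eq_I {x c : ℝ} (hx : 0 < x) (hc : 0 < c) (h : x < F c) :
    ∀ᶠ p : ℝ × ℝ in 𝓝 (x, c), Q p.1 p.2 = δ * p.1 ^ 2 := by
  filter_upwards [M.eventually_lt_F hc h, eventually_snd (lt_mem_nhds hc),
    (continuous_fst.tendsto (x, c)).eventually (lt_mem_nhds hx)] with p k1 k2 k3
  exact M.cand.onI p.1 p.2 ⟨k2, le_of_lt k3, k1.le⟩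

theorem eventually_eq_II {x c : ℝ} (hc : 0 < c) (h1 : F c < x) (h2 : x < G c) :
    ∀ᶠ p : ℝ × ℝ in 𝓝 (x, c), Q p.1 p.2 = sol α δ lam 0 (F p.2) p.1 := by
  filter_upwards [M.eventually_F_lt hc h1, M.eventually_lt_G hc h2,
    eventually_snd (lt_mem_nhds hc)] with p k1 k2 k3
  exact M.eq_on_II k3 k1.le k2.le

theorem eventually_eq_III {x c : ℝ} (hc : c ∈ Ioo 0 cI) (h1 : Fb c < x) (h2 : x < Gb c) :
    ∀ᶠ p : ℝ × ℝ in 𝓝 (x, c), Q p.1 p.2 = sol α δ lam p.2 (Fb p.2) p.1 := by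
  filter_upwards [M.eventually_Fb_lt hc h1, M.eventually_lt_Gb hc h2,
    eventually_snd (isOpen_Ioo.mem_nhds hc)] with p k1 k2 k3
  exact M.eq_on_III k3 k1.le k2.le

theorem contDiffAt_I {x c : ℝ} (hx : 0 < x) (hc : 0 < c) (h : x < F c) :
    ContDiffAt ℝ 1 (fun p : ℝ × ℝ => Q p.1 p.2) (x, c) :=
  ContDiffAt.congr_of_eventuallyEq (by fun_prop) (M.eventually_eq_I hx hc h)

theorem contDiffAt_II {x c : ℝ} (hc : 0 < c) (h1 : F c < x) (h2 : x < G c) :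
    ContDiffAt ℝ 1 (fun p : ℝ × ℝ => Q p.1 p.2) (x, c) :=
  (contDiffAt_sol_curve (t := fun _ => 0) contDiffAt_const
    (M.F_contDiffAt hc).1).congr_of_eventuallyEq (M.eventually_eq_II hc h1 h2)

theorem contDiffAt_III {x c : ℝ} (hc : c ∈ Ioo 0 cI) (h1 : Fb c < x) (h2 : x < Gb c) :
    ContDiffAt ℝ 1 (fun p : ℝ × ℝ => Q p.1 p.2) (x, c) :=
  (contDiffAt_sol_curve (t := id) contDiffAt_id
    (M.bd.Fb_contDiffAt hc)).congr_of_eventuallyEq (M.eventually_eq_III hc h1 h2)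

theorem slices_II {x c : ℝ} (hc : 0 < c) (h1 : F c < x) (h2 : x < G c) :
    HasDerivAt (fun y => Q y c) (solX α δ lam 0 (F c) x) x ∧
      HasDerivAt (fun d => Q x d) (solC α δ lam 0 (F c) 0 (vel α δ lam F G c) x) c := by
  have h := M.eventually_eq_II hc h1 h2
  constructor
  · exact (hasDerivAt_sol M.reg 0 (F c) x).congr_of_eventuallyEq
      ((Continuous.tendsto (by fun_prop : Continuous fun z : ℝ => (z, c)) x).eventually h)
  · have := hasDerivAt_sol_curve M.reg (hasDerivAt_const c 0) (M.F_hasDerivAt_vel hc)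
      (hasDerivAt_const c x)
    rw [mul_zero, add_zero] at this
    exact this.congr_of_eventuallyEq
      ((Continuous.tendsto (by fun_prop : Continuous fun d : ℝ => (x, d)) c).eventually h)

theorem slices_III {x c : ℝ} (hc : c ∈ Ioo 0 cI) (h1 : Fb c < x) (h2 : x < Gb c) :
    HasDerivAt (fun y => Q y c) (solX α δ lam c (Fb c) x) x ∧
      HasDerivAt (fun d => Q x d) (solC α δ lam c (Fb c) 1 (deriv Fb c) x) c := by
  have h := M.eventually_eq_III hc h1 h2
  constructor
  · exact (hasDerivAt_sol M.reg c (Fb c) x).congr_of_eventuallyEq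
      ((Continuous.tendsto (by fun_prop : Continuous fun z : ℝ => (z, c)) x).eventually h)
  · have := hasDerivAt_sol_curve M.reg (hasDerivAt_id c) (M.bd.Fb_hasDerivAt hc)
      (hasDerivAt_const c x)
    rw [mul_zero, add_zero] at this
    exact this.congr_of_eventuallyEq
      ((Continuous.tendsto (by fun_prop : Continuous fun d : ℝ => (x, d)) c).eventually h)

theorem contDiffAt_F {c : ℝ} (hc : 0 < c) :
    ContDiffAt ℝ 1 (fun p : ℝ × ℝ => Q p.1 p.2) (F c, c) := by
  have hF := M.bd.F_pos c hc.le
  refine contDiffAt_glue (g := F) (f₁ := fun p => δ * p.1 ^ 2)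
    (f₂ := fun p => sol α δ lam 0 (F p.2) p.1) rfl ?_ (by fun_prop)
    (contDiffAt_sol_curve (t := fun _ => 0) contDiffAt_const (M.F_contDiffAt hc).1) ?_ ?_ ?_
  · filter_upwards [lt_mem_nhds hc] with d hd using (M.F_hasDerivAt_vel hd).differentiableAt
  · filter_upwards [eventually_snd (lt_mem_nhds hc),
      (continuous_fst.tendsto (F c, c)).eventually (lt_mem_nhds hF)] with p k2 k3 k1
    exact M.cand.onI p.1 p.2 ⟨k2, le_of_lt k3, k1⟩
  · filter_upwards [eventually_snd (lt_mem_nhds hc),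
      M.eventually_lt_G hc (M.bd.F_lt_G hc)] with p k2 k3 k1
    exact M.eq_on_II k2 k1 k3.le
  · filter_upwards with d
    rw [(hasDerivAt_sq_mul (F d)).deriv, (hasDerivAt_sol M.reg 0 (F d) (F d)).deriv]
    simp

theorem contDiffAt_Fb {c : ℝ} (hc : c ∈ Ioo 0 cI) :
    ContDiffAt ℝ 1 (fun p : ℝ × ℝ => Q p.1 p.2) (Fb c, c) := by
  refine contDiffAt_glue (g := Fb) (f₁ := fun p => δ * (p.1 - p.2) ^ 2 + p.2)
    (f₂ := fun p => sol α δ lam p.2 (Fb p.2) p.1) rfl ?_ (by fun_prop)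
    (contDiffAt_sol_curve (t := id) contDiffAt_id (M.bd.Fb_contDiffAt hc)) ?_ ?_ ?_
  · filter_upwards [isOpen_Ioo.mem_nhds hc] with d hd using (M.bd.Fb_hasDerivAt hd).differentiableAt
  · filter_upwards [eventually_snd (isOpen_Ioo.mem_nhds hc),
      M.eventually_G_lt hc.1 (M.bd.G_lt_Fb c ⟨hc.1, hc.2.le⟩)] with p k2 k3 k1
    exact M.lower_eq ⟨k2.1, k2.2.le⟩ k3.le k1
  · filter_upwards [eventually_snd (isOpen_Ioo.mem_nhds hc),
      M.eventually_lt_Gb hc (M.bd.Fb_lt_Gb hc)] with p k2 k3 k1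
    exact M.eq_on_III k2 k1 k3.le
  · filter_upwards with d
    rw [(hasDerivAt_sq_shift d (Fb d)).deriv, (hasDerivAt_sol M.reg d (Fb d) (Fb d)).deriv]
    simp

theorem contDiffAt_profile_Gb {c : ℝ} (hc : c ∈ Ioo 0 cI) {x : ℝ} (hx : Gb c ≤ x) :
    ContDiffAt ℝ 1 (profile Q cI) (x - c) := by
  have h1 := M.bd.level_lt_Gb hc
  have hI := hc.1.trans hc.2
  have h2 := M.bd.diag_cI_lt hI
  have h3 := M.bd.half_lt_level_sub hI
  have hδ : 0 < 1 / (2 * δ) := by have := M.reg.δ_pos; positivity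
  exact M.contDiffAt_profile (fun _ => by linarith [hc.2]) (by linarith [hc.2])

theorem contDiffAt_Gb {c : ℝ} (hc : c ∈ Ioo 0 cI) :
    ContDiffAt ℝ 1 (fun p : ℝ × ℝ => Q p.1 p.2) (Gb c, c) := by
  have hφ : ∀ d ∈ Ioo 0 cI, ContDiffAt ℝ 1 (profile Q cI) (Gb d - d) :=
    fun d hd => M.contDiffAt_profile_Gb hd le_rfl
  refine contDiffAt_glue (g := Gb) (f₁ := fun p => sol α δ lam p.2 (Fb p.2) p.1)
    (f₂ := fun p => profile Q cI (p.1 - p.2) + p.2) rfl ?_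
    (contDiffAt_sol_curve (t := id) contDiffAt_id (M.bd.Fb_contDiffAt hc))
    ((ContDiffAt.comp (f := fun p : ℝ × ℝ => p.1 - p.2) (Gb c, c) (hφ c hc) (by fun_prop)).add
      (by fun_prop)) ?_ ?_ ?_
  · filter_upwards [isOpen_Ioo.mem_nhds hc] with d hd using (M.bd.Gb_hasDerivAt hd).differentiableAt
  · filter_upwards [eventually_snd (isOpen_Ioo.mem_nhds hc),
      M.eventually_Fb_lt hc (M.bd.Fb_lt_Gb hc)] with p k2 k3 k1
    exact M.eq_on_III k2 k3.le k1
  · filter_upwards [eventually_snd (isOpen_Ioo.mem_nhds hc)] with p k2 k1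
    exact M.upper_eq_of_lt k2 k1
  · filter_upwards [isOpen_Ioo.mem_nhds hc] with d hd
    have hd' := ((hφ d hd).differentiableAt (by norm_num)).hasDerivAt
    rw [(hasDerivAt_sol M.reg d (Fb d) (Gb d)).deriv,
      ((hd'.comp_sub_const (Gb d) d).add_const d).deriv, (M.inherits_Gb hd).slope]
    simp

/-- The common gluing step for the three kinds of profile found above G: the square, the profile at
level cI, and the trace of G above c̄. -/
theorem contDiffAt_G_of_rep {φ : ℝ → ℝ} {c : ℝ} (hc : 0 < c) (hne : c ≠ cbar)
    (hφ : ContDiffAt ℝ 1 φ (G c - c))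
    (hrep : ∀ᶠ p : ℝ × ℝ in 𝓝 (G c, c), G p.2 ≤ p.1 → Q p.1 p.2 = φ (p.1 - p.2) + p.2)
    (hsl : ∀ᶠ d in 𝓝 c, solX α δ lam 0 (F d) (G d) = deriv φ (G d - d)) :
    ContDiffAt ℝ 1 (fun p : ℝ × ℝ => Q p.1 p.2) (G c, c) := by
  have hGc := M.bd.G_contDiffAt hc hne
  refine contDiffAt_glue (g := G) (f₁ := fun p => sol α δ lam 0 (F p.2) p.1)
    (f₂ := fun p => φ (p.1 - p.2) + p.2) rfl ?_
    (contDiffAt_sol_curve (t := fun _ => 0) contDiffAt_const (M.F_contDiffAt hc).1)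
    ((ContDiffAt.comp (f := fun p : ℝ × ℝ => p.1 - p.2) (G c, c) hφ (by fun_prop)).add
      (by fun_prop)) ?_ hrep ?_
  · filter_upwards [hGc.eventually (by norm_num)] with d hd using hd.differentiableAt (by norm_num)
  · filter_upwards [eventually_snd (lt_mem_nhds hc),
      M.eventually_F_lt hc (M.bd.F_lt_G hc)] with p k2 k3 k1
    exact M.eq_on_II k2 k3.le k1
  · have ht : Tendsto (fun d => G d - d) (𝓝 c) (𝓝 (G c - c)) :=
      hGc.continuousAt.tendsto.sub tendsto_id
    filter_upwards [hsl, ht.eventually (hφ.eventually (by norm_num))] with d hd hd2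
    have hd' := (hd2.differentiableAt (by norm_num)).hasDerivAt
    rw [(hasDerivAt_sol M.reg 0 (F d) (G d)).deriv,
      ((hd'.comp_sub_const (G d) d).add_const d).deriv, hd]

theorem contDiffAt_G {c : ℝ} (hc : 0 < c) (hne : c ≠ cbar) :
    ContDiffAt ℝ 1 (fun p : ℝ × ℝ => Q p.1 p.2) (G c, c) := by
  have hGc := M.bd.G_continuousAt hc
  rcases lt_or_gt_of_ne hne with hcb | hcb
  · rcases le_or_gt c cI with h | h
    · have hcm : c ∈ Ioc 0 cI := ⟨hc, h⟩
      have hlev := M.G_lt_level_of_le hcm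
      have hI : 0 < cI := hc.trans_le h
      refine M.contDiffAt_G_of_rep (φ := fun y => δ * y ^ 2) hc hne (by fun_prop) ?_ ?_
      · have hdl : G c - c < α / (2 * lam) - c := by linarith
        have e4 : ∀ᶠ p : ℝ × ℝ in 𝓝 (G c, c), p.2 ≤ cI → p.1 < Fb p.2 := by
          rcases h.eq_or_lt with rfl | h
          · obtain ⟨m, hm1, hm2⟩ := exists_between hlev
            have h1 : ∀ᶠ d in 𝓝[Ioc 0 c] c, m < Fb d :=
              (M.bd.Fb_cont c hcm).tendsto.eventually (lt_mem_nhds (by rwa [M.bd.Fb_end hI]))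
            filter_upwards [eventually_snd (eventually_nhdsWithin_iff.1 h1),
              eventually_snd (lt_mem_nhds hc),
              (continuous_fst.tendsto (G c, c)).eventually (gt_mem_nhds hm1)] with p k1 k2 k3 k4
            exact lt_trans k3 (k1 ⟨k2, k4⟩)
          · have := continuous_fst.continuousAt.eventually_lt
              ((M.bd.Fb_hasDerivAt ⟨hc, h⟩).continuousAt.comp' (f := Prod.snd) (x := (G c, c))
                continuous_snd.continuousAt) (M.bd.G_lt_Fb c hcm)
            exact this.mono fun p hp _ => hp
        have e5 : ∀ᶠ p : ℝ × ℝ in 𝓝 (G c, c), cI < p.2 → p.1 - p.2 < α / (2 * lam) - cI := by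
          rcases h.eq_or_lt with rfl | h
          · exact ((Continuous.tendsto (by fun_prop : Continuous fun p : ℝ × ℝ => p.1 - p.2)
              (G c, c)).eventually (gt_mem_nhds hdl)).mono fun p hp _ => hp
          · exact (eventually_snd (gt_mem_nhds h)).mono fun p hp hp' =>
              absurd hp' (not_lt.2 (le_of_lt hp))
        filter_upwards [eventually_snd (isOpen_Ioo.mem_nhds ⟨hc, hcb⟩), e4, e5] with p k1 k2 k3 k4
        rcases le_or_gt p.2 cI with h' | h'
        · exact M.lower_eq ⟨k1.1, h'⟩ k4 (k2 h').le
        · rw [M.upper_eq k1.1 h'.le k4 (Or.inl k1.2.le),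
            M.profile_inner hI (by linarith [M.diag_gt_cI hI ⟨h', k1.2.le⟩]) (k3 h').le]
      · filter_upwards [isOpen_Ioo.mem_nhds ⟨hc, hcb⟩, hGc.eventually_lt continuousAt_const hlev]
          with d d1 d2
        rw [M.solX_G_of_lt_level ⟨d1.1, d1.2.le⟩ d2, (hasDerivAt_sq_mul _).deriv]
    · have hop : Ioo cI cbar ∈ 𝓝 c := isOpen_Ioo.mem_nhds ⟨h, hcb⟩
      refine M.contDiffAt_G_of_rep (φ := profile Q cI) hc hne
        (M.contDiffAt_profile_diag ⟨h, hcb.le⟩) ?_ ?_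
      · filter_upwards [eventually_snd hop] with p k1 k2
        exact M.upper_eq (M.bd.cI_nonneg.trans_lt k1.1) k1.1.le k2 (Or.inl k1.2.le)
      · filter_upwards [hop] with d hd using M.solX_G_upper ⟨hd.1, hd.2.le⟩
  -- Above c̄ the diagonals from G are read off at a higher level; any level beyond c will do, and c
  -- + 1 is chosen.
  · have hop : Ioo cbar (c + 1) ∈ 𝓝 c := isOpen_Ioo.mem_nhds ⟨hcb, lt_add_one c⟩
    have hm : c ∈ Ioo cbar (c + 1) := ⟨hcb, lt_add_one c⟩
    refine M.contDiffAt_G_of_rep (φ := profile Q (c + 1)) hc hne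
      ((M.inherits_G hm).contDiffAt.of_le (by norm_num)) ?_ ?_
    · filter_upwards [eventually_snd hop] with p k1 k2 using M.top_eq k1.1.le k1.2.le k2
    · filter_upwards [hop] with d hd
      rw [(M.inherits_G hd).slope]; simp

theorem contDiffAt_profile_mid {x c : ℝ} (hc : c ∈ Ioc cI cbar) (hG : G c ≤ x) :
    ContDiffAt ℝ 1 (profile Q cI) (x - c) := by
  have h0 := M.bd.cI_nonneg.trans_lt hc.1
  have := M.diag_pos ⟨h0, hc.2⟩
  exact M.contDiffAt_profile (fun hI => by linarith [M.diag_gt_cI hI hc]) (by linarith)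

theorem contDiffAt_profile_top' {x c : ℝ} (hc : cbar < c) (hG : G c ≤ x) :
    ContDiffAt ℝ 1 (profile Q (c + 1)) (x - c) := by
  refine M.contDiffAt_profile_top (by linarith) ?_
  have := M.bd.diag_strictAntiOn hc.le (show cbar ≤ c + 1 by linarith) (lt_add_one c)
  simp only at this
  linarith

/-- On the interior of region IV, `Q` is locally transported along the diagonals. -/
theorem exists_rep {x c : ℝ} (hc : 0 < c) (hG : G c < x)
    (h1 : c < cI → x < Fb c ∨ Gb c < x) (h2 : c = cI → x ≠ α / (2 * lam)) :
    ∃ φ : ℝ → ℝ, ContDiffAt ℝ 1 φ (x - c) ∧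
      ∀ᶠ p : ℝ × ℝ in 𝓝 (x, c), Q p.1 p.2 = φ (p.1 - p.2) + p.2 := by
  rcases lt_trichotomy c cI with h | h | h
  · rcases h1 h with h1 | h1
    · exact ⟨fun y => δ * y ^ 2, by fun_prop, M.rep_lower ⟨hc, h⟩ hG h1⟩
    · exact ⟨_, M.contDiffAt_profile_Gb ⟨hc, h⟩ h1.le, M.rep_upper_lt ⟨hc, h⟩ h1⟩
  · subst h
    rcases lt_or_gt_of_ne (h2 rfl) with h | h
    · exact ⟨fun y => δ * y ^ 2, by fun_prop, M.rep_lower_end hc hG h⟩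
    · refine ⟨_, M.contDiffAt_profile (fun _ => by linarith) ?_, M.rep_upper_end hc h⟩
      have := M.diag_pos ⟨hc, M.bd.cI_lt_cbar.le⟩
      linarith
  · rcases le_or_gt c cbar with hb | hb
    · exact ⟨_, M.contDiffAt_profile_mid ⟨h, hb⟩ hG.le, M.rep_mid ⟨h, hb⟩ hG⟩
    · exact ⟨_, M.contDiffAt_profile_top' hb hG.le, M.rep_top hb (lt_add_one c) hG⟩

theorem contDiffAt_IV {x c : ℝ} (hc : 0 < c) (hG : G c < x)
    (h1 : c < cI → x < Fb c ∨ Gb c < x) (h2 : c = cI → x ≠ α / (2 * lam)) :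
    ContDiffAt ℝ 1 (fun p : ℝ × ℝ => Q p.1 p.2) (x, c) := by
  obtain ⟨φ, a, b⟩ := M.exists_rep hc hG h1 h2
  exact contDiffAt_of_rep b a

theorem contDiffAt_of_ne {x c : ℝ} (hx : 0 < x) (hc : 0 < c) (h1 : (x, c) ≠ (G cbar, cbar))
    (h2 : (x, c) ≠ (α / (2 * lam), cI)) :
    ContDiffAt ℝ 1 (fun p : ℝ × ℝ => Q p.1 p.2) (x, c) := by
  rcases lt_trichotomy x (F c) with h | rfl | h
  · exact M.contDiffAt_I hx hc h
  · exact M.contDiffAt_F hc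
  rcases lt_trichotomy x (G c) with h' | rfl | h'
  · exact M.contDiffAt_II hc h h'
  · refine M.contDiffAt_G hc fun h => h1 (by rw [h])
  rcases lt_or_ge c cI with hcI | hcI
  · have hcm : c ∈ Ioo 0 cI := ⟨hc, hcI⟩
    rcases lt_trichotomy x (Fb c) with k | rfl | k
    · exact M.contDiffAt_IV hc h' (fun _ => Or.inl k) fun e => absurd e hcI.ne
    · exact M.contDiffAt_Fb hcm
    rcases lt_trichotomy x (Gb c) with k' | rfl | k'
    · exact M.contDiffAt_III hcm k k'
    · exact M.contDiffAt_Gb hcm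
    · exact M.contDiffAt_IV hc h' (fun _ => Or.inr k') fun e => absurd e hcI.ne
  · exact M.contDiffAt_IV hc h' (fun e => absurd e (not_lt.2 hcI)) fun e hx => h2 (by rw [e, hx])

end Model

end

/-! ### The two exceptional points of the boundaries -/

section

/-- The pair of partial derivatives of `Q`. -/
def grad (Q : ℝ → ℝ → ℝ) (z : ℝ × ℝ) : ℝ × ℝ :=
  (fderiv ℝ (fun p : ℝ × ℝ => Q p.1 p.2) z (1, 0), fderiv ℝ (fun p : ℝ × ℝ => Q p.1 p.2) z (0, 1))

theorem tendsto_grad_of_rep {Q : ℝ → ℝ → ℝ} {φ : ℝ → ℝ} {x c : ℝ} {S : Set (ℝ × ℝ)}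
    (h : ∀ᶠ z in 𝓝[S] (x, c), ∀ᶠ p : ℝ × ℝ in 𝓝 z, Q p.1 p.2 = φ (p.1 - p.2) + p.2)
    (hφ : ContDiffAt ℝ 1 φ (x - c)) :
    Tendsto (grad Q) (𝓝[S] (x, c)) (𝓝 (deriv φ (x - c), 1 - deriv φ (x - c))) := by
  have hsub : Tendsto (fun z : ℝ × ℝ => z.1 - z.2) (𝓝[S] (x, c)) (𝓝 (x - c)) :=
    (Continuous.tendsto (by fun_prop : Continuous fun z : ℝ × ℝ => z.1 - z.2) (x, c)).mono_left
      nhdsWithin_le_nhds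
  have hd := (continuousAt_deriv_of_contDiffAt hφ).tendsto.comp hsub
  refine (hd.prodMk_nhds (hd.const_sub 1)).congr' ?_
  filter_upwards [h, hsub.eventually (hφ.eventually (by norm_num))] with z h1 h2
  have := grad_of_rep (x := z.1) (c := z.2) h1 h2
  exact (Prod.ext this.1 this.2).symm

theorem contDiffAt_of_tendsto_grad {Q : ℝ → ℝ → ℝ} {p : ℝ × ℝ} {S : Set (ℝ × ℝ)} {v : ℝ × ℝ}
    (hc : ContinuousAt (fun p : ℝ × ℝ => Q p.1 p.2) p)
    (h : ∀ᶠ z in 𝓝[≠] p, ContDiffAt ℝ 1 (fun p : ℝ × ℝ => Q p.1 p.2) z)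
    (hS : ∀ᶠ z in 𝓝[≠] p, z ∈ closure S) (hv : Tendsto (grad Q) (𝓝[S] p) (𝓝 v)) :
    ContDiffAt ℝ 1 (fun p : ℝ × ℝ => Q p.1 p.2) p :=
  contDiffAt_of_punctured hc h hS ((continuous_fst.tendsto v).comp hv)
    ((continuous_snd.tendsto v).comp hv)

theorem tendsto_solX {α δ lam : ℝ} {ι : Type*} {l : Filter ι} {t z x : ι → ℝ} {t₀ z₀ x₀ : ℝ}
    (ht : Tendsto t l (𝓝 t₀)) (hz : Tendsto z l (𝓝 z₀)) (hx : Tendsto x l (𝓝 x₀)) :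
    Tendsto (fun i => solX α δ lam (t i) (z i) (x i)) l (𝓝 (solX α δ lam t₀ z₀ x₀)) :=
  Tendsto.comp (g := fun p : ℝ × ℝ × ℝ => solX α δ lam p.1 p.2.1 p.2.2)
    (f := fun i => (t i, z i, x i)) (continuous_solX.tendsto (t₀, z₀, x₀))
    (ht.prodMk_nhds (hz.prodMk_nhds hx))

namespace Model

variable {α δ lam cI cbar g0 : ℝ} {F G Fb Gb : ℝ → ℝ} {Q : ℝ → ℝ → ℝ}
  (M : Model α δ lam cI cbar g0 F G Fb Gb Q)

include M

theorem grad_II {x c : ℝ} (hc : 0 < c) (h1 : F c < x) (h2 : x < G c) :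
    grad Q (x, c) = (solX α δ lam 0 (F c) x, solC α δ lam 0 (F c) 0 (vel α δ lam F G c) x) := by
  have hs := M.slices_II hc h1 h2
  have := grad_of_slices (M.contDiffAt_II hc h1 h2) hs.1 hs.2
  exact Prod.ext this.1 this.2

theorem grad_III {x c : ℝ} (hc : c ∈ Ioo 0 cI) (h1 : Fb c < x) (h2 : x < Gb c) :
    grad Q (x, c) = (solX α δ lam c (Fb c) x, solC α δ lam c (Fb c) 1 (deriv Fb c) x) := by
  have hs := M.slices_III hc h1 h2
  have := grad_of_slices (M.contDiffAt_III hc h1 h2) hs.1 hs.2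
  exact Prod.ext this.1 this.2

theorem deriv_profile_top {C₀ : ℝ} (hC : cbar < C₀) :
    deriv (profile Q C₀) (G cbar - cbar) = deriv (profile Q cI) (G cbar - cbar) := by
  have h1 := M.contDiffAt_profile_top hC (y := G cbar - cbar)
    (M.bd.diag_strictAntiOn self_mem_Ici hC.le hC)
  have h2 := M.contDiffAt_profile_diag ⟨M.bd.cI_lt_cbar, le_rfl⟩
  have e1 := (h1.differentiableAt (by norm_num)).hasDerivAt.hasDerivWithinAt
    (s := Ici (G cbar - cbar))
  have e2 := (h2.differentiableAt (by norm_num)).hasDerivAt.hasDerivWithinAt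
    (s := Ici (G cbar - cbar))
  refine (uniqueDiffWithinAt_Ici _).eq_deriv _ e1 (e2.congr ?_ ?_)
  · exact fun y hy => M.profile_top_eq hC.le hy
  · exact M.profile_top_eq hC.le le_rfl

/-- G may have a kink here, so gluing is unavailable. The gradient limits from II and from both
parts of IV coincide: SF1 at c̄ matches Q_x, D = 1 then matches Q_c, and the velocity of F is
continuous at c̄. -/
theorem contDiffAt_corner :
    ContDiffAt ℝ 1 (fun p : ℝ × ℝ => Q p.1 p.2) (G cbar, cbar) := by
  have hb := M.bd.cbar_pos
  have hG := M.bd.G_pos cbar hb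
  have hIb := M.bd.cI_lt_cbar
  have hs := M.solX_G_upper ⟨hIb, le_rfl⟩
  have hC : cbar < cbar + 1 := lt_add_one _
  have hpos : ∀ᶠ z : ℝ × ℝ in 𝓝 (G cbar, cbar), 0 < z.1 ∧ 0 < z.2 :=
    ((continuous_fst.tendsto (G cbar, cbar)).eventually (lt_mem_nhds hG)).and
      (eventually_snd (lt_mem_nhds hb))
  refine contDiffAt_of_tendsto_grad
    (S := {z | z.1 < G z.2} ∪ ({z | G z.2 < z.1 ∧ z.2 ≤ cbar} ∪ {z | G z.2 < z.1 ∧ cbar < z.2}))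
    (v := (deriv (profile Q cI) (G cbar - cbar), 1 - deriv (profile Q cI) (G cbar - cbar)))
    (M.continuousAt hG hb) ?_ ?_ ?_
  · have hne : ∀ᶠ z : ℝ × ℝ in 𝓝 (G cbar, cbar), z.2 ∈ Ioi cI := eventually_snd (lt_mem_nhds hIb)
    filter_upwards [self_mem_nhdsWithin, nhdsWithin_le_nhds hpos, nhdsWithin_le_nhds hne]
      with z h1 h2 h3
    exact M.contDiffAt_of_ne h2.1 h2.2 h1 fun h => (ne_of_gt h3) (congrArg Prod.snd h)
  · refine Eventually.of_forall fun z => ?_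
    have := dense_off_graphs (E := ∅) (by simp) (N := fun c => {G c}) (by simp) z
    refine closure_mono (fun w hw => ?_) this
    rcases lt_or_gt_of_ne (show w.1 ≠ G w.2 from hw.2) with h | h
    · exact Or.inl h
    · exact Or.inr ((le_or_gt w.2 cbar).imp (fun k => ⟨h, k⟩) fun k => ⟨h, k⟩)
  rw [nhdsWithin_union, nhdsWithin_union]
  refine Tendsto.sup ?_ (Tendsto.sup ?_ ?_)
  · have hF := (M.bd.F_continuousAt hb).comp' (f := Prod.snd) (x := (G cbar, cbar))
      continuous_snd.continuousAt
    have hv := (M.continuousAt_vel hb).comp' (f := Prod.snd) (x := (G cbar, cbar))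
      continuous_snd.continuousAt
    have hX : ContinuousAt (fun z : ℝ × ℝ => solX α δ lam 0 (F z.2) z.1) (G cbar, cbar) :=
      ContinuousAt.comp (f := fun z : ℝ × ℝ => ((0 : ℝ), F z.2, z.1)) continuous_solX.continuousAt
        (continuousAt_const.prodMk (hF.prodMk continuous_fst.continuousAt))
    have hg : ContinuousAt (fun z : ℝ × ℝ => gap α δ lam 0 (F z.2)) (G cbar, cbar) :=
      ContinuousAt.comp (f := fun z : ℝ × ℝ => ((0 : ℝ), F z.2)) continuous_gap.continuousAt
        (continuousAt_const.prodMk hF)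
    have hsh : ContinuousAt (fun z : ℝ × ℝ => Real.sinh (√(2 * α) * (z.1 - F z.2)))
        (G cbar, cbar) :=
      Real.continuous_sinh.continuousAt.comp
        (continuousAt_const.mul (continuous_fst.continuousAt.sub hF))
    have hCc : ContinuousAt (fun z : ℝ × ℝ =>
        solC α δ lam 0 (F z.2) 0 (vel α δ lam F G z.2) z.1) (G cbar, cbar) := by
      simp only [solC_zero]
      exact (((continuousAt_const.mul hg).mul hv).div_const _).mul hsh
    have hval : 1 - deriv (profile Q cI) (G cbar - cbar) =
        solC α δ lam 0 (F cbar) 0 (vel α δ lam F G cbar) (G cbar) := by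
      rw [← hs]; linarith [M.vel_fit hb]
    rw [hval, ← hs]
    refine ((hX.tendsto.prodMk_nhds hCc.tendsto).mono_left nhdsWithin_le_nhds).congr' ?_
    filter_upwards [self_mem_nhdsWithin, nhdsWithin_le_nhds hpos,
      nhdsWithin_le_nhds (M.eventually_F_lt hb (M.bd.F_lt_G hb))] with z h1 h2 h3
    exact (M.grad_II h2.2 h3 h1).symm
  · refine tendsto_grad_of_rep ?_ (M.contDiffAt_profile_diag ⟨hIb, le_rfl⟩)
    filter_upwards [self_mem_nhdsWithin,
      nhdsWithin_le_nhds (eventually_snd (lt_mem_nhds hIb))] with z h1 h2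
    exact M.rep_mid ⟨h2, h1.2⟩ h1.1
  · rw [← M.deriv_profile_top hC]
    refine tendsto_grad_of_rep ?_
      (M.contDiffAt_profile_top hC (M.bd.diag_strictAntiOn self_mem_Ici hC.le hC))
    filter_upwards [self_mem_nhdsWithin,
      nhdsWithin_le_nhds (eventually_snd (gt_mem_nhds hC))] with z h1 h2
    exact M.rep_top h1.2 h2 h1.1

theorem deriv_profile_level (hI : 0 < cI) : ContDiffAt ℝ 1 (profile Q cI) (α / (2 * lam) - cI) ∧
    deriv (profile Q cI) (α / (2 * lam) - cI) = 2 * δ * (α / (2 * lam) - cI) := by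
  have h := M.contDiffAt_profile (y := α / (2 * lam) - cI) (fun _ => M.bd.diag_cI_lt hI) (by
    have := M.bd.half_lt_level_sub hI
    have := M.reg.δ_pos
    have : 0 < 1 / (2 * δ) := by positivity
    linarith)
  exact ⟨h, tendsto_nhds_unique ((continuousAt_deriv_of_contDiffAt h).tendsto.mono_left
    nhdsWithin_le_nhds) (M.tendsto_slope_Gb_right hI)⟩

theorem tendsto_grad_III (hI : 0 < cI) :
    Tendsto (grad Q) (𝓝[{z | z.2 ∈ Ioo 0 cI ∧ Fb z.2 < z.1 ∧ z.1 < Gb z.2}] (α / (2 * lam), cI))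
      (𝓝 (2 * δ * (α / (2 * lam) - cI), 1 - 2 * δ * (α / (2 * lam) - cI))) := by
  set L := α / (2 * lam) with hL
  set T : Set (ℝ × ℝ) := {z | z.2 ∈ Ioo 0 cI ∧ Fb z.2 < z.1 ∧ z.1 < Gb z.2} with hT
  have h2 : Tendsto (fun z : ℝ × ℝ => z.2) (𝓝[T] (L, cI)) (𝓝 cI) :=
    (continuous_snd.tendsto (L, cI)).mono_left nhdsWithin_le_nhds
  have h1 : Tendsto (fun z : ℝ × ℝ => z.1) (𝓝[T] (L, cI)) (𝓝 L) :=
    (continuous_fst.tendsto (L, cI)).mono_left nhdsWithin_le_nhds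
  have h2w : Tendsto (fun z : ℝ × ℝ => z.2) (𝓝[T] (L, cI)) (𝓝[Ioc 0 cI] cI) :=
    tendsto_nhdsWithin_iff.2 ⟨h2, by
      filter_upwards [self_mem_nhdsWithin] with z hz using ⟨hz.1.1, hz.1.2.le⟩⟩
  have hFb : Tendsto (fun z : ℝ × ℝ => Fb z.2) (𝓝[T] (L, cI)) (𝓝 L) := by
    have := (M.bd.Fb_cont cI ⟨hI, le_rfl⟩).tendsto.comp h2w
    rwa [M.bd.Fb_end hI] at this
  have hGb : Tendsto (fun z : ℝ × ℝ => Gb z.2) (𝓝[T] (L, cI)) (𝓝 L) := by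
    have := (M.bd.Gb_cont cI ⟨hI, le_rfl⟩).tendsto.comp h2w
    rwa [M.bd.Gb_end hI] at this
  have hX : ∀ x : ℝ × ℝ → ℝ, Tendsto x (𝓝[T] (L, cI)) (𝓝 L) →
      Tendsto (fun z => solX α δ lam z.2 (Fb z.2) (x z)) (𝓝[T] (L, cI))
        (𝓝 (2 * δ * (L - cI))) := by
    intro x hx
    have h3 := tendsto_solX (α := α) (δ := δ) (lam := lam) h2 hFb hx
    rwa [solX_self] at h3
  have hCc : Tendsto (fun z : ℝ × ℝ => solC α δ lam z.2 (Fb z.2) 1 (deriv Fb z.2) z.1)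
      (𝓝[T] (L, cI)) (𝓝 (1 - 2 * δ * (L - cI))) := by
    -- Monotonicity of Q_c in x squeezes it between its values on Ḡ, namely 1 - `solX`, and on F̄,
    -- namely 1 - 2δ(F̄ - c), which have the same limit at the tip.
    refine tendsto_of_tendsto_of_tendsto_of_le_of_le' ((hX _ hGb).const_sub 1)
      (((hFb.sub h2).const_mul (2 * δ)).const_sub 1) ?_ ?_
    · filter_upwards [self_mem_nhdsWithin] with z hz
      have k := M.solC_III_antitoneOn hz.1 hz.2.1.le (M.bd.Fb_lt_Gb hz.1).le hz.2.2.le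
      linarith [(M.diag_fit_Gb hz.1).1]
    · filter_upwards [self_mem_nhdsWithin] with z hz
      have k := M.solC_III_antitoneOn hz.1 self_mem_Ici hz.2.1.le hz.2.1.le
      rw [solC_self] at k
      linarith
  refine ((hX _ h1).prodMk_nhds hCc).congr' ?_
  filter_upwards [self_mem_nhdsWithin] with z hz
  exact (M.grad_III hz.1 hz.2.1 hz.2.2).symm

/-- Off the graphs of F̄ and Ḡ and the line c = cI, four sectors meet at the tip: below F̄, inside
III, above Ḡ, and c > cI. In each the gradient tends to (s, 1 - s) with s = 2δ(α/(2λ) - cI). -/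
theorem contDiffAt_tip (hI : 0 < cI) :
    ContDiffAt ℝ 1 (fun p : ℝ × ℝ => Q p.1 p.2) (α / (2 * lam), cI) := by
  have hIb := M.bd.cI_lt_cbar
  have hGL := M.G_lt_level_of_le ⟨hI, le_rfl⟩
  have hLpos : 0 < α / (2 * lam) := (M.bd.G_pos cI hI).trans hGL
  obtain ⟨hp, hs⟩ := M.deriv_profile_level hI
  have hpos : ∀ᶠ z : ℝ × ℝ in 𝓝 (α / (2 * lam), cI), 0 < z.1 ∧ z.2 ∈ Ioo 0 cbar :=
    ((continuous_fst.tendsto (α / (2 * lam), cI)).eventually (lt_mem_nhds hLpos)).and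
      (eventually_snd (isOpen_Ioo.mem_nhds ⟨hI, hIb⟩))
  have hG := M.eventually_G_lt hI hGL
  have hGb := (tendsto_grad_of_rep (Q := Q) (x := α / (2 * lam)) (c := cI)
    (S := {z | z.2 ∈ Ioo 0 cI ∧ Gb z.2 < z.1}) (by
      filter_upwards [self_mem_nhdsWithin] with z hz using M.rep_upper_lt hz.1 hz.2) hp)
  have hmid := (tendsto_grad_of_rep (Q := Q) (x := α / (2 * lam)) (c := cI)
    (S := {z | cI < z.2}) (by
      filter_upwards [self_mem_nhdsWithin, nhdsWithin_le_nhds hG, nhdsWithin_le_nhds hpos]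
        with z h1 h2 h3 using M.rep_mid ⟨h1, h3.2.2.le⟩ h2) hp)
  have hlow := (tendsto_grad_of_rep (Q := Q) (x := α / (2 * lam)) (c := cI)
    (φ := fun y => δ * y ^ 2) (S := {z | z.2 ∈ Ioo 0 cI ∧ z.1 < Fb z.2}) (by
      filter_upwards [self_mem_nhdsWithin, nhdsWithin_le_nhds hG]
        with z h1 h2 using M.rep_lower h1.1 h2 h1.2) (by fun_prop))
  rw [hs] at hGb hmid
  rw [(hasDerivAt_sq_mul _).deriv] at hlow
  have hall := hlow.sup ((M.tendsto_grad_III hI).sup (hGb.sup hmid))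
  simp only [← nhdsWithin_union] at hall
  refine contDiffAt_of_tendsto_grad (M.continuousAt hLpos hI) ?_ ?_ hall
  · filter_upwards [self_mem_nhdsWithin, nhdsWithin_le_nhds hpos] with z h1 h2
    exact M.contDiffAt_of_ne h2.1 h2.2.1 (fun h => h2.2.2.ne (congrArg Prod.snd h)) h1
  · filter_upwards [nhdsWithin_le_nhds hpos] with z hz
    have hd := dense_off_graphs (E := {cI}) (by simp) (N := fun c => {Fb c, Gb c})
      fun c => (Set.toFinite _).countable
    have ho : IsOpen {z : ℝ × ℝ | 0 < z.2} := isOpen_lt continuous_const continuous_snd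
    refine closure_mono ?_ (hd.open_subset_closure_inter ho hz.2.1)
    rintro w ⟨hw0, hw1, hw2⟩
    simp only [mem_insert_iff, mem_singleton_iff, not_or] at hw1 hw2
    rcases lt_or_gt_of_ne hw1 with h | h
    · rcases lt_or_gt_of_ne hw2.1 with k | k
      · exact Or.inl ⟨⟨hw0, h⟩, k⟩
      rcases lt_or_gt_of_ne hw2.2 with k' | k'
      · exact Or.inr (Or.inl ⟨⟨hw0, h⟩, k, k'⟩)
      · exact Or.inr (Or.inr (Or.inl ⟨⟨hw0, h⟩, k'⟩))
    · exact Or.inr (Or.inr (Or.inr h))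

theorem contDiffAt_pos {x c : ℝ} (hx : 0 < x) (hc : 0 < c) :
    ContDiffAt ℝ 1 (fun p : ℝ × ℝ => Q p.1 p.2) (x, c) := by
  by_cases h1 : (x, c) = (G cbar, cbar)
  · rw [h1]; exact M.contDiffAt_corner
  by_cases h2 : (x, c) = (α / (2 * lam), cI)
  · have : c = cI := congrArg Prod.snd h2
    rw [h2]; exact M.contDiffAt_tip (this ▸ hc)
  exact M.contDiffAt_of_ne hx hc h1 h2

end Model

end

section

/-! ### Estimates off the boundaries -/

/-- The conditions of the verification theorem at a single point `(x, c)` with `x > 0`, with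
quantitative bounds on the derivatives in terms of constants `N` and `E`. -/
structure Estimates (α δ lam N E : ℝ) (Q : ℝ → ℝ → ℝ) (x c : ℝ) : Prop where
  contDiffAt : ContDiffAt ℝ 2 (fun y => Q y c) x
  dx_nonneg : 0 ≤ dx Q x c
  dx_le : dx Q x c ≤ N * E * (1 + x)
  sum_le : dx Q x c + dc Q x c ≤ 1
  dxx_le : |dxx Q x c| ≤ N * Real.exp (√(2 * α) * x)
  generator : 0 ≤ generatorTerm α lam Q x c
  compl : (δ * x ^ 2 - Q x c) * (1 - dx Q x c - dc Q x c) * generatorTerm α lam Q x c = 0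

/-- A constant `N` that dominates the derivatives of the solutions `sol t z` for `t` in `[0, T]`
and `z` in `[0, Z]`, and the other constants of the problem. -/
structure BoundConst (α δ lam T Z N : ℝ) : Prop where
  pos : 0 < N
  payoff : 2 * δ ≤ N
  tail : -(√(2 * α) * fitV α δ lam 0 (f0 α δ lam)) ≤ N
  run : 2 * (lam / α) ≤ N
  sol : ∀ t ∈ Icc 0 T, ∀ z ∈ Icc 0 Z, ∀ x, z ≤ x →
    |solX α δ lam t z x| ≤ N * Real.exp (√(2 * α) * x) + 2 * (lam / α) * x ∧
    |solXX α δ lam t z x| ≤ N * Real.exp (√(2 * α) * x)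

theorem exists_boundConst {α δ lam : ℝ} (H : Regime α δ lam) (T Z : ℝ) :
    ∃ N, BoundConst α δ lam T Z N := by
  obtain ⟨M, hM, h⟩ := exists_sol_bound H T Z
  have h1 : 0 ≤ -(√(2 * α) * fitV α δ lam 0 (f0 α δ lam)) :=
    (neg_pos.2 (mul_neg_of_pos_of_neg H.k_pos H.fitV_f0_neg)).le
  have h2 := H.δ_pos
  have h3 : 0 < lam / α := div_pos H.lam_pos H.α_pos
  refine ⟨M + 2 * δ + -(√(2 * α) * fitV α δ lam 0 (f0 α δ lam)) + 2 * (lam / α), by linarith,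
    by linarith, by linarith, by linarith, fun t ht z hz x hx => ?_⟩
  obtain ⟨a, b⟩ := h t ht z hz x hx
  have h4 : M * Real.exp (√(2 * α) * x) ≤
      (M + 2 * δ + -(√(2 * α) * fitV α δ lam 0 (f0 α δ lam)) + 2 * (lam / α)) *
        Real.exp (√(2 * α) * x) :=
    mul_le_mul_of_nonneg_right (by linarith) (Real.exp_pos _).le
  exact ⟨by linarith, by linarith⟩

variable {α δ lam : ℝ}

theorem BoundConst.le_of_le {T Z N E x u : ℝ} (hN : BoundConst α δ lam T Z N) (hE : 1 ≤ E)
    (hx : 0 ≤ x) (hu : u ≤ N * E + N * x) : u ≤ N * E * (1 + x) := by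
  have := mul_nonneg (mul_nonneg hN.pos.le (sub_nonneg.2 hE)) hx
  linarith

theorem BoundConst.solX_le {T Z N E t z x₂ x : ℝ} (hN : BoundConst α δ lam T Z N)
    (hE : 1 ≤ E) (ht : t ∈ Icc 0 T) (hz : z ∈ Icc 0 Z) (hzx : z ≤ x₂) (hx : x₂ ≤ x)
    (hexp : Real.exp (√(2 * α) * x₂) ≤ E) : solX α δ lam t z x₂ ≤ N * E * (1 + x) := by
  have h0 : 0 ≤ x₂ := hz.1.trans hzx
  refine hN.le_of_le hE (h0.trans hx) ?_
  have h1 := (le_abs_self _).trans (hN.sol t ht z hz x₂ hzx).1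
  have h2 := mul_le_mul_of_nonneg_left hexp hN.pos.le
  have h3 : 2 * (lam / α) * x₂ ≤ N * x := mul_le_mul hN.run hx h0 hN.pos.le
  linarith

theorem BoundConst.solXX_le {T Z N t z x₂ x : ℝ} (H : Regime α δ lam)
    (hN : BoundConst α δ lam T Z N) (ht : t ∈ Icc 0 T) (hz : z ∈ Icc 0 Z) (hzx : z ≤ x₂)
    (hx : x₂ ≤ x) : |solXX α δ lam t z x₂| ≤ N * Real.exp (√(2 * α) * x) := by
  refine (hN.sol t ht z hz x₂ hzx).2.trans ?_
  have := H.k_pos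
  have := hN.pos
  gcongr

theorem BoundConst.stop_le {T Z N x : ℝ} (H : Regime α δ lam) (hN : BoundConst α δ lam T Z N)
    (hx : 0 ≤ x) : |2 * δ| ≤ N * Real.exp (√(2 * α) * x) := by
  rw [abs_of_pos (by have := H.δ_pos; positivity)]
  have h1 : 1 ≤ Real.exp (√(2 * α) * x) := Real.one_le_exp (mul_nonneg H.k_pos.le hx)
  nlinarith [hN.payoff, hN.pos]

theorem dxx_eq_of_eventuallyEq {Q : ℝ → ℝ → ℝ} {f f' : ℝ → ℝ} {f'' x c : ℝ}
    (h : (fun y => Q y c) =ᶠ[𝓝 x] f) (h1 : ∀ y, HasDerivAt f (f' y) y)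
    (h2 : HasDerivAt f' f'' x) : dx Q x c = f' x ∧ dxx Q x c = f'' := by
  refine ⟨h.deriv_eq.trans (h1 x).deriv, ?_⟩
  have : (fun y => dx Q y c) =ᶠ[𝓝 x] f' := by
    filter_upwards [h.deriv] with y hy
    rw [dx, hy, (h1 y).deriv]
  exact this.deriv_eq.trans h2.deriv

theorem hasDerivAt_two_mul_shift (c x : ℝ) :
    HasDerivAt (fun y => 2 * δ * (y - c)) (2 * δ) x := by
  simpa using ((hasDerivAt_id x).sub_const c).const_mul (2 * δ)

theorem Estimates.of_sq {T Z N E x c : ℝ} {Q : ℝ → ℝ → ℝ} (H : Regime α δ lam)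
    (hN : BoundConst α δ lam T Z N) (hE : 1 ≤ E) (hx : 0 < x) (hc : 0 ≤ c) (hxc : 0 ≤ x - c)
    (hQ : ∀ᶠ p : ℝ × ℝ in 𝓝 (x, c), Q p.1 p.2 = δ * (p.1 - p.2) ^ 2 + p.2)
    (hg : 0 ≤ gap α δ lam c x) : Estimates α δ lam N E Q x c := by
  have hs := slices_of_rep (φ := fun y => δ * y ^ 2) hQ (by fun_prop)
  rw [(hasDerivAt_sq_mul (x - c)).deriv] at hs
  have he : (fun y => Q y c) =ᶠ[𝓝 x] fun y => δ * (y - c) ^ 2 + c :=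
    (Continuous.tendsto (by fun_prop : Continuous fun z : ℝ => (z, c)) x).eventually hQ
  obtain ⟨e1, e2⟩ := dxx_eq_of_eventuallyEq he (hasDerivAt_sq_shift c)
    (hasDerivAt_two_mul_shift c x)
  have e3 : dc Q x c = 1 - 2 * δ * (x - c) := hs.2.deriv
  have e4 : generatorTerm α lam Q x c = gap α δ lam c x := by
    rw [generatorTerm, e2, he.eq_of_nhds, gap]; ring
  have hδ := H.δ_pos
  refine ⟨ContDiffAt.congr_of_eventuallyEq (by fun_prop) he, by rw [e1]; positivity,
    hN.le_of_le hE hx.le ?_, by rw [e1, e3]; linarith, by rw [e2]; exact hN.stop_le H hx.le,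
    by rwa [e4], by rw [e1, e3]; ring⟩
  rw [e1]
  have h1 := mul_le_mul hN.payoff (show x - c ≤ x by linarith) hxc hN.pos.le
  have h2 := mul_nonneg hN.pos.le (zero_le_one.trans hE)
  linarith

theorem Estimates.of_inherits {N E x c c₂ t z : ℝ} {Q : ℝ → ℝ → ℝ} {φ : ℝ → ℝ}
    (H : Regime α δ lam) (hI : Inherits α δ lam φ (x - c) c₂ t z)
    (hQ : ∀ᶠ p : ℝ × ℝ in 𝓝 (x, c), Q p.1 p.2 = φ (p.1 - p.2) + p.2)
    (hc₂ : c₂ ≤ c) (hL : α / (2 * lam) ≤ x - c + c₂) (h0 : 0 ≤ solX α δ lam t z (x - c + c₂))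
    (h1 : solX α δ lam t z (x - c + c₂) ≤ N * E * (1 + x))
    (h2 : |solXX α δ lam t z (x - c + c₂)| ≤ N * Real.exp (√(2 * α) * x)) :
    Estimates α δ lam N E Q x c := by
  have hs := slices_of_rep hQ (hI.contDiffAt.differentiableAt (by norm_num))
  rw [hI.slope] at hs
  have he : (fun y => Q y c) =ᶠ[𝓝 x] fun y => φ (y - c) + c :=
    (Continuous.tendsto (by fun_prop : Continuous fun z : ℝ => (z, c)) x).eventually hQ
  have e1 : dx Q x c = solX α δ lam t z (x - c + c₂) := hs.1.deriv
  have e3 : dc Q x c = 1 - solX α δ lam t z (x - c + c₂) := hs.2.deriv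
  have e2 : dxx Q x c = solXX α δ lam t z (x - c + c₂) := by
    have : (fun y => dx Q y c) =ᶠ[𝓝 x] fun y => deriv φ (y - c) := by
      filter_upwards [he.deriv] with y hy
      rw [dx, hy, deriv_add_const, deriv_comp_sub_const]
    rw [dxx, this.deriv_eq, deriv_comp_sub_const, hI.curv]
  -- The generator vanishes at the foot of the diagonal; Q_xx is unchanged along it, Q grows by c -
  -- c₂, and λx² supplies the rest.
  have e4 : generatorTerm α lam Q x c =
      (c - c₂) * (2 * lam * (x - c + c₂) - α) + lam * (c - c₂) ^ 2 := by
    rw [generatorTerm, e2, he.eq_of_nhds, hI.val, solXX_eq H]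
    ring
  have hlam := H.lam_pos
  refine ⟨?_, by rwa [e1], by rwa [e1], by rw [e1, e3]; linarith, by rwa [e2], ?_,
    by rw [e1, e3]; ring⟩
  · refine ContDiffAt.congr_of_eventuallyEq ?_ he
    exact (ContDiffAt.comp (f := fun y => y - c) x hI.contDiffAt (by fun_prop)).add
      contDiffAt_const
  · rw [e4]
    have : 0 ≤ 2 * lam * (x - c + c₂) - α := by
      rw [div_le_iff₀ (by positivity)] at hL; linarith
    have := sub_nonneg.2 hc₂
    positivity

theorem Estimates.of_sol {N E x c t z r : ℝ} {Q : ℝ → ℝ → ℝ} (H : Regime α δ lam)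
    (hQ : (fun y => Q y c) =ᶠ[𝓝 x] sol α δ lam t z) (hr : HasDerivAt (fun d => Q x d) r c)
    (h0 : 0 ≤ solX α δ lam t z x) (hsum : solX α δ lam t z x + r ≤ 1)
    (h1 : solX α δ lam t z x ≤ N * E * (1 + x))
    (h2 : |solXX α δ lam t z x| ≤ N * Real.exp (√(2 * α) * x)) :
    Estimates α δ lam N E Q x c := by
  obtain ⟨e1, e2⟩ := dxx_eq_of_eventuallyEq hQ (hasDerivAt_sol H t z) (hasDerivAt_solX H t z x)
  have e3 : dc Q x c = r := hr.deriv
  have e4 : generatorTerm α lam Q x c = 0 := by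
    rw [generatorTerm, e2, hQ.eq_of_nhds, solXX_eq H]; ring
  exact ⟨(contDiff_sol_right t z).contDiffAt.congr_of_eventuallyEq hQ, by rwa [e1], by rwa [e1],
    by rwa [e1, e3], by rwa [e2], e4.ge, by rw [e4, mul_zero]⟩

theorem Estimates.of_stop {T Z N E x c : ℝ} {Q : ℝ → ℝ → ℝ} (H : Regime α δ lam)
    (hN : BoundConst α δ lam T Z N) (hE : 1 ≤ E) (hx : 0 < x) (hx1 : x ≤ 1 / (2 * δ))
    (hQ : ∀ᶠ p : ℝ × ℝ in 𝓝 (x, c), Q p.1 p.2 = δ * p.1 ^ 2) :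
    Estimates α δ lam N E Q x c := by
  have he : (fun y => Q y c) =ᶠ[𝓝 x] fun y => δ * y ^ 2 :=
    (Continuous.tendsto (by fun_prop : Continuous fun z : ℝ => (z, c)) x).eventually hQ
  have hd : (fun d => Q x d) =ᶠ[𝓝 c] fun _ => δ * x ^ 2 :=
    (Continuous.tendsto (by fun_prop : Continuous fun d : ℝ => (x, d)) c).eventually hQ
  obtain ⟨e1, e2⟩ := dxx_eq_of_eventuallyEq (f' := fun y => 2 * δ * y) he hasDerivAt_sq_mul
    (by simpa using hasDerivAt_two_mul_shift 0 x)
  have e3 : dc Q x c = 0 := hd.deriv_eq.trans (deriv_const _ _)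
  have hδ := H.δ_pos
  have e4 : generatorTerm α lam Q x c = gap α δ lam 0 x := by
    rw [generatorTerm, e2, he.eq_of_nhds, gap]; ring
  have hx2 : 2 * δ * x ≤ 1 := by
    rw [le_div_iff₀ (by positivity)] at hx1; linarith
  refine ⟨ContDiffAt.congr_of_eventuallyEq (by fun_prop) he, by rw [e1]; positivity,
    hN.le_of_le hE hx.le ?_, by rw [e1, e3]; linarith, by rw [e2]; exact hN.stop_le H hx.le, ?_,
    by rw [he.eq_of_nhds]; ring⟩
  · rw [e1]
    have h1 := mul_le_mul_of_nonneg_right hN.payoff hx.le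
    have h2 := mul_nonneg hN.pos.le (zero_le_one.trans hE)
    linarith
  · rw [e4]
    exact (H.gap_zero_pos hx.le (hx1.trans H.half_lt_f0.le)).le

theorem offBoundaries_iff {cI cbar g0 : ℝ} {F G Fb Gb : ℝ → ℝ} {x c : ℝ}
    (hx : x ∈ offBoundaries (boundaries α δ lam cI cbar g0 F G Fb Gb) c) :
    (0 < c → x ≠ F c ∧ x ≠ G c) ∧ (c ∈ Ioc 0 cI → x ≠ Fb c ∧ x ≠ Gb c) ∧
      (0 ≤ c → x - c ≠ f0 α δ lam) ∧ (cbar ≤ c → x - c ≠ G cbar - cbar) ∧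
      (0 < cI → 0 ≤ c → x - c ≠ g0) ∧ (0 < cI → cI ≤ c → x - c ≠ α / (2 * lam) - cI) := by
  refine ⟨fun h => ⟨(hx 0 h).1, (hx 1 h).1⟩, fun h => ⟨(hx 2 h).1, (hx 3 h).1⟩, fun h e => ?_,
    fun h e => ?_, fun hI h e => ?_, fun hI h e => ?_⟩
  · exact (hx 4 h).1 (show x = f0 α δ lam + c by linarith)
  · exact (hx 5 h).1 (show x = G cbar + c - cbar by linarith)
  · exact (hx 6 ⟨hI, h⟩).1 (show x = g0 + c by linarith)
  · exact (hx 7 ⟨hI, h⟩).1 (show x = α / (2 * lam) - cI + c by linarith)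

/-- The exponential weight in the growth bound. -/
def weight (α g₀ g : ℝ) : ℝ := 1 + Real.exp (√(2 * α) * g₀) + Real.exp (√(2 * α) * g)

theorem one_le_weight (α g₀ g : ℝ) : 1 ≤ weight α g₀ g := by
  have := Real.exp_pos (√(2 * α) * g₀)
  have := Real.exp_pos (√(2 * α) * g)
  unfold weight; linarith

theorem Regime.exp_le_weight_left (H : Regime α δ lam) {g₀ g x : ℝ} (hx : x ≤ g₀) :
    Real.exp (√(2 * α) * x) ≤ weight α g₀ g := by
  have h1 := Real.exp_le_exp.2 (mul_le_mul_of_nonneg_left hx H.k_pos.le)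
  have := Real.exp_pos (√(2 * α) * g)
  unfold weight; linarith

theorem Regime.exp_le_weight_right (H : Regime α δ lam) {g₀ g x : ℝ} (hx : x ≤ g) :
    Real.exp (√(2 * α) * x) ≤ weight α g₀ g := by
  have h1 := Real.exp_le_exp.2 (mul_le_mul_of_nonneg_left hx H.k_pos.le)
  have := Real.exp_pos (√(2 * α) * g₀)
  unfold weight; linarith

namespace Model

variable {cI cbar g0 : ℝ} {F G Fb Gb : ℝ → ℝ} {Q : ℝ → ℝ → ℝ}
  (M : Model α δ lam cI cbar g0 F G Fb Gb Q)

include M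

theorem F_mem {c : ℝ} (hc : 0 < c) : F c ∈ Icc 0 (f0 α δ lam + α / (2 * lam)) := by
  have := M.bd.F_lt hc
  have := M.reg.half_lt_f0
  have := M.reg.half_lt_level
  have := M.bd.F_pos c hc.le
  have := M.reg.f0_pos
  exact ⟨by linarith, by linarith⟩

theorem Fb_mem {c : ℝ} (hc : c ∈ Ioo 0 cI) : Fb c ∈ Icc 0 (f0 α δ lam + α / (2 * lam)) :=
  ⟨(M.bd.Fb_pos c ⟨hc.1, hc.2.le⟩).le, by linarith [M.bd.Fb_lt_level hc, M.reg.f0_pos]⟩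

theorem f0_mem : f0 α δ lam ∈ Icc 0 (f0 α δ lam + α / (2 * lam)) := by
  have := M.reg.α_pos
  have := M.reg.lam_pos
  have : 0 < α / (2 * lam) := by positivity
  exact ⟨M.reg.f0_pos.le, by linarith⟩

variable {N : ℝ} (hN : BoundConst α δ lam cI (f0 α δ lam + α / (2 * lam)) N)

include hN

theorem estimates_outer {x c g : ℝ} {φ : ℝ → ℝ} (hc : 0 ≤ c)
    (hI : Inherits α δ lam φ (x - c) 0 0 (f0 α δ lam)) (hf : f0 α δ lam ≤ x - c)
    (hL : α / (2 * lam) ≤ x - c)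
    (hQ : ∀ᶠ p : ℝ × ℝ in 𝓝 (x, c), Q p.1 p.2 = φ (p.1 - p.2) + p.2) :
    Estimates α δ lam N (weight α g0 g) Q x c := by
  have hf0 := M.reg.f0_pos
  have h0 : 0 < lam / α := div_pos M.reg.lam_pos M.reg.α_pos
  refine Estimates.of_inherits M.reg hI hQ hc (by linarith)
    (M.reg.solX_f0_nonneg (by linarith)) ?_
    (hN.solXX_le M.reg ⟨le_rfl, M.bd.cI_nonneg⟩ M.f0_mem (by linarith) (by linarith))
  refine hN.le_of_le (one_le_weight α g0 g) (by linarith) ?_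
  have h1 := M.reg.solX_f0_le (x := x - c + 0) (by linarith)
  have h2 := mul_le_mul hN.run (show x - c + 0 ≤ x by linarith) (by linarith) hN.pos.le
  have h3 := mul_le_mul_of_nonneg_left (one_le_weight α g0 g) hN.pos.le
  linarith [hN.tail]

/-- Case distinction over the pieces of the profile. `hgap` is called only on the square piece;
`hc₂` places the foot on Ḡ below (x, c), which the sign of the transported generator requires. -/
theorem estimates_profile {x c g : ℝ} (hc : 0 < c) (h1 : 0 < cI → G cI - cI < x - c)
    (h0 : 0 < x - c) (hf : cI = 0 → x - c ≠ f0 α δ lam) (hg : 0 < cI → x - c ≠ g0)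
    (hl : 0 < cI → x - c ≠ α / (2 * lam) - cI)
    (hQ : ∀ᶠ p : ℝ × ℝ in 𝓝 (x, c), Q p.1 p.2 = profile Q cI (p.1 - p.2) + p.2)
    (hc₂ : ∀ c₂ ∈ Ioo 0 cI, Gb c₂ - c₂ = x - c → c₂ ≤ c)
    (hgap : (0 < cI → x - c ≤ α / (2 * lam) - cI) → (cI = 0 → x - c ≤ f0 α δ lam) →
      0 ≤ gap α δ lam c x) :
    Estimates α δ lam N (weight α g0 g) Q x c := by
  have hsub : Tendsto (fun p : ℝ × ℝ => p.1 - p.2) (𝓝 (x, c)) (𝓝 (x - c)) :=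
    Continuous.tendsto (by fun_prop : Continuous fun p : ℝ × ℝ => p.1 - p.2) (x, c)
  have hsq : profile Q cI =ᶠ[𝓝 (x - c)] (fun y => δ * y ^ 2) → 0 ≤ gap α δ lam c x →
      Estimates α δ lam N (weight α g0 g) Q x c := fun he hg =>
    Estimates.of_sq M.reg hN (one_le_weight _ _ _) (by linarith) hc.le h0.le (by
      filter_upwards [hQ, hsub.eventually he] with p e1 e2 using by rw [e1, e2]) hg
  rcases M.bd.cI_nonneg.eq_or_lt with hI | hI
  · rcases lt_or_gt_of_ne (hf hI.symm) with h | h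
    · refine hsq ?_ (hgap (fun k => absurd k hI.not_lt) fun _ => h.le)
      filter_upwards [Ioo_mem_nhds h0 h] with y hy
      rw [M.profile_zero hI.symm hy.1.le, V0_of_le hy.2.le]
    · exact M.estimates_outer hN hc.le (M.inherits_zero hI.symm h) h.le
        ((M.regime hI.symm).trans h.le) hQ
  · rcases lt_or_gt_of_ne (hl hI) with h | h
    · exact hsq (M.profile_eventuallyEq_inner hI (h1 hI) h)
        (hgap (fun _ => h.le) fun k => absurd k hI.ne')
    rcases lt_or_gt_of_ne (hg hI) with h' | h'
    · obtain ⟨c₂, hm, he⟩ := M.exists_Gb_diag hI h h'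
      have hi := M.inherits_Gb hm
      have hb : x - c + c₂ = Gb c₂ := by linarith
      have hle := hc₂ c₂ hm he
      have ht : c₂ ∈ Icc 0 cI := ⟨hm.1.le, hm.2.le⟩
      have hFG := (M.bd.Fb_lt_Gb hm).le
      rw [he] at hi
      refine Estimates.of_inherits M.reg hi hQ hle ?_ ?_ ?_ ?_ <;> rw [hb]
      · exact (M.bd.level_lt_Gb hm).le
      · exact M.solX_III_nonneg hm ⟨hFG, le_rfl⟩
      · exact hN.solX_le (one_le_weight _ _ _) ht (M.Fb_mem hm) hFG (by linarith)
          (M.reg.exp_le_weight_left (M.bd.Gb_lt_g0 ⟨hm.1, hm.2.le⟩).le)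
      · exact hN.solXX_le M.reg ht (M.Fb_mem hm) hFG (by linarith)
    · have := M.g0_gt hI
      exact M.estimates_outer hN hc.le (M.inherits_outer hI h')
        ((M.bd.f0_lt_level hI).le.trans (by linarith)) (by linarith) hQ

theorem estimates_II {x c : ℝ} (hc : 0 < c) (h1 : F c < x) (h2 : x < G c) :
    Estimates α δ lam N (weight α g0 (G c)) Q x c := by
  have hs := M.slices_II hc h1 h2
  have hm : x ∈ Icc (F c) (G c) := ⟨h1.le, h2.le⟩
  have h0 : (0 : ℝ) ∈ Icc 0 cI := ⟨le_rfl, M.bd.cI_nonneg⟩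
  have he : (fun y => Q y c) =ᶠ[𝓝 x] sol α δ lam 0 (F c) := by
    filter_upwards [Ioo_mem_nhds h1 h2] with y hy using M.eq_on_II hc hy.1.le hy.2.le
  exact Estimates.of_sol M.reg he hs.2 (M.solX_II_nonneg hc hm) (M.diag_le_one_II hc hm)
    (hN.solX_le (one_le_weight _ _ _) h0 (M.F_mem hc) h1.le le_rfl
      (M.reg.exp_le_weight_right h2.le)) (hN.solXX_le M.reg h0 (M.F_mem hc) h1.le le_rfl)

theorem estimates_III {x c g : ℝ} (hc : c ∈ Ioo 0 cI) (h1 : Fb c < x) (h2 : x < Gb c) :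
    Estimates α δ lam N (weight α g0 g) Q x c := by
  have hs := M.slices_III hc h1 h2
  have hm : x ∈ Icc (Fb c) (Gb c) := ⟨h1.le, h2.le⟩
  have h0 : c ∈ Icc 0 cI := ⟨hc.1.le, hc.2.le⟩
  have he : (fun y => Q y c) =ᶠ[𝓝 x] sol α δ lam c (Fb c) := by
    filter_upwards [Ioo_mem_nhds h1 h2] with y hy using M.eq_on_III hc hy.1.le hy.2.le
  exact Estimates.of_sol M.reg he hs.2 (M.solX_III_nonneg hc hm) (M.diag_le_one_III hc hm)
    (hN.solX_le (one_le_weight _ _ _) h0 (M.Fb_mem hc) h1.le le_rfl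
      (M.reg.exp_le_weight_left (h2.le.trans (M.bd.Gb_lt_g0 ⟨hc.1, hc.2.le⟩).le)))
    (hN.solXX_le M.reg h0 (M.Fb_mem hc) h1.le le_rfl)

theorem estimates_top {x c : ℝ} (hc : cbar < c) (hG : G c < x) (hy : x - c < G cbar - cbar) :
    Estimates α δ lam N (weight α g0 (G c)) Q x c := by
  have hC : cbar < c + 1 := by linarith
  have hanti := M.bd.diag_strictAntiOn hc.le hC.le (lt_add_one c)
  obtain ⟨c₂, hm, he⟩ := M.exists_G_diag hC (by linarith) hy
  have hle : c₂ ≤ c := by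
    by_contra! h
    have := M.bd.diag_strictAntiOn hc.le hm.1.le h
    simp only at this
    linarith
  have hpos := M.bd.cbar_pos.trans hm.1
  have hi := M.inherits_G hm
  have hb : x - c + c₂ = G c₂ := by linarith
  have ht : (0 : ℝ) ∈ Icc 0 cI := ⟨le_rfl, M.bd.cI_nonneg⟩
  have hFG := (M.bd.F_lt_G hpos).le
  rw [he] at hi
  refine Estimates.of_inherits M.reg hi (M.rep_top hc (lt_add_one c) hG) hle ?_ ?_ ?_ ?_ <;> rw [hb]
  · exact M.bd.level_le_G hm.1.le
  · exact M.solX_II_nonneg hpos ⟨hFG, le_rfl⟩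
  · exact hN.solX_le (one_le_weight _ _ _) ht (M.F_mem hpos) hFG (by linarith)
      (M.reg.exp_le_weight_right (M.bd.G_strictMonoOn.monotoneOn hpos (hpos.trans_le hle) hle))
  · exact hN.solXX_le M.reg ht (M.F_mem hpos) hFG (by linarith)

theorem estimates_IV {x c : ℝ} (hc : 0 < c) (hG : G c < x) (h1 : c < cI → x < Fb c ∨ Gb c < x)
    (hf : x - c ≠ f0 α δ lam) (htop : cbar ≤ c → x - c ≠ G cbar - cbar)
    (hg : 0 < cI → x - c ≠ g0) (hl : 0 < cI → cI ≤ c → x - c ≠ α / (2 * lam) - cI) :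
    Estimates α δ lam N (weight α g0 (G c)) Q x c := by
  have hδ : 0 < 1 / (2 * δ) := by have := M.reg.δ_pos; positivity
  rcases lt_or_ge c cI with h | h
  · have hI := hc.trans h
    have hcm : c ∈ Ioo 0 cI := ⟨hc, h⟩
    rcases h1 h with h1 | h1
    · have hcb : c ∈ Ioc 0 cbar := ⟨hc, (h.trans M.bd.cI_lt_cbar).le⟩
      exact Estimates.of_sq M.reg hN (one_le_weight _ _ _) ((M.bd.G_pos c hc).trans hG) hc.le
        (by linarith [M.diag_pos hcb]) (M.rep_lower hcm hG h1)
        (M.gap_nonneg hcb hG.le (fun _ => h1.le) (fun k => absurd k (not_le.2 h))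
          fun k => absurd k hI.ne')
    · have hy : α / (2 * lam) - cI < x - c := by linarith [M.bd.level_lt_Gb hcm]
      refine M.estimates_profile hN hc (fun _ => (M.bd.diag_cI_lt hI).trans hy)
        (by linarith [M.bd.half_lt_level_sub hI]) (fun _ => hf) hg (fun _ => hy.ne')
        (M.rep_upper_lt hcm h1) (fun c₂ hm he => ?_) fun k => absurd (k hI) (not_le.2 hy)
      by_contra! k
      have := M.bd.Gb_diag_strictAntiOn ⟨hc, h.le⟩ ⟨hm.1, hm.2.le⟩ k
      simp only at this
      linarith
  · rcases le_or_gt c cbar with hb | hb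
    · have hpos := M.diag_pos ⟨hc, hb⟩
      have hgap := fun h2 h3 => M.gap_nonneg ⟨hc, hb⟩ hG.le (fun k => absurd k (not_lt.2 h))
        (fun _ => h2) h3
      rcases h.eq_or_lt with rfl | h
      · rcases lt_or_gt_of_ne (hl hc le_rfl) with k | k
        · exact Estimates.of_sq M.reg hN (one_le_weight _ _ _) ((M.bd.G_pos cI hc).trans hG) hc.le
            (by linarith) (M.rep_lower_end hc hG (by linarith))
            (hgap (fun _ => k.le) fun k => absurd k hc.ne')
        · exact M.estimates_profile hN hc (fun _ => by linarith) (by linarith) (fun _ => hf) hg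
            (fun hI => hl hI le_rfl) (M.rep_upper_end hc (by linarith))
            (fun c₂ hm _ => hm.2.le) hgap
      · exact M.estimates_profile hN hc (fun hI => by linarith [M.diag_gt_cI hI ⟨h, hb⟩])
          (by linarith) (fun _ => hf) hg (fun hI => hl hI h.le) (M.rep_mid ⟨h, hb⟩ hG)
          (fun c₂ hm _ => hm.2.le.trans h.le) hgap
    · rcases lt_or_gt_of_ne (htop hb.le) with hy | hy
      · exact M.estimates_top hN hb hG hy
      have hIb := M.bd.cI_lt_cbar
      refine M.estimates_profile hN hc (fun hI => ?_) ?_ (fun _ => hf) hg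
        (fun hI => hl hI h) ?_ (fun c₂ hm _ => hm.2.le.trans h)
        (M.gap_nonneg_top hb.le hy.le)
      · exact (M.diag_gt_cI hI ⟨hIb, le_rfl⟩).trans hy
      · exact (M.diag_pos ⟨M.bd.cbar_pos, le_rfl⟩).trans hy
      · have hsub : Tendsto (fun p : ℝ × ℝ => p.1 - p.2) (𝓝 (x, c)) (𝓝 (x - c)) :=
          Continuous.tendsto (by fun_prop : Continuous fun p : ℝ × ℝ => p.1 - p.2) (x, c)
        filter_upwards [M.rep_top hb (lt_add_one c) hG, hsub.eventually (lt_mem_nhds hy)]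
          with p e1 e2
        rw [e1, M.profile_top_eq (by linarith) (le_of_lt e2)]

theorem estimates {x c : ℝ} (hx : 0 < x) (hc : 0 < c)
    (ho : x ∈ offBoundaries (boundaries α δ lam cI cbar g0 F G Fb Gb) c) :
    Estimates α δ lam N (weight α g0 (G c)) Q x c := by
  obtain ⟨h1, h2, h3, h4, h5, h6⟩ := offBoundaries_iff ho
  rcases lt_or_gt_of_ne (h1 hc).1 with h | h
  · exact Estimates.of_stop M.reg hN (one_le_weight _ _ _) hx (h.trans (M.bd.F_lt hc)).le
      (M.eventually_eq_I hx hc h)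
  rcases lt_or_gt_of_ne (h1 hc).2 with h' | h'
  · exact M.estimates_II hN hc h h'
  by_cases hIII : c < cI ∧ Fb c < x ∧ x < Gb c
  · exact M.estimates_III hN ⟨hc, hIII.1⟩ hIII.2.1 hIII.2.2
  refine M.estimates_IV hN hc h' (fun k => ?_) (h3 hc.le) h4 (fun hI => h5 hI hc.le) h6
  have h2 := h2 ⟨hc, k.le⟩
  rcases lt_or_gt_of_ne h2.1 with e | e
  · exact Or.inl e
  rcases lt_or_gt_of_ne h2.2 with e' | e'
  · exact absurd ⟨k, e, e'⟩ hIII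
  · exact Or.inr e'

end Model

end

section

/-! ### Estimates on the boundaries and comparison with stopping -/

theorem eventually_offBoundaries {n : ℕ} (b : Fin n → MovingBoundary) (x c : ℝ) :
    ∀ᶠ y in 𝓝[≠] x, y ∈ offBoundaries b c := by
  have hfin : (⋃ i, {(b i).val c, -(b i).val c} : Set ℝ).Finite :=
    finite_iUnion fun i => Set.toFinite _
  -- x itself may lie on a boundary, so it is removed from the finite set before the complement is
  -- taken.
  have h := (hfin.subset (sdiff_subset (t := {x}))).isClosed.isOpen_compl.mem_nhds
    (x := x) (by simp)
  filter_upwards [mem_nhdsWithin_of_mem_nhds h, self_mem_nhdsWithin] with y h1 h2 i _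
  have h3 : y ∉ (⋃ i, {(b i).val c, -(b i).val c} : Set ℝ) := fun h => h1 ⟨h, h2⟩
  simp only [mem_iUnion, mem_insert_iff, mem_singleton_iff, not_exists, not_or] at h3
  exact h3 i

theorem hasDerivAt_diag {f : ℝ × ℝ → ℝ} {x c : ℝ} (h : ContDiffAt ℝ 1 f (x, c)) :
    HasDerivAt (fun s => f (x + s, c + s)) (fderiv ℝ f (x, c) (1, 0) + fderiv ℝ f (x, c) (0, 1))
      0 := by
  have h1 : HasDerivAt (fun s : ℝ => (x + s, c + s)) ((1 : ℝ), (1 : ℝ)) 0 :=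
    ((hasDerivAt_id (0 : ℝ)).const_add x).prodMk ((hasDerivAt_id (0 : ℝ)).const_add c)
  have h2 : HasFDerivAt f (fderiv ℝ f (x, c)) (x + 0, c + 0) := by
    simpa using (h.differentiableAt (by norm_num)).hasFDerivAt
  have := HasFDerivAt.comp_hasDerivAt (f := fun s : ℝ => (x + s, c + s)) (0 : ℝ) h2 h1
  rw [← map_add, Prod.mk_add_mk, add_zero, zero_add]
  exact this

namespace Model

variable {α δ lam cI cbar g0 : ℝ} {F G Fb Gb : ℝ → ℝ} {Q : ℝ → ℝ → ℝ}
  (M : Model α δ lam cI cbar g0 F G Fb Gb Q)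

include M

theorem hasDerivAt_dx {x c : ℝ} (hx : 0 < x) (hc : 0 < c) :
    HasDerivAt (fun y => Q y c) (dx Q x c) x :=
  (hasDerivAt_fst_slice (M.contDiffAt_pos hx hc)).differentiableAt.hasDerivAt

theorem grad_eq {x c : ℝ} (hx : 0 < x) (hc : 0 < c) : grad Q (x, c) = (dx Q x c, dc Q x c) :=
  Prod.ext (hasDerivAt_fst_slice (M.contDiffAt_pos hx hc)).deriv.symm
    (hasDerivAt_snd_slice (M.contDiffAt_pos hx hc)).deriv.symm

theorem tendsto_dx_dc {x c : ℝ} (hx : 0 < x) (hc : 0 < c) :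
    Tendsto (fun y => (dx Q y c, dc Q y c)) (𝓝[≠] x) (𝓝 (dx Q x c, dc Q x c)) := by
  have h : ContinuousAt (fderiv ℝ (fun p : ℝ × ℝ => Q p.1 p.2)) (x, c) :=
    ((M.contDiffAt_pos hx hc).fderiv_right (m := 0) (by norm_num)).continuousAt
  have hg : ContinuousAt (grad Q) (x, c) :=
    (h.clm_apply continuousAt_const).prodMk (h.clm_apply continuousAt_const)
  have h2 : Tendsto (fun y => grad Q (y, c)) (𝓝[≠] x) (𝓝 (grad Q (x, c))) :=
    hg.tendsto.comp ((Continuous.tendsto (by fun_prop : Continuous fun y : ℝ => (y, c)) x).mono_left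
      nhdsWithin_le_nhds)
  rw [M.grad_eq hx hc] at h2
  refine h2.congr' ?_
  filter_upwards [mem_nhdsWithin_of_mem_nhds (lt_mem_nhds hx)] with y hy
  exact M.grad_eq hy hc

/-- At each level only finitely many x are exceptional, so continuity of the gradient extends the
estimates to every x > 0. -/
theorem gradient_bounds {N : ℝ} (hN : BoundConst α δ lam cI (f0 α δ lam + α / (2 * lam)) N)
    {x c : ℝ} (hx : 0 < x) (hc : 0 < c) : 0 ≤ dx Q x c ∧ dx Q x c + dc Q x c ≤ 1 ∧
      dx Q x c ≤ N * weight α g0 (G c) * (1 + x) := by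
  have ht := M.tendsto_dx_dc hx hc
  have h1 : Tendsto (fun y => dx Q y c) (𝓝[≠] x) (𝓝 (dx Q x c)) :=
    (continuous_fst.tendsto _).comp ht
  have h2 : Tendsto (fun y => dc Q y c) (𝓝[≠] x) (𝓝 (dc Q x c)) :=
    (continuous_snd.tendsto _).comp ht
  have h3 : Tendsto (fun y => N * weight α g0 (G c) * (1 + y)) (𝓝[≠] x)
      (𝓝 (N * weight α g0 (G c) * (1 + x))) :=
    (Continuous.tendsto (by fun_prop) x).mono_left nhdsWithin_le_nhds
  have he : ∀ᶠ y in 𝓝[≠] x, Estimates α δ lam N (weight α g0 (G c)) Q y c := by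
    filter_upwards [mem_nhdsWithin_of_mem_nhds (lt_mem_nhds hx),
      eventually_offBoundaries (boundaries α δ lam cI cbar g0 F G Fb Gb) x c] with y hy ho
    exact M.estimates hN hy hc ho
  exact ⟨ge_of_tendsto h1 (he.mono fun y h => h.dx_nonneg),
    le_of_tendsto (h1.add h2) (he.mono fun y h => h.sum_le),
    le_of_tendsto_of_tendsto h1 h3 (he.mono fun y h => h.dx_le)⟩

/-- Moving the fitting point z from F(c) to x raises the fitted solution at x, since the gap is
positive up to f₀; at z = x it equals δx². -/
theorem le_payoff_of_le_half {x c : ℝ} (hx : 0 ≤ x) (hc : 0 < c) (h : x ≤ 1 / (2 * δ)) :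
    Q x c ≤ δ * x ^ 2 := by
  rcases le_or_gt x (F c) with hF | hF
  · exact (M.cand.onI x c ⟨hc, hx, hF⟩).le
  rw [M.eq_on_II hc hF.le (h.trans (M.bd.half_lt_G hc).le)]
  have hd : ∀ z, HasDerivAt (fun z => sol α δ lam 0 z x) (solC α δ lam 0 z 0 1 x) z := by
    intro z
    simpa using hasDerivAt_sol_curve M.reg (hasDerivAt_const z 0) (hasDerivAt_id z)
      (hasDerivAt_const z x)
  have hmono : MonotoneOn (fun z => sol α δ lam 0 z x) (Icc (F c) x) := by
    refine monotoneOn_of_deriv_nonneg (convex_Icc _ _)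
      (fun z _ => (hd z).continuousAt.continuousWithinAt)
      (fun z _ => (hd z).differentiableAt.differentiableWithinAt) fun z hz => ?_
    rw [interior_Icc] at hz
    rw [(hd z).deriv, solC_zero]
    have h1 := M.reg.gap_zero_pos (z := z) ((M.bd.F_pos c hc.le).le.trans hz.1.le)
      (hz.2.le.trans (h.trans M.reg.half_lt_f0.le))
    have h2 := M.reg.k_pos
    have h3 : 0 ≤ Real.sinh (√(2 * α) * (x - z)) :=
      Real.sinh_nonneg_iff.2 (mul_nonneg h2.le (sub_nonneg.2 hz.2.le))
    positivity
  have := hmono ⟨le_rfl, hF.le⟩ ⟨hF.le, le_rfl⟩ hF.le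
  simpa using this

theorem le_payoff {x c : ℝ} (hx : 0 ≤ x) (hc : 0 ≤ c) : Q x c ≤ δ * x ^ 2 := by
  rcases hc.eq_or_lt with rfl | hc
  · rw [M.cand.noFuel x hx]; exact M.reg.V0_le x
  rcases le_or_gt x (1 / (2 * δ)) with h | h
  · exact M.le_payoff_of_le_half hx hc h
  have hδ := M.reg.δ_pos
  have hh : 0 < 1 / (2 * δ) := by positivity
  obtain ⟨N, hN⟩ := exists_boundConst M.reg cI (f0 α δ lam + α / (2 * lam))
  -- Descend the diagonal until the fuel is exhausted or x reaches 1/(2δ); on the way 2δx ≥ 1 ≥ D.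
  set s := min c (x - 1 / (2 * δ)) with hs
  have hs0 : 0 < s := lt_min hc (sub_pos.2 h)
  have hsc : s ≤ c := min_le_left _ _
  have hsx : s ≤ x - 1 / (2 * δ) := min_le_right _ _
  have hend : Q (x - s) (c - s) ≤ δ * (x - s) ^ 2 := by
    rcases le_total c (x - 1 / (2 * δ)) with k | k
    · rw [hs, min_eq_left k, sub_self, M.cand.noFuel _ (by linarith)]
      exact M.reg.V0_le _
    · rcases k.eq_or_lt with k | k
      · rw [hs, k, min_self, sub_self, M.cand.noFuel _ (by linarith)]
        exact M.reg.V0_le _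
      · refine M.le_payoff_of_le_half (by linarith) ?_ ?_ <;>
          rw [hs, min_eq_right k.le] <;> linarith
  have hder : ∀ u ∈ Ioo 0 s, HasDerivAt (fun u => δ * (x - u) ^ 2 - Q (x - u) (c - u))
      (-(2 * δ * (x - u)) + (dx Q (x - u) (c - u) + dc Q (x - u) (c - u))) u := by
    intro u hu
    have hxu : 0 < x - u := by linarith [hu.2]
    have hcu : 0 < c - u := by linarith [hu.2]
    have h1 := hasDerivAt_diag (M.contDiffAt_pos hxu hcu)
    have hg := M.grad_eq hxu hcu
    rw [show fderiv ℝ (fun p : ℝ × ℝ => Q p.1 p.2) (x - u, c - u) (1, 0) = dx Q (x - u) (c - u)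
      from congrArg Prod.fst hg, show fderiv ℝ (fun p : ℝ × ℝ => Q p.1 p.2) (x - u, c - u) (0, 1) =
      dc Q (x - u) (c - u) from congrArg Prod.snd hg, ← sub_self u] at h1
    have h2 := h1.comp_const_sub u u
    have h3 : HasDerivAt (fun u => δ * (x - u) ^ 2) (-(2 * δ * (x - u))) u :=
      (hasDerivAt_sq_mul (δ := δ) (x - u)).comp_const_sub x u
    refine ((h3.sub h2).congr_deriv (by ring)).congr_of_eventuallyEq
      (Eventually.of_forall fun w => ?_)
    simp only [Pi.sub_apply]
    congr 2 <;> ring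
  have hcont : ContinuousOn (fun u => δ * (x - u) ^ 2 - Q (x - u) (c - u)) (Icc 0 s) := by
    refine ContinuousOn.sub (by fun_prop) ?_
    refine ContinuousOn.comp (f := fun u : ℝ => (x - u, c - u)) M.cand.cont (by fun_prop) ?_
    intro u hu
    exact ⟨show 0 ≤ x - u by linarith [hu.2], show 0 ≤ c - u by linarith [hu.2]⟩
  have hanti : AntitoneOn (fun u => δ * (x - u) ^ 2 - Q (x - u) (c - u)) (Icc 0 s) := by
    refine antitoneOn_of_deriv_nonpos (convex_Icc _ _) hcont ?_ ?_ <;> rw [interior_Icc] <;>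
      intro u hu
    · exact (hder u hu).differentiableAt.differentiableWithinAt
    rw [(hder u hu).deriv]
    have hxu : 1 / (2 * δ) < x - u := by linarith [hu.2]
    have h1 := (M.gradient_bounds hN (x := x - u) (c := c - u) (by linarith)
      (by linarith [hu.2])).2.1
    rw [div_lt_iff₀ (by positivity)] at hxu
    linarith
  have := hanti ⟨le_rfl, hs0.le⟩ ⟨hs0.le, le_rfl⟩ hs0.le
  simp only [sub_zero] at this
  linarith

end Model

end

section

/-! ### The even extension -/

section EvenExt

variable {Q : ℝ → ℝ → ℝ} {x c : ℝ}

theorem evenExt_neg (Q : ℝ → ℝ → ℝ) (x c : ℝ) : evenExt Q (-x) c = evenExt Q x c := by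
  simp [evenExt]

theorem evenExt_of_nonneg (hx : 0 ≤ x) : evenExt Q x c = Q x c := by
  rw [evenExt, abs_of_nonneg hx]

theorem evenExt_eventuallyEq (hx : 0 < x) :
    (fun y => evenExt Q y c) =ᶠ[𝓝 x] fun y => Q y c := by
  filter_upwards [lt_mem_nhds hx] with y hy using evenExt_of_nonneg (le_of_lt hy)

theorem dx_evenExt (hx : 0 < x) : dx (evenExt Q) x c = dx Q x c :=
  (evenExt_eventuallyEq hx).deriv_eq

theorem dc_evenExt (hx : 0 ≤ x) : dc (evenExt Q) x c = dc Q x c := by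
  rw [dc, dc]
  congr 1
  funext d
  exact evenExt_of_nonneg hx

theorem dxx_evenExt (hx : 0 < x) : dxx (evenExt Q) x c = dxx Q x c := by
  refine EventuallyEq.deriv_eq ?_
  filter_upwards [lt_mem_nhds hx] with y hy using dx_evenExt hy

theorem generatorTerm_evenExt {α lam : ℝ} (hx : 0 < x) :
    generatorTerm α lam (evenExt Q) x c = generatorTerm α lam Q x c := by
  rw [generatorTerm, generatorTerm, dxx_evenExt hx, evenExt_of_nonneg hx.le]

theorem dx_evenExt_neg (Q : ℝ → ℝ → ℝ) (x c : ℝ) :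
    dx (evenExt Q) (-x) c = -dx (evenExt Q) x c := by
  have h := deriv_comp_neg (f := fun y => evenExt Q y c) (-x)
  simp only [evenExt_neg, neg_neg] at h
  exact h

theorem dc_evenExt_neg (Q : ℝ → ℝ → ℝ) (x c : ℝ) :
    dc (evenExt Q) (-x) c = dc (evenExt Q) x c := by
  simp [dc, evenExt_neg]

theorem dxx_evenExt_neg (Q : ℝ → ℝ → ℝ) (x c : ℝ) :
    dxx (evenExt Q) (-x) c = dxx (evenExt Q) x c := by
  have h := deriv_comp_neg (f := fun y => dx (evenExt Q) y c) (-x)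
  simp only [dx_evenExt_neg, neg_neg, deriv.fun_neg, neg_inj] at h
  exact h

theorem generatorTerm_evenExt_neg (α lam : ℝ) (Q : ℝ → ℝ → ℝ) (x c : ℝ) :
    generatorTerm α lam (evenExt Q) (-x) c = generatorTerm α lam (evenExt Q) x c := by
  rw [generatorTerm, generatorTerm, dxx_evenExt_neg, evenExt_neg, neg_sq]

theorem contDiffAt_evenExt_neg {n : WithTop ℕ∞}
    (h : ContDiffAt ℝ n (fun y => evenExt Q y c) x) :
    ContDiffAt ℝ n (fun y => evenExt Q y c) (-x) := by
  have h1 : ContDiffAt ℝ n (fun y => evenExt Q y c) (- -x) := by rwa [neg_neg]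
  have := ContDiffAt.comp (f := fun y : ℝ => -y) (-x) h1 (by fun_prop)
  exact this.congr_of_eventuallyEq (Eventually.of_forall fun y => (evenExt_neg Q y c).symm)

theorem neg_mem_offBoundaries {n : ℕ} {b : Fin n → MovingBoundary}
    (hx : x ∈ offBoundaries b c) : -x ∈ offBoundaries b c := by
  intro i hi
  obtain ⟨h1, h2⟩ := hx i hi
  exact ⟨fun h => h2 (by linarith), fun h => h1 (by linarith)⟩

end EvenExt

namespace Model

variable {α δ lam cI cbar g0 : ℝ} {F G Fb Gb : ℝ → ℝ} {Q : ℝ → ℝ → ℝ}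
  (M : Model α δ lam cI cbar g0 F G Fb Gb Q)

include M

/-- The kink of |x| at 0 is harmless because near 0 the function is δx² at every level. -/
theorem evenExt_eventuallyEq_zero {c : ℝ} (hc : 0 ≤ c) :
    (fun y => evenExt Q y c) =ᶠ[𝓝 0] fun y => δ * y ^ 2 := by
  rcases hc.eq_or_lt with rfl | hc
  · filter_upwards [Ioo_mem_nhds (neg_neg_of_pos M.reg.f0_pos) M.reg.f0_pos] with y hy
    rw [evenExt, M.cand.noFuel _ (abs_nonneg y), V0_of_le (abs_le.2 ⟨hy.1.le, hy.2.le⟩), sq_abs]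
  · have hF := M.bd.F_pos c hc.le
    filter_upwards [Ioo_mem_nhds (neg_neg_of_pos hF) hF] with y hy
    rw [evenExt, M.cand.onI |y| c ⟨hc, abs_nonneg y, abs_le.2 ⟨hy.1.le, hy.2.le⟩⟩, sq_abs]

theorem evenExt_derivs_zero {c : ℝ} (hc : 0 ≤ c) :
    dx (evenExt Q) 0 c = 0 ∧ dxx (evenExt Q) 0 c = 2 * δ ∧
      generatorTerm α lam (evenExt Q) 0 c = δ ∧ evenExt Q 0 c = 0 := by
  have he := M.evenExt_eventuallyEq_zero hc
  obtain ⟨e1, e2⟩ := dxx_eq_of_eventuallyEq (f' := fun y => 2 * δ * y) he hasDerivAt_sq_mul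
    (by simpa using hasDerivAt_two_mul_shift 0 0)
  have e3 : evenExt Q 0 c = 0 := he.eq_of_nhds.trans (by simp)
  exact ⟨e1.trans (mul_zero _), e2, by rw [generatorTerm, e2, e3]; ring, e3⟩

theorem dc_evenExt_zero {c : ℝ} (hc : 0 < c) : dc (evenExt Q) 0 c = 0 := by
  have : (fun d => evenExt Q 0 d) =ᶠ[𝓝 c] fun _ => 0 := by
    filter_upwards [lt_mem_nhds hc] with d hd using (M.evenExt_derivs_zero (le_of_lt hd)).2.2.2
  exact this.deriv_eq.trans (deriv_const _ _)

theorem noFuel_eventuallyEq {x : ℝ} (hx : 0 < x) :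
    (fun y => Q y 0) =ᶠ[𝓝 x] V0 α δ lam := by
  filter_upwards [lt_mem_nhds hx] with y hy using M.cand.noFuel y (le_of_lt hy)

variable {N : ℝ} (hN : BoundConst α δ lam cI (f0 α δ lam + α / (2 * lam)) N)

include hN

theorem noFuel_second_order {x : ℝ} (hx : 0 < x) (hf : x ≠ f0 α δ lam) :
    ContDiffAt ℝ 2 (fun y => Q y 0) x ∧ |dxx Q x 0| ≤ N * Real.exp (√(2 * α) * x) ∧
      0 ≤ generatorTerm α lam Q x 0 := by
  have hV := M.noFuel_eventuallyEq hx
  rcases lt_or_gt_of_ne hf with h | h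
  · have he : (fun y => Q y 0) =ᶠ[𝓝 x] fun y => δ * y ^ 2 := by
      filter_upwards [hV, gt_mem_nhds h] with y h1 h2 using h1.trans (V0_of_le (le_of_lt h2))
    have e2 := (dxx_eq_of_eventuallyEq (f' := fun y => 2 * δ * y) he hasDerivAt_sq_mul
      (by simpa using hasDerivAt_two_mul_shift 0 x)).2
    refine ⟨ContDiffAt.congr_of_eventuallyEq (by fun_prop) he,
      by rw [e2]; exact hN.stop_le M.reg hx.le, ?_⟩
    have h1 : generatorTerm α lam Q x 0 = gap α δ lam 0 x := by
      rw [generatorTerm, e2, he.eq_of_nhds, gap]; ring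
    rw [h1]
    exact (M.reg.gap_zero_pos hx.le h.le).le
  · have he : (fun y => Q y 0) =ᶠ[𝓝 x] sol α δ lam 0 (f0 α δ lam) := by
      filter_upwards [hV, lt_mem_nhds h] with y h1 h2 using
        h1.trans (M.reg.V0_of_ge (le_of_lt h2))
    have e2 := (dxx_eq_of_eventuallyEq he (hasDerivAt_sol M.reg 0 (f0 α δ lam))
      (hasDerivAt_solX M.reg 0 (f0 α δ lam) x)).2
    refine ⟨(contDiff_sol_right 0 (f0 α δ lam)).contDiffAt.congr_of_eventuallyEq he, ?_, ?_⟩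
    · rw [e2]
      exact hN.solXX_le M.reg ⟨le_rfl, M.bd.cI_nonneg⟩ M.f0_mem h.le le_rfl
    · have h1 : generatorTerm α lam Q x 0 = 0 := by
        rw [generatorTerm, e2, he.eq_of_nhds, solXX_eq M.reg]; ring
      exact h1.ge

theorem second_order_of_nonneg {x c : ℝ} (hx : 0 ≤ x) (hc : 0 ≤ c)
    (ho : x ∈ offBoundaries (boundaries α δ lam cI cbar g0 F G Fb Gb) c) :
    ContDiffAt ℝ 2 (fun y => evenExt Q y c) x ∧
      |dxx (evenExt Q) x c| ≤ N * Real.exp (√(2 * α) * x) ∧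
      0 ≤ generatorTerm α lam (evenExt Q) x c := by
  rcases hx.eq_or_lt with rfl | hx
  · obtain ⟨-, e2, e3, -⟩ := M.evenExt_derivs_zero hc
    rw [e2, e3]
    exact ⟨ContDiffAt.congr_of_eventuallyEq (by fun_prop) (M.evenExt_eventuallyEq_zero hc),
      hN.stop_le M.reg le_rfl, M.reg.δ_pos.le⟩
  rw [dxx_evenExt hx, generatorTerm_evenExt hx]
  have key : ContDiffAt ℝ 2 (fun y => Q y c) x ∧ |dxx Q x c| ≤ N * Real.exp (√(2 * α) * x) ∧
      0 ≤ generatorTerm α lam Q x c := by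
    rcases hc.eq_or_lt with rfl | hc
    · refine M.noFuel_second_order hN hx ?_
      simpa using (offBoundaries_iff ho).2.2.1 le_rfl
    · have h := M.estimates hN hx hc ho
      exact ⟨h.contDiffAt, h.dxx_le, h.generator⟩
  exact ⟨key.1.congr_of_eventuallyEq (evenExt_eventuallyEq hx), key.2⟩

theorem second_order {x c : ℝ} (hc : 0 ≤ c)
    (ho : x ∈ offBoundaries (boundaries α δ lam cI cbar g0 F G Fb Gb) c) :
    ContDiffAt ℝ 2 (fun y => evenExt Q y c) x ∧
      |dxx (evenExt Q) x c| ≤ N * Real.exp (√(2 * α) * |x|) ∧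
      0 ≤ generatorTerm α lam (evenExt Q) x c := by
  rcases le_total 0 x with hx | hx
  · rw [abs_of_nonneg hx]
    exact M.second_order_of_nonneg hN hx hc ho
  · have h := M.second_order_of_nonneg hN (neg_nonneg.2 hx) hc (neg_mem_offBoundaries ho)
    rw [dxx_evenExt_neg, generatorTerm_evenExt_neg] at h
    rw [abs_of_nonpos hx]
    have h1 := contDiffAt_evenExt_neg h.1
    rw [neg_neg] at h1
    exact ⟨h1, h.2⟩

/-- G(0) carries no information, so the weight uses G with that value replaced by l; at c = 0 any l
works here, and the limit of G is chosen later to make the weight continuous. -/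
theorem growth_of_nonneg {l : ℝ} {x c : ℝ} (hx : 0 ≤ x) (hc : 0 ≤ c) :
    DifferentiableAt ℝ (fun y => evenExt Q y c) x ∧
      |dx (evenExt Q) x c| ≤ N * weight α g0 (Function.update G 0 l c) * (1 + x) := by
  have hw := one_le_weight α g0 (Function.update G 0 l c)
  have hN0 := hN.pos
  rcases hx.eq_or_lt with rfl | hx
  · have he := M.evenExt_eventuallyEq_zero hc
    refine ⟨DifferentiableAt.congr_of_eventuallyEq (by fun_prop) he, ?_⟩
    rw [(M.evenExt_derivs_zero hc).1, abs_zero]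
    positivity
  rw [dx_evenExt hx]
  have key : DifferentiableAt ℝ (fun y => Q y c) x ∧ 0 ≤ dx Q x c ∧
      dx Q x c ≤ N * weight α g0 (Function.update G 0 l c) * (1 + x) := by
    rcases hc.eq_or_lt with rfl | hc
    · have hV := M.noFuel_eventuallyEq hx
      have hd := M.reg.hasDerivAt_V0 x
      have e1 : dx Q x 0 = V0X α δ lam x := hV.deriv_eq.trans hd.deriv
      rw [e1]
      refine ⟨hd.differentiableAt.congr_of_eventuallyEq hV, M.reg.V0X_nonneg hx.le,
        hN.le_of_le hw hx.le ?_⟩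
      have h2 := mul_le_mul_of_nonneg_left hw hN0.le
      rcases le_total x (f0 α δ lam) with h | h
      · rw [V0X_of_le h]
        have := mul_le_mul_of_nonneg_right hN.payoff hx.le
        linarith
      · rw [V0X_of_ge h]
        have := mul_le_mul_of_nonneg_right hN.run hx.le
        linarith [M.reg.solX_f0_le h, hN.tail]
    · have h := M.gradient_bounds hN hx hc
      rw [Function.update_of_ne hc.ne']
      exact ⟨(M.hasDerivAt_dx hx hc).differentiableAt, h.1, h.2.2⟩
  rw [abs_of_nonneg key.2.1]
  exact ⟨key.1.congr_of_eventuallyEq (evenExt_eventuallyEq hx), key.2.2⟩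

theorem growth {l : ℝ} {x c : ℝ} (hc : 0 ≤ c) :
    DifferentiableAt ℝ (fun y => evenExt Q y c) x ∧
      |dx (evenExt Q) x c| ≤ N * weight α g0 (Function.update G 0 l c) * (1 + |x|) := by
  rcases le_total 0 x with hx | hx
  · rw [abs_of_nonneg hx]
    exact M.growth_of_nonneg hN hx hc
  · have h := M.growth_of_nonneg hN (l := l) (neg_nonneg.2 hx) hc
    rw [dx_evenExt_neg, abs_neg] at h
    rw [abs_of_nonpos hx]
    refine ⟨?_, h.2⟩
    have := DifferentiableAt.comp (f := fun y : ℝ => -y) x h.1 (by fun_prop)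
    exact this.congr_of_eventuallyEq (Eventually.of_forall fun y => (evenExt_neg Q y c).symm)

theorem gradient_of_nonneg {x c : ℝ} (hx : 0 ≤ x) (hc : 0 < c) :
    |dx (evenExt Q) x c| + dc (evenExt Q) x c ≤ 1 := by
  rcases hx.eq_or_lt with rfl | hx
  · rw [(M.evenExt_derivs_zero hc.le).1, M.dc_evenExt_zero hc]; norm_num
  · have h := M.gradient_bounds hN hx hc
    rw [dx_evenExt hx, dc_evenExt hx.le, abs_of_nonneg h.1]
    exact h.2.1

theorem complementarity_of_nonneg {x c : ℝ} (hx : 0 ≤ x) (hc : 0 < c)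
    (ho : x ∈ offBoundaries (boundaries α δ lam cI cbar g0 F G Fb Gb) c) :
    (δ * x ^ 2 - evenExt Q x c) * (1 - |dx (evenExt Q) x c| - dc (evenExt Q) x c) *
      generatorTerm α lam (evenExt Q) x c = 0 := by
  rcases hx.eq_or_lt with rfl | hx
  · rw [(M.evenExt_derivs_zero hc.le).2.2.2]; ring
  · have h := M.estimates hN hx hc ho
    rw [dx_evenExt hx, dc_evenExt hx.le, abs_of_nonneg h.dx_nonneg, evenExt_of_nonneg hx.le,
      generatorTerm_evenExt hx]
    exact h.compl

omit hN

/-- The weight inherits continuity and strict monotonicity from G, extended to c = 0 by its right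
limit. -/
theorem growth_weight {l : ℝ} (hl : Tendsto G (𝓝[>] 0) (𝓝 l)) (hN : 0 < N) :
    ContinuousOn (fun c => N * weight α g0 (Function.update G 0 l c)) (Ici 0) ∧
      StrictMonoOn (fun c => N * weight α g0 (Function.update G 0 l c)) (Ici 0) := by
  have hk := M.reg.k_pos
  constructor
  · have hc : ContinuousOn (Function.update G 0 l) (Ici 0) := by
      intro c hc
      rcases (mem_Ici.1 hc).eq_or_lt with rfl | hc
      · rw [continuousWithinAt_update_same, Ici_sdiff_left]
        exact hl
      · refine ContinuousAt.continuousWithinAt ((M.bd.G_continuousAt hc).congr ?_)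
        filter_upwards [lt_mem_nhds hc] with d hd
        exact (Function.update_of_ne (ne_of_gt hd) _ _).symm
    unfold weight
    fun_prop
  · have hm : StrictMonoOn (Function.update G 0 l) (Ici 0) := by
      intro a ha b _ hab
      have hb : 0 < b := lt_of_le_of_lt ha hab
      rw [Function.update_of_ne hb.ne']
      rcases (mem_Ici.1 ha).eq_or_lt with rfl | ha
      · rw [Function.update_self]
        exact gt_of_strictMonoOn_of_tendsto Ioc_subset_Ioi_self M.bd.G_strictMonoOn hl hb
      · rw [Function.update_of_ne ha.ne']
        exact M.bd.G_strictMonoOn ha hb hab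
    intro a ha b hb hab
    have h := Real.exp_lt_exp.2 (mul_lt_mul_of_pos_left (hm ha hb hab) hk)
    refine mul_lt_mul_of_pos_left ?_ hN
    unfold weight
    linarith

theorem continuousOn_evenExt :
    ContinuousOn (fun p : ℝ × ℝ => evenExt Q p.1 p.2) (univ ×ˢ Ici 0) :=
  ContinuousOn.comp (f := fun p : ℝ × ℝ => (|p.1|, p.2)) M.cand.cont (by fun_prop)
    fun p hp => ⟨abs_nonneg p.1, hp.2⟩

theorem contDiffAt_evenExt_of_pos {x c : ℝ} (hx : 0 < x) (hc : 0 < c) :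
    ContDiffAt ℝ 1 (fun p : ℝ × ℝ => evenExt Q p.1 p.2) (x, c) := by
  refine (M.contDiffAt_pos hx hc).congr_of_eventuallyEq ?_
  filter_upwards [(continuous_fst.tendsto (x, c)).eventually (lt_mem_nhds hx)] with p hp
  exact evenExt_of_nonneg (le_of_lt hp)

theorem contDiffAt_evenExt {x c : ℝ} (hc : 0 < c) :
    ContDiffAt ℝ 1 (fun p : ℝ × ℝ => evenExt Q p.1 p.2) (x, c) := by
  rcases lt_trichotomy x 0 with hx | rfl | hx
  · have h := ContDiffAt.comp (f := fun p : ℝ × ℝ => (-p.1, p.2)) (x, c)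
      (M.contDiffAt_evenExt_of_pos (neg_pos.2 hx) hc) (by fun_prop)
    exact h.congr_of_eventuallyEq (Eventually.of_forall fun p => (evenExt_neg Q p.1 p.2).symm)
  · refine ContDiffAt.congr_of_eventuallyEq (f := fun p : ℝ × ℝ => δ * p.1 ^ 2) (by fun_prop) ?_
    have hF := M.bd.F_pos c hc.le
    have h1 : ∀ᶠ p : ℝ × ℝ in 𝓝 (0, c), |p.1| < F p.2 :=
      (continuous_fst.abs.continuousAt).eventually_lt
        ((M.bd.F_continuousAt hc).comp' (f := Prod.snd) continuous_snd.continuousAt) (by simpa)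
    filter_upwards [h1, eventually_snd (lt_mem_nhds hc)] with p k1 k2
    rw [evenExt, M.cand.onI |p.1| p.2 ⟨k2, abs_nonneg _, k1.le⟩, sq_abs]
  · exact M.contDiffAt_evenExt_of_pos hx hc

theorem piecewise (i : Fin 8) :
    (boundaries α δ lam cI cbar g0 F G Fb Gb i).PiecewiseC1 := by
  have hline : ∀ (s : Set ℝ) (f : ℝ → ℝ), ContDiff ℝ 1 f → s.OrdConnected → s ⊆ Ici 0 →
      (⟨s, f⟩ : MovingBoundary).PiecewiseC1 := fun s f hf h1 h2 =>
    ⟨h1, h2, hf.continuous.continuousOn, ∅, finite_empty, hf.contDiffOn⟩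
  fin_cases i
  · refine ⟨ordConnected_Ioi, Ioi_subset_Ici_self, M.bd.F_cont.mono inter_subset_left, {cbar},
      finite_singleton _, ?_⟩
    exact M.bd.F_C1.mono (sdiff_subset_sdiff_left interior_subset)
  · refine ⟨ordConnected_Ioi, Ioi_subset_Ici_self, M.bd.G_cont.mono inter_subset_left, {cbar},
      finite_singleton _, ?_⟩
    exact M.bd.G_C1.mono (sdiff_subset_sdiff_left interior_subset)
  · refine ⟨ordConnected_Ioc, fun c hc => hc.1.le, M.bd.Fb_cont.mono inter_subset_left, ∅,
      finite_empty, ?_⟩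
    exact M.bd.Fb_C1.mono (sdiff_subset.trans interior_Ioc.subset)
  · refine ⟨ordConnected_Ioc, fun c hc => hc.1.le, M.bd.Gb_cont.mono inter_subset_left, ∅,
      finite_empty, ?_⟩
    exact M.bd.Gb_C1.mono (sdiff_subset.trans interior_Ioc.subset)
  · exact hline _ _ (by fun_prop) ordConnected_Ici subset_rfl
  · exact hline _ _ (by fun_prop) ordConnected_Ici (Ici_subset_Ici.2 M.bd.cbar_pos.le)
  · exact hline _ _ (by fun_prop) ⟨fun a ha b _ c hc => ⟨ha.1, ha.2.trans hc.1⟩⟩ fun c hc => hc.2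
  · exact hline _ _ (by fun_prop) ⟨fun a ha b _ c hc => ⟨ha.1, ha.2.trans hc.1⟩⟩
      fun c hc => M.bd.cI_nonneg.trans hc.2

theorem verificationConditions :
    VerificationConditions α δ lam (evenExt Q) (boundaries α δ lam cI cbar g0 F G Fb Gb) := by
  obtain ⟨N, hN⟩ := exists_boundConst M.reg cI (f0 α δ lam + α / (2 * lam))
  obtain ⟨l, hl, -⟩ := M.bd.G_lim
  refine
    { piecewise := M.piecewise
      even := fun x c _ => evenExt_neg Q x c
      cont := M.continuousOn_evenExt
      contDiff := fun p hp => (M.contDiffAt_evenExt hp.2).contDiffWithinAt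
      contDiff_two := fun c hc x hx => (M.second_order hN hc hx).1
      dxx_locallyBounded := fun p _ => ⟨N * Real.exp (√(2 * α) * (|p.1| + 1)), ?_⟩
      growth := ⟨fun c => N * weight α g0 (Function.update G 0 l c), (M.growth_weight hl hN.pos).1,
        (M.growth_weight hl hN.pos).2, fun c _ => ?_, fun x c hc => M.growth hN hc⟩
      le_stop := fun x c hc => ?_
      gradient := fun x c hc => ?_
      generator := fun c hc x hx => (M.second_order hN hc hx).2.2
      complementarity := fun c hc x hx => ?_ }
  · have h : ∀ᶠ r : ℝ × ℝ in 𝓝 p, |r.1| < |p.1| + 1 :=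
      (continuous_fst.abs.tendsto p).eventually (gt_mem_nhds (lt_add_one _))
    filter_upwards [h] with r h1 h2 h3
    refine (M.second_order hN h2 h3).2.1.trans ?_
    have := hN.pos
    have := M.reg.k_pos
    gcongr
  · have := one_le_weight α g0 (Function.update G 0 l c)
    have := hN.pos
    positivity
  · have := M.le_payoff (abs_nonneg x) hc
    rwa [sq_abs] at this
  · rcases le_total 0 x with hx | hx
    · exact M.gradient_of_nonneg hN hx hc
    · have := M.gradient_of_nonneg hN (neg_nonneg.2 hx) hc
      rwa [dx_evenExt_neg, abs_neg, dc_evenExt_neg] at this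
  · rcases le_total 0 x with h0 | h0
    · exact M.complementarity_of_nonneg hN h0 hc hx
    · have := M.complementarity_of_nonneg hN (neg_nonneg.2 h0) hc (neg_mem_offBoundaries hx)
      rwa [dx_evenExt_neg, abs_neg, dc_evenExt_neg, generatorTerm_evenExt_neg, evenExt_neg,
        neg_sq] at this

end Model

end

end FuelControl

end

theorem theorem6p2 (α δ lam : ℝ) (hα : 0 < α) (hδ : 0 < δ)
    (hlam : lam ∈ Set.Ioo (FuelControl.lamStar α δ) (α * δ))
    (cI cbar g0 : ℝ) (F G Fb Gb : ℝ → ℝ)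
    (hregime : cI = 0 → α / (2 * lam) ≤ FuelControl.f0 α δ lam)
    (hbd : FuelControl.AdmissibleBoundaries α δ lam cI cbar g0 F G Fb Gb)
    (Q : ℝ → ℝ → ℝ) (hQ : FuelControl.IsCandidate α δ lam cI cbar F G Fb Gb Q) :
    FuelControl.VerificationConditions α δ lam (FuelControl.evenExt Q)
      (FuelControl.boundaries α δ lam cI cbar g0 F G Fb Gb) := by
  exact FuelControl.Model.verificationConditions
    ⟨FuelControl.regime_of_mem hα hδ hlam, hregime, hbd, hQ⟩
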